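/- Let $0<q<1$, $\alpha>0$, $\beta<0$, and let $(\gamma,\delta)$ be a pair of one of the following two kinds: either $\gamma=\bar\delta\in\mathbb C\setminus\mathbb R$; or $\gamma,\delta$ are real and lie together in one of the open intervals between neighbouring points of $\{\alpha q^n:n\in\mathbb Z\}\subset(0,\infty)$, or together in one of the open intervals between neighbouring points of $\{\beta q^n:n\in\mathbb Z\}\subset(-\infty,0)$. Put $(z;q)_\infty=\prod_{i\ge0}(1-zq^i)$ and $\Delta_{q,\alpha,\beta}=\{\beta^{-1}q^k:k\ge1\}\cup\{\alpha^{-1}q^k:k\ge1\}\subset\mathbb R\setminus\{0\}$. For suitable $(c,d)$ let $\varphi_\ell(x;q,\alpha,\beta,c,d)$, $\ell=0,1,2,\dots$, be the monic orthogonal polynomials (big $q$-Jacobi polynomials) on $\Delta_{q,\alpha,\beta}$ with weight $$W(x;q,\alpha,\beta,c,d)=|x|\,\frac{(\alpha x;q)_\infty(\beta x;q)_\infty}{(cx;q)_\infty(dx;q)_\infty}.$$ For a partition $\lambda$ and $N\ge\ell(\lambda)$ let $$\varphi_{\lambda\mid N}(x_1,\dots,x_N;q,\alpha,\beta,c,d)=\frac{\det[\varphi_{\lambda_i+N-i}(x_j;q,\alpha,\beta,c,d)]_{i,j=1}^N}{\prod_{1\le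 i<j\le N}(x_i-x_j)},$$ and let $\Phi_\lambda=\Phi_\lambda(\,\cdot\,;q,\alpha,\beta,\gamma,\delta)$ be the limit, as $N\to\infty$, of $\varphi_{\lambda\mid N}(\,\cdot\,;q,\alpha,\beta,\gamma q^{1-N},\delta q^{1-N})$ in the algebra $\mathrm{Sym}$ of symmetric functions over $\mathbb R$. Here a sequence $F_N$ of symmetric polynomials in $N$ variables of uniformly bounded degree converges to $F\in\mathrm{Sym}$ if for all large $d$ the preimages of the $F_N$ ($N\ge d$) under the isomorphisms $\mathrm{Sym}_{\le d}\to\mathrm{Sym}(N)_{\le d}$ converge to $F$ in the finite-dimensional space $\mathrm{Sym}_{\le d}$. Let $\Omega$ be the compact space of all configurations (subsets) $X\subseteq\Delta_{q,\alpha,\beta}$, identified with $\{0,1\}^{\Delta_{q,\alpha,\beta}}$ with the product topology; each $F\in\mathrm{Sym}$ is a function $X\mapsto F(X)$ on $\Omega$, obtained by substituting the points of $X$ (and zeros, if $X$ is finite) for the variables. Then there is exactly one probability Borel measure $M^{q,\alpha,\beta,\gamma,\delta}$ on $\Omega$ such that the functions $\Phi_\lambda$, with $\lambda$ ranging over all partitions,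 form an orthogonal basis of $L^2(\Omega,M^{q,\alpha,\beta,\gamma,\delta})$, and this measure is concentrated on the subset $\Omega_\infty\subset\Omega$ of infinite configurations: $M^{q,\alpha,\beta,\gamma,\delta}(\Omega\setminus\Omega_\infty)=0$. -/

import Mathlib

open Filter Topology MeasureTheory

noncomputable section

namespace BigQJacobi

/-- The infinite `q`-Pochhammer symbol `(z; q)_∞ = ∏_{i ≥ 0} (1 - z q^i)`. -/
def qPochInf (q : ℝ) (z : ℂ) : ℂ := ∏' i : ℕ, (1 - z * (q : ℂ) ^ i)

/-- The lattice `Δ_{q,a,b} = {b⁻¹ q^k : k ≥ 1} ∪ {a⁻¹ q^k : k ≥ 1}`. -/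
def lattice (q a b : ℝ) : Set ℝ :=
  {x | ∃ k : ℕ, x = b⁻¹ * q ^ (k + 1) ∨ x = a⁻¹ * q ^ (k + 1)}

/-- The weight `W(x) = |x| (ax;q)_∞ (bx;q)_∞ / ((cx;q)_∞ (dx;q)_∞)`. The expression is real for the
pairs `(c, d)` of interest (complex conjugate, or both real), whence the real part. -/
def weight (q a b : ℝ) (c d : ℂ) (x : ℝ) : ℝ :=
  |x| * (qPochInf q (a * x) * qPochInf q (b * x) / (qPochInf q (c * x) * qPochInf q (d * x))).re

/-- `p` is the monic orthogonal polynomial of degree `l` on `Δ_{q,a,b}` for the weight `W`. -/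
def IsMonicOrthogonal (q a b : ℝ) (c d : ℂ) (l : ℕ) (p : Polynomial ℝ) : Prop :=
  p.Monic ∧ p.natDegree = l ∧
    ∀ k < l, ∑' x : lattice q a b, p.eval (x : ℝ) * (x : ℝ) ^ k * weight q a b c d x = 0

open Classical in
/-- The big `q`-Jacobi polynomial `φ_l(x; q, a, b, c, d)`: the monic orthogonal polynomial of
degree `l` for the weight `W` (with the value `0` if there is none). -/
def bigQJacobi (q a b : ℝ) (c d : ℂ) (l : ℕ) : Polynomial ℝ :=
  if h : ∃ p, IsMonicOrthogonal q a b c d l p then h.choose else 0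

/-- The numerator `det[φ_{μ_i + N - i}(x_j)]` (rows and columns are numbered from `0`, and
`μ.rowLen i` is the `(i+1)`-st part of the partition `μ`). -/
def altNumerator (q a b : ℝ) (c d : ℂ) (N : ℕ) (μ : YoungDiagram) : MvPolynomial (Fin N) ℝ :=
  (Matrix.of fun i j : Fin N =>
    Polynomial.aeval (MvPolynomial.X j : MvPolynomial (Fin N) ℝ)
      (bigQJacobi q a b c d (μ.rowLen i + (N - 1 - i)))).det

/-- The Vandermonde product `∏_{i < j} (x_i - x_j)`. -/
def vandermondeProd (N : ℕ) : MvPolynomial (Fin N) ℝ :=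
  ∏ i : Fin N, ∏ j ∈ Finset.Ioi i, (MvPolynomial.X i - MvPolynomial.X j)

open Classical in
/-- The `N`-variate symmetric big `q`-Jacobi polynomial
`φ_{μ|N} = det[φ_{μ_i + N - i}(x_j)] / ∏_{i < j} (x_i - x_j)`, the quotient being taken in the
ring of polynomials (the division is exact). -/
def multiBigQJacobi (q a b : ℝ) (c d : ℂ) (N : ℕ) (μ : YoungDiagram) : MvPolynomial (Fin N) ℝ :=
  if h : ∃ F, F * vandermondeProd N = altNumerator q a b c d N μ then h.choose else 0

/-- The algebra of symmetric functions over `ℝ`, presented as the polynomial algebra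
`ℝ[p₁, p₂, …]` in the power sums; the variable of index `k` is `p_{k+1}`. -/
abbrev Sym : Type := MvPolynomial ℕ ℝ

namespace Sym

/-- The degree of a symmetric function; the power sum `p_k` has degree `k`. -/
def degree (F : Sym) : ℕ := F.weightedTotalDegree (fun k : ℕ => k + 1)

/-- The canonical projection onto symmetric polynomials in `N` variables, sending the power sum
`p_k` to `x_1^k + ⋯ + x_N^k`. -/
def proj (N : ℕ) : Sym →ₐ[ℝ] MvPolynomial (Fin N) ℝ :=
  MvPolynomial.aeval fun k : ℕ => MvPolynomial.psum (Fin N) ℝ (k + 1)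

/-- Convergence `F_N → F` of symmetric polynomials in growing numbers of variables to a symmetric
function: for some `d` and all large `N`, the polynomial `F_N` is the projection of a symmetric
function `L_N` of degree at most `d` (it is unique as soon as `N ≥ d`), and `L_N → F` in the
finite-dimensional space of symmetric functions of degree at most `d`. -/
def Converges (f : (N : ℕ) → MvPolynomial (Fin N) ℝ) (F : Sym) : Prop :=
  ∃ (d : ℕ) (L : ℕ → Sym),
    (∀ᶠ N in atTop, (L N).degree ≤ d ∧ proj N (L N) = f N) ∧
    F.degree ≤ d ∧
    ∀ m : ℕ →₀ ℕ, Tendsto (fun N => (L N).coeff m) atTop (𝓝 (F.coeff m))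

end Sym

open Classical in
/-- The symmetric function `Φ_μ( · ; q, α, β, γ, δ)`, the limit as `N → ∞` of the polynomials
`φ_{μ|N}( · ; q, α, β, γ q^{1-N}, δ q^{1-N})` (with the value `0` if there is no limit). -/
def Phi (q α β : ℝ) (γ δ : ℂ) (μ : YoungDiagram) : Sym :=
  if h : ∃ F : Sym, Sym.Converges (fun N => multiBigQJacobi q α β
      (γ * (q : ℂ) ^ (1 - (N : ℤ))) (δ * (q : ℂ) ^ (1 - (N : ℤ))) N μ) F
  then h.choose else 0

/-- The space `Ω` of all configurations in (subsets of) `Δ_{q,α,β}`, identified with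
`{0,1}^Δ`. -/
def Config (q α β : ℝ) : Type := lattice q α β → Bool

/-- The product topology on `Ω`. -/
instance (q α β : ℝ) : TopologicalSpace (Config q α β) :=
  inferInstanceAs (TopologicalSpace (lattice q α β → Bool))

/-- The Borel `σ`-algebra of `Ω`. -/
instance (q α β : ℝ) : MeasurableSpace (Config q α β) := borel _

instance (q α β : ℝ) : BorelSpace (Config q α β) := ⟨rfl⟩

/-- The subset of `Δ_{q,α,β}` that a configuration stands for. -/
def Config.points {q α β : ℝ} (X : Config q α β) : Set ℝ :=
  {x | ∃ h : x ∈ lattice q α β, X ⟨x, h⟩ = true}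

/-- The set `Ω_∞` of infinite configurations. -/
def infiniteConfigs (q α β : ℝ) : Set (Config q α β) := {X | X.points.Infinite}

/-- The value `F(X)` of a symmetric function at a configuration `X`: the points of `X` are
substituted for the variables, so the power sum `p_k` takes the value `∑_{x ∈ X} x^k`. -/
def Sym.evalAt {q α β : ℝ} (F : Sym) (X : Config q α β) : ℝ :=
  MvPolynomial.aeval (fun k : ℕ => ∑' x : X.points, (x : ℝ) ^ (k + 1)) F

/-- `M` is a probability Borel measure on `Ω` for which the functions `Φ_μ` form an orthogonal
basis in the real Hilbert space `L²(Ω, M)`: they define nonzero, pairwise orthogonal elements of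
this space whose linear span is dense. -/
structure IsOrthogonalityMeasure (q α β : ℝ) (γ δ : ℂ) (M : Measure (Config q α β)) : Prop where
  isProbabilityMeasure : IsProbabilityMeasure M
  memLp : ∀ μ : YoungDiagram, MemLp (fun X => (Phi q α β γ δ μ).evalAt X) 2 M
  ne_zero : ∀ μ, (memLp μ).toLp ≠ 0
  orthogonal : ∀ μ ν, μ ≠ ν → inner ℝ (memLp μ).toLp (memLp ν).toLp = 0
  dense_span :
    (Submodule.span ℝ (Set.range fun μ => (memLp μ).toLp)).topologicalClosure = ⊤

/-- Admissible parameters: `α > 0`, `β < 0`, and either `γ` and `δ` are complex conjugate and not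
real, or they are real and lie in the same open interval between neighbouring points of
`{α q^n : n ∈ ℤ}`, or in the same open interval between neighbouring points of
`{β q^n : n ∈ ℤ}`. -/
def Admissible (q α β : ℝ) (γ δ : ℂ) : Prop :=
  0 < α ∧ β < 0 ∧
    ((γ.im ≠ 0 ∧ δ = (starRingEnd ℂ) γ) ∨
      ∃ c d : ℝ, γ = c ∧ δ = d ∧ ∃ n : ℤ,
        (c ∈ Set.Ioo (α * q ^ (n + 1)) (α * q ^ n) ∧ d ∈ Set.Ioo (α * q ^ (n + 1)) (α * q ^ n)) ∨
        (c ∈ Set.Ioo (β * q ^ n) (β * q ^ (n + 1)) ∧ d ∈ Set.Ioo (β * q ^ n) (β * q ^ (n + 1))))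

end BigQJacobi

end

/-!
# The big `q`-Jacobi symmetric functions form an orthogonal basis

Throughout, `s = γ + δ` and `p = γ δ`, which are real, and only these two numbers enter; `Regular`
collects the inequalities that make the weight positive on the lattice for all the parameters
`(γ q^m, δ q^m)`.

*Stabilisation.* The weight satisfies a Pearson equation, which gives a recurrence for its moments
and makes a second order `q`-difference operator symmetric. Comparing coefficients in the eigenvalue
equation yields the coefficients of the three term recurrence in closed form
(`IsBigQJacobiOPS.coeff_sub_one`, `IsBigQJacobiOPS.norm_ratio`). Number the polynomials with
parameters `(γ q^{1-N}, δ q^{1-N})` by `j`, where the degree is `N + j`. Then the recurrence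
coefficients converge as `N → ∞`, and they decay geometrically as `j → -∞`, uniformly in `N`
(`shifted_isStable`). Multiplication of the alternant `det [P_{w_i}(x_j)]` by a power sum
modifies the entries of the word `w` one at a time. Only finitely many modified words are
neither degenerate nor equal to `w`, and the sum of the diagonal contributions converges by
domination. Therefore, for every symmetric function `F`, the coefficients of `F · V` in the basis
of alternants converge, `V` being the Vandermonde product (`IsStableFamily.stabilises_proj`).

*The coefficient map.* The limits define a linear map `IsOrthogonalModel.fock` from `Sym` to
functions on partitions, which respects degrees. The coefficients of top degree do not depend on
`N`, so that the map is surjective in each degree, and it is injective because there are no more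
monomials in the power sums than partitions of the same size
(`IsOrthogonalModel.fock_injective`). The functions `Φ_ν` exist, and they are the preimages of the
unit vectors (`exists_converges`, `bigFock_Phi`).

*The measure.* The squares of the Vandermonde products, with the weight in each variable, define
probability measures on `N`-point configurations. By Andréief's identity the alternants are
orthogonal, with squared norms that are products of recurrence coefficients over the contents of
the boxes of the partition; so `E[F G]` converges to `∑_ν c_ν(F) c_ν(G) h_ν`, where `c` is the
coefficient map and `h_ν > 0`. The space of configurations is compact, and a weak limit `M` of the
ensembles has these expectations (`exists_isometric_measure`). Hence the `Φ_ν` are orthogonal and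
nonzero in `L²(M)`. Symmetric functions separate configurations (`eq_of_forall_evalAt_eq`), so they
are dense in `L²` by the Stone–Weierstrass theorem, and a probability measure is determined by its
expectations of symmetric functions. As `Φ_∅ = 1`, orthogonality fixes these expectations, whence
uniqueness.

*Infinite configurations.* For a finite set `B` of lattice points, `E[2^{-#(X ∩ B)}]` is a
determinant, bounded by `exp (-m(B) / 2)`, where `m(B)` is the sum of the masses on `B` of the
squares of the first `N` orthonormal polynomials (`IsOrthogonalModel.integral_prod_le`). The
polynomial number `j < 0` lives at the scale `q^{-j}`, so `m(B)` is unbounded as `B` exhausts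
the lattice (`IsOrthogonalModel.exists_mass_ge`). Therefore `E[2^{-#X}] = 0`.
-/

noncomputable section

namespace BigQJacobi

/-- The value `1 - s z / a + p z² / a²`, that is `(1 - c z / a) (1 - d z / a)` for `s = c + d` and
`p = c d`. -/
def pairFactor (a s p z : ℝ) : ℝ := 1 - s * z / a + p * z ^ 2 / a ^ 2

/-- The conditions on the real numbers `s = c + d` and `p = c d` under which the weight with
parameters `(c, d)` is positive on the lattice, in a form that is stable under
`(c, d) ↦ (c q^m, d q^m)`, `m ∈ ℤ`. -/
structure Regular (q α β s p : ℝ) : Prop where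
  q_pos : 0 < q
  q_lt_one : q < 1
  α_pos : 0 < α
  β_neg : β < 0
  p_pos : 0 < p
  left_pos : ∀ n : ℤ, 0 < pairFactor α s p (q ^ n)
  right_pos : ∀ n : ℤ, 0 < pairFactor β s p (q ^ n)

/-! ### Infinite products -/

section Pochhammer

variable {q : ℝ}

lemma summable_norm_qPoch (hq0 : 0 < q) (hq1 : q < 1) (z : ℂ) :
    Summable fun i : ℕ => ‖-(z * (q : ℂ) ^ i)‖ := by
  have : Summable fun i : ℕ => ‖z‖ * q ^ i :=
    (summable_geometric_of_lt_one hq0.le hq1).mul_left _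
  refine this.congr fun i => ?_
  rw [norm_neg, norm_mul, norm_pow, Complex.norm_real, Real.norm_of_nonneg hq0.le]

lemma multipliable_qPoch (hq0 : 0 < q) (hq1 : q < 1) (z : ℂ) :
    Multipliable fun i : ℕ => (1 - z * (q : ℂ) ^ i) := by
  simpa only [sub_eq_add_neg] using
    multipliable_one_add_of_summable (summable_norm_qPoch hq0 hq1 z)

lemma qPochInf_eq_mul (hq0 : 0 < q) (hq1 : q < 1) (z : ℂ) :
    qPochInf q z = (1 - z) * qPochInf q (q * z) := by
  have e : ∀ i : ℕ, 1 - (q : ℂ) * z * (q : ℂ) ^ i = 1 - z * (q : ℂ) ^ (i + 1) := fun i => by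
    rw [pow_succ]; ring
  have h' : Multipliable fun i : ℕ => (1 - z * (q : ℂ) ^ (i + 1)) :=
    (multipliable_qPoch hq0 hq1 (q * z)).congr e
  have h := tprod_eq_zero_mul' (f := fun i : ℕ => 1 - z * (q : ℂ) ^ i) h'
  rw [pow_zero, mul_one] at h
  unfold qPochInf
  rw [h, tprod_congr e]

lemma norm_qPochInf_sub_one_le (hq0 : 0 < q) (hq1 : q < 1) (z : ℂ) :
    ‖qPochInf q z - 1‖ ≤ Real.exp (‖z‖ * (1 - q)⁻¹) - 1 := by
  have h := (multipliable_qPoch hq0 hq1 z).hasProd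
  have h2 : Tendsto (fun t : Finset ℕ => ‖∏ i ∈ t, (1 - z * (q : ℂ) ^ i) - 1‖) atTop
      (𝓝 ‖qPochInf q z - 1‖) := by
    have h3 : Tendsto (fun t : Finset ℕ => ∏ i ∈ t, (1 - z * (q : ℂ) ^ i)) atTop
      (𝓝 (qPochInf q z)) := by simpa [HasProd, qPochInf] using h
    exact (h3.sub_const 1).norm
  refine le_of_tendsto' h2 fun t => ?_
  have h4 := Finset.norm_prod_one_add_sub_one_le t fun i : ℕ => -(z * (q : ℂ) ^ i)
  simp only [← sub_eq_add_neg] at h4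
  refine h4.trans ?_
  gcongr
  have h5 : HasSum (fun i : ℕ => ‖z‖ * q ^ i) (‖z‖ * (1 - q)⁻¹) :=
    (hasSum_geometric_of_lt_one hq0.le hq1).mul_left _
  refine le_trans (le_of_eq ?_) (sum_le_hasSum t (fun i _ => by positivity) h5)
  refine Finset.sum_congr rfl fun i _ => ?_
  rw [norm_neg, norm_mul, norm_pow, Complex.norm_real, Real.norm_of_nonneg hq0.le]

lemma tendsto_qPochInf_mul_pow (hq0 : 0 < q) (hq1 : q < 1) (z : ℂ) :
    Tendsto (fun k : ℕ => qPochInf q (z * (q : ℂ) ^ k)) atTop (𝓝 1) := by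
  rw [tendsto_iff_norm_sub_tendsto_zero]
  have h1 : Tendsto (fun k : ℕ => Real.exp (‖z * (q : ℂ) ^ k‖ * (1 - q)⁻¹) - 1) atTop (𝓝 0) := by
    have h2 : Tendsto (fun k : ℕ => ‖z * (q : ℂ) ^ k‖ * (1 - q)⁻¹) atTop (𝓝 0) := by
      have h3 : Tendsto (fun k : ℕ => ‖z‖ * q ^ k * (1 - q)⁻¹) atTop (𝓝 (‖z‖ * 0 * (1 - q)⁻¹)) :=
        ((tendsto_pow_atTop_nhds_zero_of_lt_one hq0.le hq1).const_mul _).mul_const _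
      simp only [mul_zero, zero_mul] at h3
      refine h3.congr fun k => ?_
      rw [norm_mul, norm_pow, Complex.norm_real, Real.norm_of_nonneg hq0.le]
    have := (Real.continuous_exp.tendsto 0).comp h2
    simpa using this.sub_const 1
  exact squeeze_zero (fun _ => norm_nonneg _)
    (fun k => norm_qPochInf_sub_one_le hq0 hq1 _) h1

end Pochhammer

/-! ### The big `q`-Jacobi weight and its moments -/

section Weight

variable {q α β s p : ℝ} {c d : ℂ}

/-- The quotient of infinite products in the weight. -/
def weightRatio (q a b : ℝ) (c d : ℂ) (x : ℝ) : ℂ :=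
  qPochInf q (a * x) * qPochInf q (b * x) / (qPochInf q (c * x) * qPochInf q (d * x))

/-- The Pearson equation for the quotient of infinite products. -/
lemma weightRatio_re_mul (hq0 : 0 < q) (hq1 : q < 1) (hs : c + d = s) (hp : c * d = p) {x : ℝ}
    (hx : 1 - s * x + p * x ^ 2 ≠ 0) :
    (weightRatio q α β c d (q * x)).re * ((1 - α * x) * (1 - β * x)) =
      (weightRatio q α β c d x).re * (1 - s * x + p * x ^ 2) := by
  have hcd : (1 - c * x) * (1 - d * x) = ((1 - s * x + p * x ^ 2 : ℝ) : ℂ) := by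
    push_cast; rw [← hs, ← hp]; ring
  have hne : (1 - c * x) * (1 - d * x) ≠ 0 := by rw [hcd]; exact_mod_cast hx
  have key : weightRatio q α β c d (q * x) * (((1 - α * x) * (1 - β * x) : ℝ) : ℂ) =
      weightRatio q α β c d x * ((1 - s * x + p * x ^ 2 : ℝ) : ℂ) := by
    rw [← hcd]
    unfold weightRatio
    rw [qPochInf_eq_mul hq0 hq1 (α * x), qPochInf_eq_mul hq0 hq1 (β * x),
      qPochInf_eq_mul hq0 hq1 (c * x), qPochInf_eq_mul hq0 hq1 (d * x)]
    have e1 : ∀ w : ℂ, (q : ℂ) * (w * x) = w * ((q * x : ℝ) : ℂ) := by intro w; push_cast; ring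
    rw [e1, e1, e1, e1]
    have h1 : (1 - c * x) ≠ 0 := left_ne_zero_of_mul hne
    have h2 : (1 - d * x) ≠ 0 := right_ne_zero_of_mul hne
    rw [show (1 - c * (x : ℂ)) * qPochInf q (c * ((q * x : ℝ) : ℂ)) *
      ((1 - d * x) * qPochInf q (d * ((q * x : ℝ) : ℂ))) =
      ((1 - c * x) * (1 - d * x)) *
        (qPochInf q (c * ((q * x : ℝ) : ℂ)) * qPochInf q (d * ((q * x : ℝ) : ℂ))) by ring,
      div_mul_eq_mul_div _ _ ((1 - c * (x : ℂ)) * (1 - d * x)), mul_comm _ ((1 - c * (x : ℂ)) * (1 - d * x)),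
      mul_div_mul_left _ _ hne]
    push_cast
    ring
  have := congrArg Complex.re key
  rwa [Complex.re_mul_ofReal, Complex.re_mul_ofReal] at this

lemma tendsto_weightRatio_mul_pow (hq0 : 0 < q) (hq1 : q < 1) (x : ℝ) :
    Tendsto (fun k : ℕ => (weightRatio q α β c d (q ^ k * x)).re) atTop (𝓝 1) := by
  have h : ∀ w : ℂ, Tendsto (fun k : ℕ => qPochInf q (w * ((q ^ k * x : ℝ) : ℂ))) atTop (𝓝 1) := by
    intro w
    refine (tendsto_qPochInf_mul_pow hq0 hq1 (w * x)).congr fun k => ?_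
    congr 1; push_cast; ring
  have h2 : Tendsto (fun k : ℕ => weightRatio q α β c d (q ^ k * x)) atTop
      (𝓝 (1 * 1 / (1 * 1))) :=
    ((h α).mul (h β)).div ((h c).mul (h d)) (by simp)
  have := (Complex.continuous_re.tendsto _).comp h2
  simpa [Function.comp_def] using this

lemma Regular.pairFactor_inv (h : Regular q α β s p) (k : ℕ) :
    0 < 1 - s * (q ^ k * α⁻¹) + p * (q ^ k * α⁻¹) ^ 2 ∧
    0 < 1 - s * (q ^ k * β⁻¹) + p * (q ^ k * β⁻¹) ^ 2 := by
  have h1 := h.left_pos k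
  have h2 := h.right_pos k
  simp only [pairFactor, zpow_natCast] at h1 h2
  constructor
  · convert h1 using 1; ring
  · convert h2 using 1; ring

/-- Positivity is propagated from near `0`, where the ratio is close to `1`. -/
lemma weightRatio_re_pos (h : Regular q α β s p) (hs : c + d = s) (hp : c * d = p) {x : ℝ}
    (hx : ∀ k : ℕ, 0 < 1 - s * (q ^ k * x) + p * (q ^ k * x) ^ 2)
    (hx' : ∀ k : ℕ, 0 < (1 - α * (q ^ k * x)) * (1 - β * (q ^ k * x))) :
    0 < (weightRatio q α β c d x).re := by
  have hlim := tendsto_weightRatio_mul_pow (c := c) (d := d) (α := α) (β := β)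
    h.q_pos h.q_lt_one x
  obtain ⟨n, hn⟩ := (hlim.eventually (lt_mem_nhds zero_lt_one)).exists
  have step : ∀ k : ℕ, 0 < (weightRatio q α β c d (q ^ (k + 1) * x)).re →
      0 < (weightRatio q α β c d (q ^ k * x)).re := by
    intro k hk
    have := weightRatio_re_mul (α := α) (β := β) h.q_pos h.q_lt_one hs hp (hx k).ne'
    rw [show q * (q ^ k * x) = q ^ (k + 1) * x by ring] at this
    have h3 := mul_pos hk (hx' k)
    rw [this] at h3
    exact pos_of_mul_pos_left h3 (hx k).le
  have : ∀ m : ℕ, 0 < (weightRatio q α β c d (q ^ m * x)).re →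
      0 < (weightRatio q α β c d (q ^ 0 * x)).re := by
    intro m
    induction m with
    | zero => exact id
    | succ m ih => exact fun hm => ih (step m hm)
  simpa using this n hn

lemma weight_eq (x : ℝ) : weight q α β c d x = |x| * (weightRatio q α β c d x).re := rfl

/-- The two halves of the lattice, as images of `ℕ`. -/
def branch (q a : ℝ) (k : ℕ) : ℝ := a⁻¹ * q ^ (k + 1)

lemma Regular.branch_factors (h : Regular q α β s p) {a : ℝ} (ha : a = α ∨ a = β) (j : ℕ) :
    (∀ k : ℕ, 0 < 1 - s * (q ^ k * branch q a j) + p * (q ^ k * branch q a j) ^ 2) ∧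
    (∀ k : ℕ, 0 < (1 - α * (q ^ k * branch q a j)) * (1 - β * (q ^ k * branch q a j))) := by
  have hq : ∀ m : ℕ, q ^ (m + 1) < 1 := fun m => pow_lt_one₀ h.q_pos.le h.q_lt_one (by omega)
  have hq' : ∀ m : ℕ, 0 < q ^ m := fun m => pow_pos h.q_pos m
  have e : ∀ k, q ^ k * branch q a j = q ^ (k + j + 1) * a⁻¹ := by
    intro k; unfold branch; ring
  have hα := h.α_pos
  have hβ := h.β_neg
  constructor
  · intro k
    rw [e]
    rcases ha with rfl | rfl
    · exact (h.pairFactor_inv _).1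
    · exact (h.pairFactor_inv _).2
  · intro k
    rw [e]
    rcases ha with rfl | rfl
    · have : a * (q ^ (k + j + 1) * a⁻¹) = q ^ (k + j + 1) := by field_simp
      rw [this]
      have h1 := hq (k + j)
      have h2 : 0 < q ^ (k + j + 1) * a⁻¹ := mul_pos (hq' _) (inv_pos.2 hα)
      exact mul_pos (by linarith) (by nlinarith)
    · have : a * (q ^ (k + j + 1) * a⁻¹) = q ^ (k + j + 1) := by
        have := hβ.ne
        field_simp
      rw [this]
      have h1 := hq (k + j)
      have h2 : q ^ (k + j + 1) * a⁻¹ < 0 := mul_neg_of_pos_of_neg (hq' _) (inv_lt_zero.2 hβ)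
      exact mul_pos (by nlinarith) (by linarith)

lemma Regular.branch_ne_zero (h : Regular q α β s p) {a : ℝ} (ha : a = α ∨ a = β) (j : ℕ) :
    branch q a j ≠ 0 := by
  have : a ≠ 0 := by rcases ha with rfl | rfl; exacts [h.α_pos.ne', h.β_neg.ne]
  have := h.q_pos
  unfold branch
  positivity

lemma weight_branch_pos (h : Regular q α β s p) (hs : c + d = s) (hp : c * d = p)
    {a : ℝ} (ha : a = α ∨ a = β) (j : ℕ) : 0 < weight q α β c d (branch q a j) := by
  rw [weight_eq]
  have h1 := h.branch_factors ha j
  exact mul_pos (abs_pos.2 (h.branch_ne_zero ha j)) (weightRatio_re_pos h hs hp h1.1 h1.2)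

lemma exists_branch_eq {x : ℝ} (hx : x ∈ lattice q α β) :
    ∃ a, (a = α ∨ a = β) ∧ ∃ j, x = branch q a j := by
  obtain ⟨k, hk | hk⟩ := hx
  · exact ⟨β, Or.inr rfl, k, hk⟩
  · exact ⟨α, Or.inl rfl, k, hk⟩

lemma weight_pos (h : Regular q α β s p) (hs : c + d = s) (hp : c * d = p) {x : ℝ}
    (hx : x ∈ lattice q α β) : 0 < weight q α β c d x := by
  obtain ⟨a, ha, j, rfl⟩ := exists_branch_eq hx
  exact weight_branch_pos h hs hp ha j

lemma tendsto_weightRatio_branch (h : Regular q α β s p) (a : ℝ) :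
    Tendsto (fun j : ℕ => (weightRatio q α β c d (branch q a j)).re) atTop (𝓝 1) := by
  have := tendsto_weightRatio_mul_pow (c := c) (d := d) (α := α) (β := β)
    h.q_pos h.q_lt_one (a⁻¹ * q)
  refine this.congr fun j => ?_
  congr 2
  unfold branch; ring

lemma exists_weight_le (h : Regular q α β s p) (c d : ℂ) :
    ∃ C, 0 ≤ C ∧ ∀ x ∈ lattice q α β, weight q α β c d x ≤ C * |x| := by
  have hb : ∀ a, ∃ C, ∀ j, (weightRatio q α β c d (branch q a j)).re ≤ C := by
    intro a
    obtain ⟨C, hC⟩ := (tendsto_weightRatio_branch (c := c) (d := d) h a).bddAbove_range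
    exact ⟨C, fun j => hC ⟨j, rfl⟩⟩
  obtain ⟨C1, h1⟩ := hb α
  obtain ⟨C2, h2⟩ := hb β
  refine ⟨max (max C1 C2) 0, le_max_right _ _, fun x hx => ?_⟩
  rw [weight_eq, mul_comm]
  refine mul_le_mul_of_nonneg_right ?_ (abs_nonneg _)
  obtain ⟨a, ha, j, rfl⟩ := exists_branch_eq hx
  rcases ha with rfl | rfl
  · exact (h1 j).trans ((le_max_left _ _).trans (le_max_left _ _))
  · exact (h2 j).trans ((le_max_right _ _).trans (le_max_left _ _))

/-- The lattice is the disjoint union of its two halves. -/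
def latticeEquiv (h : Regular q α β s p) : ℕ ⊕ ℕ ≃ lattice q α β :=
  Equiv.ofBijective
    (Sum.elim (fun k => ⟨branch q α k, k, Or.inr rfl⟩) (fun k => ⟨branch q β k, k, Or.inl rfl⟩)) <| by
    have hinj : ∀ a : ℝ, a ≠ 0 → Function.Injective (branch q a) := by
      intro a ha i j hij
      unfold branch at hij
      have := mul_left_cancel₀ (inv_ne_zero ha) hij
      have := (pow_right_injective₀ h.q_pos h.q_lt_one.ne) this
      omega
    have hα : ∀ k, 0 < branch q α k := fun k =>
      mul_pos (inv_pos.2 h.α_pos) (pow_pos h.q_pos _)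
    have hβ : ∀ k, branch q β k < 0 := fun k =>
      mul_neg_of_neg_of_pos (inv_lt_zero.2 h.β_neg) (pow_pos h.q_pos _)
    constructor
    · rintro (i | i) (j | j) hij
      · replace hij := congrArg Subtype.val hij
        simp only [Sum.elim_inl] at hij
        rw [hinj α h.α_pos.ne' hij]
      · replace hij := congrArg Subtype.val hij
        simp only [Sum.elim_inl, Sum.elim_inr] at hij
        have := hα i; have := hβ j; linarith
      · replace hij := congrArg Subtype.val hij
        simp only [Sum.elim_inl, Sum.elim_inr] at hij
        have := hα j; have := hβ i; linarith
      · replace hij := congrArg Subtype.val hij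
        simp only [Sum.elim_inr] at hij
        rw [hinj β h.β_neg.ne hij]
    · rintro ⟨x, k, hk | hk⟩
      · exact ⟨Sum.inr k, Subtype.ext hk.symm⟩
      · exact ⟨Sum.inl k, Subtype.ext hk.symm⟩

lemma hasSum_lattice (h : Regular q α β s p) {f : ℝ → ℝ} {A B : ℝ}
    (hA : HasSum (fun k => f (branch q α k)) A) (hB : HasSum (fun k => f (branch q β k)) B) :
    HasSum (fun x : lattice q α β => f x) (A + B) := by
  rw [← (latticeEquiv h).hasSum_iff]
  exact HasSum.sum hA hB

lemma summable_abs_lattice (h : Regular q α β s p) :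
    Summable fun x : lattice q α β => |(x : ℝ)| := by
  have hb : ∀ a : ℝ, Summable fun k => |branch q a k| := by
    intro a
    have : Summable fun k : ℕ => |a⁻¹ * q| * q ^ k :=
      (summable_geometric_of_lt_one h.q_pos.le h.q_lt_one).mul_left _
    refine this.congr fun k => ?_
    unfold branch
    rw [pow_succ', ← mul_assoc, abs_mul _ (q ^ k), abs_of_nonneg (pow_nonneg h.q_pos.le k)]
  exact (hasSum_lattice h (f := fun x => |x|) (hb α).hasSum (hb β).hasSum).summable

lemma exists_lattice_bound (h : Regular q α β s p) :
    ∃ R, 0 < R ∧ ∀ x ∈ lattice q α β, |x| ≤ R := by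
  refine ⟨max |α⁻¹| |β⁻¹|, lt_max_of_lt_left (abs_pos.2 (inv_ne_zero h.α_pos.ne')), ?_⟩
  intro x hx
  obtain ⟨a, ha, j, rfl⟩ := exists_branch_eq hx
  have : |branch q a j| ≤ |a⁻¹| := by
    unfold branch
    rw [abs_mul, abs_of_nonneg (pow_nonneg h.q_pos.le _)]
    exact mul_le_of_le_one_right (abs_nonneg _) (pow_le_one₀ h.q_pos.le h.q_lt_one.le)
  rcases ha with rfl | rfl
  · exact this.trans (le_max_left _ _)
  · exact this.trans (le_max_right _ _)

lemma summable_weight (h : Regular q α β s p) (hs : c + d = s) (hp : c * d = p) :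
    Summable fun x : lattice q α β => weight q α β c d x := by
  obtain ⟨C, -, hC⟩ := exists_weight_le h c d
  exact Summable.of_nonneg_of_le (fun x => (weight_pos h hs hp x.2).le) (fun x => hC x x.2)
    ((summable_abs_lattice h).mul_left C)

lemma summable_mul_weight (h : Regular q α β s p) (hs : c + d = s) (hp : c * d = p)
    {f : lattice q α β → ℝ} {B : ℝ} (hf : ∀ x, |f x| ≤ B) :
    Summable fun x : lattice q α β => f x * weight q α β c d x := by
  refine Summable.of_norm_bounded ((summable_weight h hs hp).mul_left B) fun x => ?_
  have := weight_pos h hs hp x.2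
  rw [Real.norm_eq_abs, abs_mul, abs_of_pos this]
  exact mul_le_mul_of_nonneg_right (hf x) this.le

lemma exists_polynomial_bound (h : Regular q α β s p) (f : Polynomial ℝ) :
    ∃ B, ∀ x : lattice q α β, |f.eval (x : ℝ)| ≤ B := by
  obtain ⟨R, -, hR⟩ := exists_lattice_bound h
  obtain ⟨B, hB⟩ := (isCompact_Icc (a := -R) (b := R)).exists_bound_of_continuousOn
    (f := fun x => f.eval x) f.continuous.continuousOn
  exact ⟨B, fun x => hB _ (abs_le.1 (hR x x.2))⟩

/-- The moment `∑ x^k W(x)` of the weight. -/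
def moment (q α β : ℝ) (c d : ℂ) (k : ℕ) : ℝ :=
  ∑' x : lattice q α β, (x : ℝ) ^ k * weight q α β c d x

lemma summable_moment (h : Regular q α β s p) (hs : c + d = s) (hp : c * d = p) (k : ℕ) :
    Summable fun x : lattice q α β => (x : ℝ) ^ k * weight q α β c d x := by
  obtain ⟨B, hB⟩ := exists_polynomial_bound h (Polynomial.X ^ k)
  refine summable_mul_weight h hs hp (f := fun x => (x : ℝ) ^ k) (B := B) fun x => ?_
  simpa using hB x

/-- The Pearson equation `W(qx)(1 - αx)(1 - βx) = q W(x)(1 - cx)(1 - dx)`, multiplied by `x^{k-1}`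
and summed over one half of the lattice. The sum telescopes; the boundary term at `0` is the sign
of `a` for `k = 0` and vanishes otherwise. -/
lemma hasSum_pearson_branch (h : Regular q α β s p) (hs : c + d = s) (hp : c * d = p)
    {a : ℝ} (ha : a = α ∨ a = β) (k : ℕ) :
    HasSum (fun j => weight q α β c d (branch q a j) *
      ((1 - q ^ k) * branch q a j ^ (k - 1) - ((α + β) / q - s * q ^ k) * branch q a j ^ k
        + (α * β / q ^ 2 - p * q ^ k) * branch q a j ^ (k + 1)))
      (-((SignType.sign a : ℝ) * 0 ^ k)) := by
  have ha0 : a ≠ 0 := by rcases ha with rfl | rfl; exacts [h.α_pos.ne', h.β_neg.ne]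
  have hq0 := h.q_pos
  -- By the Pearson equation each term is a difference of two consecutive values of `g`.
  set g : ℝ → ℝ := fun x =>
    (SignType.sign a : ℝ) * (weightRatio q α β c d x).re * ((1 - α * x / q) * (1 - β * x / q)) * x ^ k
    with hg
  have hbr : ∀ j, branch q a (j + 1) = q * branch q a j := fun j => by unfold branch; ring
  have habs : ∀ j, |branch q a j| = (SignType.sign a : ℝ) * branch q a j := by
    intro j
    have : (SignType.sign (branch q a j) : ℝ) = SignType.sign a := by
      unfold branch
      rw [sign_mul, sign_pos (pow_pos hq0 _), mul_one]
      rcases ha0.lt_or_gt with h1 | h1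
      · rw [sign_neg h1, sign_neg (inv_lt_zero.2 h1)]
      · rw [sign_pos h1, sign_pos (inv_pos.2 h1)]
    rw [← this, sign_mul_self]
  have hterm : ∀ j, weight q α β c d (branch q a j) *
      ((1 - q ^ k) * branch q a j ^ (k - 1) - ((α + β) / q - s * q ^ k) * branch q a j ^ k
        + (α * β / q ^ 2 - p * q ^ k) * branch q a j ^ (k + 1))
      = g (branch q a j) - g (branch q a (j + 1)) := by
    intro j
    have h1 := weightRatio_re_mul (α := α) (β := β) h.q_pos h.q_lt_one hs hp
      (x := branch q a j) (by simpa using ((h.branch_factors ha j).1 0).ne')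
    rw [weight_eq, habs, hbr]
    simp only [hg]
    generalize branch q a j = x at *
    have e1 : α * (q * x) / q = α * x := by field_simp
    have e2 : β * (q * x) / q = β * x := by field_simp
    have e3 : (1 - q ^ k) * x ^ (k - 1) * x = (1 - q ^ k) * x ^ k := by
      rcases k with _ | k
      · simp
      · rw [Nat.add_sub_cancel]; ring
    rw [e1, e2, mul_pow]
    have h2 : (SignType.sign a : ℝ) * (weightRatio q α β c d (q * x)).re *
        ((1 - α * x) * (1 - β * x)) * (q ^ k * x ^ k) =
        (SignType.sign a : ℝ) * ((weightRatio q α β c d x).re * (1 - s * x + p * x ^ 2)) *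
          (q ^ k * x ^ k) := by
      rw [← h1]; ring
    rw [h2]
    calc _ = (SignType.sign a : ℝ) * (weightRatio q α β c d x).re *
        ((1 - q ^ k) * x ^ (k - 1) * x - ((α + β) / q - s * q ^ k) * x ^ k * x
        + (α * β / q ^ 2 - p * q ^ k) * x ^ (k + 1) * x) := by ring
      _ = _ := by rw [e3]; field_simp; ring
  have hsum : Summable (fun j => weight q α β c d (branch q a j) *
      ((1 - q ^ k) * branch q a j ^ (k - 1) - ((α + β) / q - s * q ^ k) * branch q a j ^ k
        + (α * β / q ^ 2 - p * q ^ k) * branch q a j ^ (k + 1))) := by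
    have hinj : Function.Injective (fun j : ℕ => (if a = α then latticeEquiv h (Sum.inl j)
        else latticeEquiv h (Sum.inr j) : lattice q α β)) := by
      intro i j hij
      by_cases h' : a = α
      · simp only [h', if_true] at hij
        simpa using hij
      · simp only [h', if_false] at hij
        simpa using hij
    have hval : ∀ j : ℕ, (((if a = α then latticeEquiv h (Sum.inl j)
        else latticeEquiv h (Sum.inr j) : lattice q α β)) : ℝ) = branch q a j := by
      intro j
      by_cases h' : a = α
      · simp only [h', if_true]; rfl
      · simp only [h', if_false]
        rw [ha.resolve_left h']; rfl
    have hm : ∀ k, Summable fun j => branch q a j ^ k * weight q α β c d (branch q a j) := by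
      intro k
      refine ((summable_moment h hs hp k).comp_injective hinj).congr fun j => ?_
      simp only [Function.comp, hval]
    refine ((((hm (k - 1)).mul_left (1 - q ^ k)).sub
      ((hm k).mul_left ((α + β) / q - s * q ^ k))).add
      ((hm (k + 1)).mul_left (α * β / q ^ 2 - p * q ^ k))).congr fun j => ?_
    ring
  rw [hsum.hasSum_iff_tendsto_nat]
  simp only [hterm, Finset.sum_range_sub']
  -- At the outermost point `a * x = q`, so one of the linear factors of `g` vanishes.
  have hg0 : g (branch q a 0) = 0 := by
    have : (1 - α * branch q a 0 / q) * (1 - β * branch q a 0 / q) = 0 := by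
      have : a * branch q a 0 / q = 1 := by
        unfold branch; rw [zero_add, pow_one]; field_simp
      rcases ha with rfl | rfl
      · rw [this]; ring
      · rw [this]; ring
    simp only [hg, this]; ring
  have hbr0 : Tendsto (branch q a) atTop (𝓝 0) := by
    have := ((tendsto_pow_atTop_nhds_zero_of_lt_one h.q_pos.le h.q_lt_one).comp
      (tendsto_add_atTop_nat 1)).const_mul a⁻¹
    rw [mul_zero] at this
    exact this
  have hc : Tendsto (fun j => ((1 - α * branch q a j / q) * (1 - β * branch q a j / q)) *
      branch q a j ^ k) atTop (𝓝 (((1 - α * 0 / q) * (1 - β * 0 / q)) * 0 ^ k)) := by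
    have : Continuous fun x : ℝ => ((1 - α * x / q) * (1 - β * x / q)) * x ^ k := by fun_prop
    exact (this.tendsto 0).comp hbr0
  have hlim : Tendsto (fun n => g (branch q a n)) atTop (𝓝 ((SignType.sign a : ℝ) * 0 ^ k)) := by
    have := ((tendsto_weightRatio_branch (c := c) (d := d) h a).const_mul
      (SignType.sign a : ℝ)).mul hc
    simp only [mul_zero, zero_div, sub_zero, mul_one, one_mul] at this
    refine this.congr fun j => ?_
    simp only [hg]; ring
  rw [hg0]
  simpa using hlim.const_sub 0

/-- The sum of the Pearson identities of the two half-lattices: their boundary terms at `0` cancel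
because `α` and `β` have opposite signs. -/
lemma moment_recurrence (h : Regular q α β s p) (hs : c + d = s) (hp : c * d = p) (k : ℕ) :
    (1 - q ^ k) * moment q α β c d (k - 1) - ((α + β) / q - s * q ^ k) * moment q α β c d k
      + (α * β / q ^ 2 - p * q ^ k) * moment q α β c d (k + 1) = 0 := by
  have h1 := hasSum_lattice h (f := fun x => weight q α β c d x *
      ((1 - q ^ k) * x ^ (k - 1) - ((α + β) / q - s * q ^ k) * x ^ k
        + (α * β / q ^ 2 - p * q ^ k) * x ^ (k + 1)))
    (hasSum_pearson_branch h hs hp (Or.inl rfl) k) (hasSum_pearson_branch h hs hp (Or.inr rfl) k)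
  rw [sign_pos h.α_pos, sign_neg h.β_neg] at h1
  have hm : ∀ k, HasSum (fun x : lattice q α β => (x : ℝ) ^ k * weight q α β c d x)
    (moment q α β c d k) := fun k => (summable_moment h hs hp k).hasSum
  have h2 := (((hm (k - 1)).mul_left (1 - q ^ k)).sub
      ((hm k).mul_left ((α + β) / q - s * q ^ k))).add
      ((hm (k + 1)).mul_left (α * β / q ^ 2 - p * q ^ k))
  have h3 := h2.unique (h1.congr_fun fun x => by ring)
  rw [h3]
  simp

end Weight

/-! ### Monic orthogonal polynomials -/

section OrthogonalPolynomials
open Polynomial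

variable {Λ : ℝ[X] →ₗ[ℝ] ℝ}

/-- Monic orthogonal polynomials exist, because the form `Λ (f g)` is nondegenerate on polynomials
of degree less than `n`. -/
lemma exists_monic_orthogonal (hpos : ∀ f : ℝ[X], f ≠ 0 → 0 < Λ (f * f)) (n : ℕ) :
    ∃ P : ℝ[X], P.Monic ∧ P.natDegree = n ∧ ∀ k < n, Λ (P * X ^ k) = 0 := by
  let T : degreeLT ℝ n →ₗ[ℝ] (Fin n → ℝ) :=
    LinearMap.pi fun k => Λ ∘ₗ (LinearMap.mulRight ℝ (X ^ (k : ℕ))) ∘ₗ (degreeLT ℝ n).subtype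
  have hT : ∀ f k, T f k = Λ ((f : ℝ[X]) * X ^ (k : ℕ)) := fun f k => rfl
  have hinj : Function.Injective T := by
    rw [← LinearMap.ker_eq_bot, LinearMap.ker_eq_bot']
    intro f hf
    by_contra hne
    have hne' : (f : ℝ[X]) ≠ 0 := fun h => hne (Subtype.ext h)
    have h1 := hpos f hne'
    have hdeg : (f : ℝ[X]).natDegree < n := by
      have := mem_degreeLT.1 f.2
      exact (natDegree_lt_iff_degree_lt hne').2 this
    have h2 : (f : ℝ[X]) * f = ∑ k : Fin n, (f : ℝ[X]).coeff k • ((f : ℝ[X]) * X ^ (k : ℕ)) := by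
      have hsum := (f : ℝ[X]).as_sum_range' n hdeg
      have : (f : ℝ[X]) * f = (f : ℝ[X]) * ∑ i ∈ Finset.range n,
        (monomial i) ((f : ℝ[X]).coeff i) := congrArg _ hsum
      rw [this, Finset.mul_sum, ← Fin.sum_univ_eq_sum_range
        (fun k => (f : ℝ[X]) * (monomial k) ((f : ℝ[X]).coeff k))]
      refine Finset.sum_congr rfl fun k _ => ?_
      rw [← C_mul_X_pow_eq_monomial, smul_eq_C_mul]; ring
    rw [h2, map_sum] at h1
    have : ∀ k : Fin n, Λ ((f : ℝ[X]).coeff k • ((f : ℝ[X]) * X ^ (k : ℕ))) = 0 := by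
      intro k
      rw [map_smul, ← hT, hf]; simp
    simp [this] at h1
  have hfin : Module.finrank ℝ (degreeLT ℝ n) = Module.finrank ℝ (Fin n → ℝ) :=
    (degreeLTEquiv ℝ n).finrank_eq
  have : FiniteDimensional ℝ (degreeLT ℝ n) := (degreeLTEquiv ℝ n).symm.finiteDimensional
  have hsurj : Function.Surjective T :=
    (LinearMap.injective_iff_surjective_of_finrank_eq_finrank hfin).1 hinj
  obtain ⟨r, hr⟩ := hsurj fun k => Λ (X ^ n * X ^ (k : ℕ))
  have hrdeg : (r : ℝ[X]).degree < n := mem_degreeLT.1 r.2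
  refine ⟨X ^ n - (r : ℝ[X]), monic_X_pow_sub hrdeg, ?_, fun k hk => ?_⟩
  · rw [natDegree_eq_of_degree_eq (degree_sub_eq_left_of_degree_lt
      (by rwa [degree_X_pow])), natDegree_X_pow]
  · have := congrFun hr ⟨k, hk⟩
    rw [hT] at this
    rw [sub_mul, map_sub, sub_eq_zero]
    exact this.symm

/-- A family of monic orthogonal polynomials for the functional `Λ`. -/
structure IsMonicOPS (Λ : ℝ[X] →ₗ[ℝ] ℝ) (P : ℕ → ℝ[X]) : Prop where
  pos : ∀ f : ℝ[X], f ≠ 0 → 0 < Λ (f * f)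
  monic : ∀ n, (P n).Monic
  natDegree : ∀ n, (P n).natDegree = n
  orth : ∀ n, ∀ k < n, Λ (P n * X ^ k) = 0

namespace IsMonicOPS

variable {P : ℕ → ℝ[X]}

lemma orth_of_degree_lt (hP : IsMonicOPS Λ P) {n : ℕ} {f : ℝ[X]} (hf : f.degree < n) :
    Λ (P n * f) = 0 := by
  rcases eq_or_ne f 0 with rfl | hne
  · simp
  have hd : f.natDegree < n := (natDegree_lt_iff_degree_lt hne).2 hf
  rw [f.as_sum_range' n hd, Finset.mul_sum, map_sum]
  refine Finset.sum_eq_zero fun k hk => ?_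
  rw [← C_mul_X_pow_eq_monomial, show P n * (C (f.coeff k) * X ^ k) =
    f.coeff k • (P n * X ^ k) by rw [smul_eq_C_mul]; ring, map_smul,
    hP.orth n k (Finset.mem_range.1 hk), smul_zero]

/-- A polynomial of degree less than `n` that is orthogonal to all such polynomials vanishes. -/
lemma eq_zero_of_orth (hP : IsMonicOPS Λ P) {n : ℕ} {f : ℝ[X]} (hf : f.degree < n)
    (h : ∀ g : ℝ[X], g.degree < n → Λ (f * g) = 0) : f = 0 := by
  by_contra hne
  exact (hP.pos f hne).ne' (h f hf)

lemma ne_zero (hP : IsMonicOPS Λ P) (n : ℕ) : P n ≠ 0 := (hP.monic n).ne_zero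

lemma degree (hP : IsMonicOPS Λ P) (n : ℕ) : (P n).degree = n := by
  rw [degree_eq_natDegree (hP.ne_zero n), hP.natDegree]

lemma norm_pos (hP : IsMonicOPS Λ P) (n : ℕ) : 0 < Λ (P n * P n) := hP.pos _ (hP.ne_zero n)

lemma orth_ne (hP : IsMonicOPS Λ P) {m n : ℕ} (h : m ≠ n) : Λ (P m * P n) = 0 := by
  rcases h.lt_or_gt with h | h
  · rw [mul_comm]
    exact hP.orth_of_degree_lt (by rw [hP.degree]; exact_mod_cast h)
  · exact hP.orth_of_degree_lt (by rw [hP.degree]; exact_mod_cast h)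

lemma coeff_self (hP : IsMonicOPS Λ P) (n : ℕ) : (P n).coeff n = 1 := by
  have := (hP.monic n).coeff_natDegree
  rwa [hP.natDegree] at this

lemma coeff_of_lt (hP : IsMonicOPS Λ P) {n m : ℕ} (h : n < m) : (P n).coeff m = 0 :=
  coeff_eq_zero_of_natDegree_lt (by rwa [hP.natDegree])

/-- The three term recurrence, with the coefficients expressed by the squared norms and by the
subleading coefficients. -/
lemma three_term (hP : IsMonicOPS Λ P) (n : ℕ) :
    X * P (n + 1) = P (n + 2) + C ((P (n + 1)).coeff n - (P (n + 2)).coeff (n + 1)) * P (n + 1) +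
      C (Λ (P (n + 1) * P (n + 1)) / Λ (P n * P n)) * P n := by
  set a := Λ (P (n + 1) * P (n + 1)) / Λ (P n * P n) with ha
  set b := (P (n + 1)).coeff n - (P (n + 2)).coeff (n + 1) with hb
  set r := X * P (n + 1) - (P (n + 2) + C b * P (n + 1) + C a * P n) with hr
  have hdeg : r.degree < (n + 1 : ℕ) := by
    rw [degree_lt_iff_coeff_zero]
    intro m hm
    simp only [hr, coeff_sub, coeff_add, coeff_C_mul]
    obtain ⟨m, rfl⟩ : ∃ m', m = m' + 1 := ⟨m - 1, by omega⟩
    rw [coeff_X_mul, hP.coeff_of_lt (show n < m + 1 by omega)]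
    rcases eq_or_ne m n with rfl | h1
    · rw [hP.coeff_self, hb]; ring
    rw [hP.coeff_of_lt (show n + 1 < m + 1 by omega)]
    rcases eq_or_ne m (n + 1) with rfl | h2
    · rw [hP.coeff_self, hP.coeff_self]; ring
    rw [hP.coeff_of_lt (show n + 1 < m by omega), hP.coeff_of_lt (show n + 2 < m + 1 by omega)]
    ring
  -- The difference of the two sides has small degree and is orthogonal to all such polynomials.
  refine sub_eq_zero.1 (hP.eq_zero_of_orth hdeg fun g hg => ?_)
  -- decompose `g` as a multiple of `P n` plus lower terms
  set t := g.coeff n with ht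
  have hg' : (g - C t * P n).degree < n := by
    rw [degree_lt_iff_coeff_zero] at hg ⊢
    intro m hm
    rw [coeff_sub, coeff_C_mul]
    rcases hm.eq_or_lt with rfl | hm
    · rw [hP.coeff_self]; simp [ht]
    · rw [hg m (by omega), hP.coeff_of_lt hm]; simp
  have e : r * g = r * (g - C t * P n) + t • (r * P n) := by rw [smul_eq_C_mul]; ring
  have lt_trans' : ∀ {f : ℝ[X]} {k l : ℕ}, f.degree < k → k ≤ l → f.degree < l :=
    fun h1 h2 => h1.trans_le (by exact_mod_cast h2)
  have hX : ∀ f : ℝ[X], f.degree < n → (X * f).degree < ((n + 1 : ℕ) : WithBot ℕ) := by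
    intro f hf
    rw [degree_lt_iff_coeff_zero] at hf ⊢
    intro m hm
    obtain ⟨m, rfl⟩ : ∃ m', m = m' + 1 := ⟨m - 1, by omega⟩
    rw [coeff_X_mul]
    exact hf m (by omega)
  have h1 : Λ (r * (g - C t * P n)) = 0 := by
    set f := g - C t * P n with hf
    have : r * f = P (n + 1) * (X * f) - P (n + 2) * f - b • (P (n + 1) * f) - a • (P n * f) := by
      rw [hr, smul_eq_C_mul, smul_eq_C_mul]; ring
    rw [this, map_sub, map_sub, map_sub, map_smul, map_smul, hP.orth_of_degree_lt (hX _ hg'),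
      hP.orth_of_degree_lt (lt_trans' hg' (by omega)),
      hP.orth_of_degree_lt (lt_trans' hg' (by omega)), hP.orth_of_degree_lt hg']
    simp
  have h2 : Λ (r * P n) = 0 := by
    have e1 : r * P n = P (n + 1) * (X * P n) - P (n + 2) * P n - b • (P (n + 1) * P n)
        - a • (P n * P n) := by
      rw [hr, smul_eq_C_mul, smul_eq_C_mul]; ring
    have e2 : Λ (P (n + 1) * (X * P n)) = Λ (P (n + 1) * P (n + 1)) := by
      rw [← sub_eq_zero, ← map_sub, ← mul_sub]
      refine hP.orth_of_degree_lt ?_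
      rw [degree_lt_iff_coeff_zero]
      intro m hm
      obtain ⟨m, rfl⟩ : ∃ m', m = m' + 1 := ⟨m - 1, by omega⟩
      rw [coeff_sub, coeff_X_mul]
      rcases eq_or_ne m n with rfl | h1
      · rw [hP.coeff_self, hP.coeff_self]; ring
      · rw [hP.coeff_of_lt (by omega), hP.coeff_of_lt (by omega)]; ring
    rw [e1, map_sub, map_sub, map_sub, map_smul, map_smul, e2,
      hP.orth_ne (show n + 2 ≠ n by omega), hP.orth_ne (show n + 1 ≠ n by omega), smul_eq_mul, smul_eq_mul, ha,
      div_mul_cancel₀ _ (hP.norm_pos n).ne']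
    ring
  rw [e, map_add, map_smul, h1, h2]; simp

lemma three_term_zero (hP : IsMonicOPS Λ P) :
    X * P 0 = P 1 + C (-(P 1).coeff 0) * P 0 := by
  have h0 : P 0 = 1 := (hP.monic 0).natDegree_eq_zero.1 (hP.natDegree 0)
  have h1 : P 1 = X + C ((P 1).coeff 0) := by
    have := (hP.monic 1).as_sum
    rw [hP.natDegree] at this
    simpa using this
  rw [h0]
  conv_rhs => rw [h1]
  simp

end IsMonicOPS
end OrthogonalPolynomials

/-! ### The recurrence coefficients of the big `q`-Jacobi polynomials -/

section ExplicitCoefficients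
open Polynomial

variable {Λ : ℝ[X] →ₗ[ℝ] ℝ} {P : ℕ → ℝ[X]} {q α β s p : ℝ}

/-- The eigenvalue of the `q`-difference operator on polynomials of degree `n`, as a function of
`Q = q^n`. -/
def eigLead (q α β p Q : ℝ) : ℝ := α * β / q ^ 2 * (Q⁻¹ - 1) + p / q * (Q - 1)

/-- The coefficient of `x^{n-1}` in the image of `x^n`, as a function of `Q = q^n`. -/
def eigSub (q α β s Q : ℝ) : ℝ := -((α + β) / q) * (Q⁻¹ - 1) - s / q * (Q - 1)

/-- The coefficient of `x^{n-2}` in the image of `x^n`, as a function of `Q = q^n`. -/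
def eigSub2 (q Q : ℝ) : ℝ := (Q⁻¹ - 1) + (Q - 1) / q

/-- The second order `q`-difference operator
`D f = A(x) (f(x/q) - f(x)) + B(x) (f(qx) - f(x))` with
`A(x) = (1 - αx/q)(1 - βx/q)/x²` and `B(x) = (1 - cx)(1 - dx)/(qx²)`, given by its values on
monomials. It is symmetric for the big `q`-Jacobi weight. -/
def qDiffOp (q α β s p : ℝ) : ℝ[X] →ₗ[ℝ] ℝ[X] :=
  lsum fun n => LinearMap.toSpanSingleton ℝ ℝ[X]
    (C (eigLead q α β p (q ^ n)) * X ^ n + C (eigSub q α β s (q ^ n)) * X ^ (n - 1) +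
      C (eigSub2 q (q ^ n)) * X ^ (n - 2))

lemma qDiffOp_monomial (n : ℕ) (r : ℝ) : qDiffOp q α β s p (monomial n r) =
    r • (C (eigLead q α β p (q ^ n)) * X ^ n + C (eigSub q α β s (q ^ n)) * X ^ (n - 1) +
      C (eigSub2 q (q ^ n)) * X ^ (n - 2)) := by
  simp [qDiffOp, lsum_apply, sum_monomial_index, LinearMap.toSpanSingleton_apply]

lemma coeff_qDiffOp (hq : q ≠ 0) (f : ℝ[X]) (m : ℕ) : (qDiffOp q α β s p f).coeff m =
    eigLead q α β p (q ^ m) * f.coeff m + eigSub q α β s (q ^ (m + 1)) * f.coeff (m + 1) +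
      eigSub2 q (q ^ (m + 2)) * f.coeff (m + 2) := by
  have h1 : eigSub q α β s 1 = 0 := by simp [eigSub]
  have h2 : eigSub2 q 1 = 0 := by simp [eigSub2]
  have h3 : eigSub2 q q = 0 := by unfold eigSub2; field_simp; ring
  induction f using Polynomial.induction_on' with
  | add f g hf hg => rw [map_add, coeff_add, hf, hg, coeff_add, coeff_add, coeff_add]; ring
  | monomial n r =>
    rw [qDiffOp_monomial]
    simp only [coeff_smul, coeff_add, coeff_C_mul, coeff_X_pow, coeff_monomial, smul_eq_mul]
    have e2 : (if m = n - 1 then eigSub q α β s (q ^ n) else 0) =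
        if n = m + 1 then eigSub q α β s (q ^ (m + 1)) else 0 := by
      rcases n with _ | n
      · simp [h1]
      · by_cases h : m = n
        · simp [h]
        · have : n ≠ m := fun h' => h h'.symm
          simp [h, this]
    have e3 : (if m = n - 2 then eigSub2 q (q ^ n) else 0) =
        if n = m + 2 then eigSub2 q (q ^ (m + 2)) else 0 := by
      rcases n with _ | _ | n
      · simp [h2]
      · simp [h3]
      · by_cases h : m = n
        · simp [h]
        · have : n ≠ m := fun h' => h h'.symm
          simp [h, this]
    have e1 : (if m = n then eigLead q α β p (q ^ n) else 0) =
        if n = m then eigLead q α β p (q ^ m) else 0 := by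
      by_cases h : m = n
      · simp [h]
      · have : n ≠ m := fun h' => h h'.symm
        simp [h, this]
    simp only [mul_ite, mul_one, mul_zero, e1, e2, e3]
    split_ifs <;> ring

/-- The moment recurrence makes `D` symmetric. -/
lemma qDiffOp_symm (hq : q ≠ 0)
    (hrec : ∀ k : ℕ, (1 - q ^ k) * Λ (X ^ (k - 1)) - ((α + β) / q - s * q ^ k) * Λ (X ^ k)
      + (α * β / q ^ 2 - p * q ^ k) * Λ (X ^ (k + 1)) = 0) (f g : ℝ[X]) :
    Λ (qDiffOp q α β s p f * g) = Λ (f * qDiffOp q α β s p g) := by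
  have h1 : eigSub q α β s 1 = 0 := by simp [eigSub]
  have h0 : eigLead q α β p 1 = 0 := by simp [eigLead]
  have h2 : eigSub2 q 1 = 0 := by simp [eigSub2]
  have h3 : eigSub2 q q = 0 := by unfold eigSub2; field_simp; ring
  have key : ∀ n k : ℕ, 1 ≤ n + k → Λ (qDiffOp q α β s p (monomial n 1) * X ^ k) =
      eigLead q α β p (q ^ n) * Λ (X ^ (n + k - 1 + 1)) +
      eigSub q α β s (q ^ n) * Λ (X ^ (n + k - 1)) +
      eigSub2 q (q ^ n) * Λ (X ^ (n + k - 1 - 1)) := by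
    intro n k hnk
    rw [qDiffOp_monomial, one_smul]
    have e : (C (eigLead q α β p (q ^ n)) * X ^ n + C (eigSub q α β s (q ^ n)) * X ^ (n - 1) +
      C (eigSub2 q (q ^ n)) * X ^ (n - 2)) * X ^ k =
      eigLead q α β p (q ^ n) • (X : ℝ[X]) ^ (n + k) +
      eigSub q α β s (q ^ n) • (X : ℝ[X]) ^ (n - 1 + k) +
      eigSub2 q (q ^ n) • (X : ℝ[X]) ^ (n - 2 + k) := by
      simp only [smul_eq_C_mul]; ring
    rw [e, map_add, map_add, map_smul, map_smul, map_smul]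
    simp only [smul_eq_mul]
    rcases n with _ | _ | n
    · simp [h0, h1, h2]
    · simp only [zero_add, pow_one, h3, zero_mul, add_zero]
      rw [show 1 + k - 1 + 1 = 1 + k by omega, show 1 - 1 + k = 1 + k - 1 by omega]
    · rw [show n + 1 + 1 + k - 1 + 1 = n + 1 + 1 + k by omega,
        show n + 1 + 1 - 1 + k = n + 1 + 1 + k - 1 by omega,
        show n + 1 + 1 - 2 + k = n + 1 + 1 + k - 1 - 1 by omega]
  induction f using Polynomial.induction_on' with
  | add f g hf hg => simp only [map_add, add_mul, hf, hg]
  | monomial n r =>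
  induction g using Polynomial.induction_on' with
  | add f g hf hg => simp only [map_add, mul_add, hf, hg]
  | monomial k t =>
  have hn : monomial n r = r • (monomial n (1 : ℝ)) := by rw [smul_monomial]; simp
  have hk : monomial k t = t • (monomial k (1 : ℝ)) := by rw [smul_monomial]; simp
  rw [hn, hk]
  simp only [map_smul, smul_mul_assoc, mul_smul_comm]
  congr 2
  rcases Nat.eq_zero_or_pos (n + k) with h | h
  · obtain ⟨rfl, rfl⟩ : n = 0 ∧ k = 0 := by omega
    rw [mul_comm]
  rw [mul_comm (monomial n (1 : ℝ))]
  have hX : ∀ m : ℕ, monomial m (1 : ℝ) = X ^ m := fun m => (X_pow_eq_monomial m).symm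
  conv_lhs => rw [hX k]
  conv_rhs => rw [hX n]
  rw [key n k h, key k n (by omega), add_comm k n]
  have hr := hrec (n + k - 1)
  obtain ⟨K, hK⟩ : ∃ K, n + k = K + 1 := ⟨n + k - 1, by omega⟩
  rw [hK, Nat.add_sub_cancel] at hr ⊢
  have hx : q ^ n ≠ 0 := pow_ne_zero _ hq
  have hy : q ^ k ≠ 0 := pow_ne_zero _ hq
  have hxy : q ^ K = q ^ n * q ^ k / q := by
    rw [← pow_add, hK, pow_succ]; field_simp
  rw [hxy] at hr
  unfold eigLead eigSub eigSub2
  generalize q ^ n = x at *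
  generalize q ^ k = y at *
  have e : ∀ A B D : ℝ, (x⁻¹ - y⁻¹) * ((1 - x * y / q) * A - ((α + β) / q - s * (x * y / q)) * B +
      (α * β / q ^ 2 - p * (x * y / q)) * D) =
      (α * β / q ^ 2 * (x⁻¹ - 1) + p / q * (x - 1)) * D + (-((α + β) / q) * (x⁻¹ - 1) - s / q * (x - 1)) * B +
        (x⁻¹ - 1 + (x - 1) / q) * A -
      ((α * β / q ^ 2 * (y⁻¹ - 1) + p / q * (y - 1)) * D + (-((α + β) / q) * (y⁻¹ - 1) - s / q * (y - 1)) * B +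
        (y⁻¹ - 1 + (y - 1) / q) * A) := by
    intro A B D
    field_simp
    ring
  rw [← sub_eq_zero, ← e, hr, mul_zero]

/-- The subleading coefficient of the monic big `q`-Jacobi polynomial of degree `n`, as a
function of `Q = q^n`. -/
def subCoeff (q α β s p Q : ℝ) : ℝ :=
  -(q * (1 - Q) * ((α + β) - s * Q)) / ((1 - q) * (α * β - p * Q ^ 2))

/-- The coefficient `a_n` of the three term recurrence
`x φ_n = φ_{n+1} + b_n φ_n + a_n φ_{n-1}` as a function of `Q = q^n`. -/
def normRatio (q α β s p Q : ℝ) : ℝ :=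
  -(q / (α * β)) * (1 - Q) * (Q - p * Q ^ 2 / (α * β)) * pairFactor α s p Q * pairFactor β s p Q /
    ((1 - p * Q ^ 2 / (α * β) / q) * (1 - p * Q ^ 2 / (α * β)) ^ 2 *
      (1 - p * Q ^ 2 / (α * β) * q))

lemma eigLead_sub (hq : q ≠ 0) (hq1 : q ≠ 1) {Q : ℝ} (hQ : Q ≠ 0) :
    eigLead q α β p (q * Q) - eigLead q α β p Q =
      (1 - q) * (α * β - p * (q * Q) ^ 2) / (q ^ 2 * (q * Q)) := by
  have : 1 - q ≠ 0 := sub_ne_zero.2 hq1.symm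
  unfold eigLead
  field_simp
  ring

/-- Monic big q-Jacobi polynomials: `P` is orthogonal for a functional whose moments
satisfy the recurrence of the big `q`-Jacobi weight. -/
structure IsBigQJacobiOPS (q α β s p : ℝ) (Λ : ℝ[X] →ₗ[ℝ] ℝ) (P : ℕ → ℝ[X]) : Prop
    extends IsMonicOPS Λ P where
  q_pos : 0 < q
  q_lt_one : q < 1
  αβ_neg : α * β < 0
  p_pos : 0 < p
  moments : ∀ k : ℕ, (1 - q ^ k) * Λ (X ^ (k - 1)) - ((α + β) / q - s * q ^ k) * Λ (X ^ k)
      + (α * β / q ^ 2 - p * q ^ k) * Λ (X ^ (k + 1)) = 0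

namespace IsBigQJacobiOPS

/-- `D` is symmetric and preserves the degree filtration, so `D (P n)` is again orthogonal to all
polynomials of degree less than `n`, hence proportional to `P n`. -/
lemma eigen (hP : IsBigQJacobiOPS q α β s p Λ P) (n : ℕ) :
    qDiffOp q α β s p (P n) = C (eigLead q α β p (q ^ n)) * P n := by
  have hq := hP.q_pos.ne'
  have hM := hP.toIsMonicOPS
  have hlow : ∀ {f : ℝ[X]}, f.degree < n → (qDiffOp q α β s p f).degree < n := by
    intro f hf
    rw [degree_lt_iff_coeff_zero] at hf ⊢
    intro m hm
    rw [coeff_qDiffOp hq, hf m hm, hf _ (by omega), hf _ (by omega)]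
    simp
  refine sub_eq_zero.1 (hM.eq_zero_of_orth (n := n) ?_ fun g hg => ?_)
  · rw [degree_lt_iff_coeff_zero]
    intro m hm
    rw [coeff_sub, coeff_qDiffOp hq, coeff_C_mul, hM.coeff_of_lt (show n < m + 1 by omega),
      hM.coeff_of_lt (show n < m + 2 by omega)]
    rcases hm.eq_or_lt with rfl | hm
    · ring
    · rw [hM.coeff_of_lt hm]; ring
  · rw [sub_mul, map_sub, qDiffOp_symm hq hP.moments, hM.orth_of_degree_lt (hlow hg), mul_assoc,
      ← smul_eq_C_mul, map_smul, hM.orth_of_degree_lt hg]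
    simp

lemma denom_neg (hP : IsBigQJacobiOPS q α β s p Λ P) {r : ℝ} (hr : 0 ≤ r) :
    α * β - p * r < 0 := by
  have := mul_nonneg hP.p_pos.le hr
  linarith [hP.αβ_neg]

lemma coeff_sub_one (hP : IsBigQJacobiOPS q α β s p Λ P) (n : ℕ) :
    (P (n + 1)).coeff n = subCoeff q α β s p (q ^ (n + 1)) := by
  have hq := hP.q_pos.ne'
  have hM := hP.toIsMonicOPS
  have h := congrArg (fun f => coeff f n) (hP.eigen (n + 1))
  simp only [coeff_qDiffOp hq, coeff_C_mul, hM.coeff_self,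
    hM.coeff_of_lt (show n + 1 < n + 2 by omega)] at h
  have h1 := eigLead_sub (α := α) (β := β) (p := p) hq hP.q_lt_one.ne (pow_ne_zero n hq)
  rw [← pow_succ'] at h1
  have hd := (hP.denom_neg (sq_nonneg (q ^ (n + 1)))).ne
  have hq1 : 1 - q ≠ 0 := sub_ne_zero.2 hP.q_lt_one.ne'
  have hQ : q ^ (n + 1) ≠ 0 := pow_ne_zero _ hq
  have h2 : (1 - q) * (α * β - p * (q ^ (n + 1)) ^ 2) / (q ^ 2 * q ^ (n + 1)) *
      (P (n + 1)).coeff n = eigSub q α β s (q ^ (n + 1)) := by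
    rw [← h1]; linear_combination -h
  unfold subCoeff
  unfold eigSub at h2
  rw [eq_div_iff (mul_ne_zero hq1 hd)]
  generalize q ^ (n + 1) = Q at *
  have h3 : (1 - q) * (α * β - p * Q ^ 2) / (q ^ 2 * Q) * (P (n + 1)).coeff n =
    (P (n + 1)).coeff n * ((1 - q) * (α * β - p * Q ^ 2)) / (q ^ 2 * Q) := by ring
  rw [h3, div_eq_iff (by positivity)] at h2
  rw [h2]
  field_simp
  ring

/-- The coefficient of `x^{n-2}` in `P n`, as a function of `Q = q^n`. -/
def subCoeff2 (q α β s p Q : ℝ) : ℝ :=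
  (eigSub q α β s (Q / q) * subCoeff q α β s p Q + eigSub2 q Q) * (q * Q) /
    ((1 - q ^ 2) * (α * β - p * Q ^ 2 / q)) * q

lemma coeff_sub_two (hP : IsBigQJacobiOPS q α β s p Λ P) (n : ℕ) :
    (P (n + 2)).coeff n = subCoeff2 q α β s p (q ^ (n + 2)) := by
  have hq := hP.q_pos.ne'
  have hM := hP.toIsMonicOPS
  have h := congrArg (fun f => coeff f n) (hP.eigen (n + 2))
  simp only [coeff_qDiffOp hq, coeff_C_mul, hM.coeff_self,
    hP.coeff_sub_one (n + 1)] at h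
  have hq1 : 1 - q ^ 2 ≠ 0 := (sub_pos.2 (pow_lt_one₀ hP.q_pos.le hP.q_lt_one two_ne_zero)).ne'
  have hQ : q ^ (n + 2) ≠ 0 := pow_ne_zero _ hq
  have hd : α * β - p * (q ^ (n + 2)) ^ 2 / q ≠ 0 := by
    rw [mul_div_assoc]
    exact (hP.denom_neg (div_nonneg (sq_nonneg _) hP.q_pos.le)).ne
  have e1 : q ^ (n + 1) = q ^ (n + 2) / q := by rw [pow_succ q (n + 1)]; field_simp
  have e0 : q ^ n = q ^ (n + 2) / q ^ 2 := by rw [pow_add]; field_simp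
  rw [show n + 1 + 1 = n + 2 by ring, e1, e0] at h
  unfold subCoeff2
  rw [div_mul_eq_mul_div, eq_div_iff (mul_ne_zero hq1 hd)]
  generalize q ^ (n + 2) = Q at *
  have h1 : eigLead q α β p Q - eigLead q α β p (Q / q ^ 2) =
      (1 - q ^ 2) * (α * β - p * Q ^ 2 / q) / (q ^ 2 * Q) := by
    unfold eigLead; field_simp; ring
  have h2 : (1 - q ^ 2) * (α * β - p * Q ^ 2 / q) / (q ^ 2 * Q) * (P (n + 2)).coeff n =
      eigSub q α β s (Q / q) * subCoeff q α β s p Q + eigSub2 q Q := by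
    rw [← h1]; linear_combination -h
  rw [← h2]
  field_simp

/-- The ratio of consecutive squared norms is the last coefficient of the three-term recurrence, and
is found by comparing coefficients there. -/
lemma norm_ratio (hP : IsBigQJacobiOPS q α β s p Λ P) (n : ℕ) :
    Λ (P (n + 1) * P (n + 1)) / Λ (P n * P n) = normRatio q α β s p (q ^ (n + 1)) := by
  have hq := hP.q_pos.ne'
  have hM := hP.toIsMonicOPS
  have h := congrArg (fun f => coeff f n) (hM.three_term n)
  simp only [coeff_add, coeff_C_mul, hM.coeff_self, hP.coeff_sub_one, hP.coeff_sub_two] at h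
  have hα : α ≠ 0 := left_ne_zero_of_mul hP.αβ_neg.ne
  have hβ : β ≠ 0 := right_ne_zero_of_mul hP.αβ_neg.ne
  have hq1 : 1 - q ≠ 0 := sub_ne_zero.2 hP.q_lt_one.ne'
  have hX : (X * P (n + 1)).coeff n = subCoeff2 q α β s p (q ^ (n + 1)) := by
    rcases n with _ | n
    · rw [coeff_X_mul_zero]
      unfold subCoeff2 eigSub eigSub2
      rw [zero_add, pow_one, div_self hq]
      field_simp
      ring
    · rw [coeff_X_mul, hP.coeff_sub_two]
  rw [hX, show q ^ (n + 2) = q * q ^ (n + 1) by ring] at h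
  have hQ : q ^ (n + 1) ≠ 0 := pow_ne_zero _ hq
  generalize Λ (P (n + 1) * P (n + 1)) / Λ (P n * P n) = A at *
  have hd0 : ∀ r : ℝ, 0 ≤ r → α * β - p * r ≠ 0 := fun r hr => (hP.denom_neg hr).ne
  have hq0 := hP.q_pos
  generalize q ^ (n + 1) = Q at *
  have hA : A = subCoeff2 q α β s p Q - subCoeff2 q α β s p (q * Q) -
      (subCoeff q α β s p Q - subCoeff q α β s p (q * Q)) * subCoeff q α β s p Q := by
    linear_combination -h
  rw [hA]
  have d1 : α * β - p * Q ^ 2 ≠ 0 := hd0 _ (by positivity)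
  have d2 : α * β * q - p * Q ^ 2 ≠ 0 := by
    have := hd0 (Q ^ 2 / q) (by positivity)
    contrapose! this
    field_simp; linarith
  have d3 : α * β - p * Q ^ 2 * q ≠ 0 := by
    have := hd0 (Q ^ 2 * q) (by positivity)
    contrapose! this
    linarith
  have d4 : α * β - p * Q ^ 2 * q ^ 2 ≠ 0 := by
    have := hd0 (Q ^ 2 * q ^ 2) (by positivity)
    contrapose! this
    linarith
  have hq2 : 1 + q ≠ 0 := by positivity
  unfold subCoeff2 eigSub eigSub2 subCoeff normRatio pairFactor
  have e1 : (1 - q^2) = (1-q)*(1+q) := by ring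
  have e2 : α * β - p * Q ^ 2 / q = (α * β * q - p * Q ^ 2) / q := by field_simp
  have e3 : α * β - p * (q*Q) ^ 2 = α * β - p * Q ^ 2 * q ^ 2 := by ring
  have e4 : α * β - p * (q*Q) ^ 2 / q = α * β - p * Q ^ 2 * q := by field_simp
  have e5 : 1 - p * Q ^ 2 / (α * β) / q = (α * β * q - p * Q ^ 2) / (α * β * q) := by field_simp
  have e6 : 1 - p * Q ^ 2 / (α * β) = (α * β - p * Q ^ 2) / (α * β) := by field_simp
  have e7 : 1 - p * Q ^ 2 / (α * β) * q = (α * β - p * Q ^ 2 * q) / (α * β) := by field_simp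
  rw [e1, e2, e3, e4, e5, e6, e7]
  have : (q*Q)/q = Q := by field_simp
  rw [this]
  generalize hD1 : α * β - p * Q ^ 2 = D1 at *
  generalize hD2 : α * β * q - p * Q ^ 2 = D2 at *
  generalize hD3 : α * β - p * Q ^ 2 * q = D3 at *
  generalize hD4 : α * β - p * Q ^ 2 * q ^ 2 = D4 at *
  generalize hE1 : 1 - q = E1 at *
  generalize hE2 : 1 + q = E2 at *
  clear e1 e2 e3 e4 e5 e6 e7 this
  field_simp
  subst hD1 hD2 hD3 hD4 hE1 hE2
  ring

end IsBigQJacobiOPS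

end ExplicitCoefficients

/-! ### The functional of the weight -/

section WeightFunctional
open Polynomial

variable {q α β s p : ℝ} {c d : ℂ}

lemma summable_polynomial_mul_weight (h : Regular q α β s p) (hs : c + d = s) (hp : c * d = p)
    (f : ℝ[X]) : Summable fun x : lattice q α β => f.eval (x : ℝ) * weight q α β c d x := by
  obtain ⟨B, hB⟩ := exists_polynomial_bound h f
  exact summable_mul_weight h hs hp hB

/-- The linear functional `f ↦ ∑ f(x) W(x)` on polynomials. -/
def weightFunctional (h : Regular q α β s p) (hs : c + d = s) (hp : c * d = p) :
    ℝ[X] →ₗ[ℝ] ℝ where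
  toFun f := ∑' x : lattice q α β, f.eval (x : ℝ) * weight q α β c d x
  map_add' f g := by
    rw [← (summable_polynomial_mul_weight h hs hp f).tsum_add
      (summable_polynomial_mul_weight h hs hp g)]
    exact tsum_congr fun x => by rw [eval_add, add_mul]
  map_smul' r f := by
    rw [RingHom.id_apply, smul_eq_mul, ← tsum_mul_left]
    exact tsum_congr fun x => by rw [eval_smul, smul_eq_mul, mul_assoc]

lemma weightFunctional_apply (h : Regular q α β s p) (hs : c + d = s) (hp : c * d = p) (f : ℝ[X]) :
    weightFunctional h hs hp f = ∑' x : lattice q α β, f.eval (x : ℝ) * weight q α β c d x := rfl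

lemma infinite_lattice (h : Regular q α β s p) : (lattice q α β).Infinite := by
  have : Infinite (lattice q α β) :=
    Infinite.of_injective (fun k : ℕ => latticeEquiv h (Sum.inl k))
      ((latticeEquiv h).injective.comp Sum.inl_injective)
  exact Set.infinite_coe_iff.1 this

lemma weightFunctional_pos (h : Regular q α β s p) (hs : c + d = s) (hp : c * d = p) (f : ℝ[X])
    (hf : f ≠ 0) : 0 < weightFunctional h hs hp (f * f) := by
  obtain ⟨x, hx, hfx⟩ : ∃ x ∈ lattice q α β, f.eval x ≠ 0 := by
    by_contra! hcon
    exact hf (eq_zero_of_infinite_isRoot f ((infinite_lattice h).mono fun x hx => hcon x hx))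
  rw [weightFunctional_apply]
  refine (summable_polynomial_mul_weight h hs hp (f * f)).tsum_pos (fun y => ?_) ⟨x, hx⟩ ?_
  · rw [eval_mul]
    exact mul_nonneg (mul_self_nonneg _) (weight_pos h hs hp y.2).le
  · rw [eval_mul]
    exact mul_pos (mul_self_pos.2 hfx) (weight_pos h hs hp hx)

lemma bigQJacobi_spec (h : Regular q α β s p) (hs : c + d = s) (hp : c * d = p) (n : ℕ) :
    IsMonicOrthogonal q α β c d n (bigQJacobi q α β c d n) := by
  obtain ⟨P, h1, h2, h3⟩ := exists_monic_orthogonal (weightFunctional_pos h hs hp) n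
  have hex : ∃ P, IsMonicOrthogonal q α β c d n P := by
    refine ⟨P, h1, h2, fun k hk => ?_⟩
    rw [← h3 k hk, weightFunctional_apply]
    simp only [eval_mul, eval_pow, eval_X]
  unfold bigQJacobi
  rw [dif_pos hex]
  exact hex.choose_spec

lemma isBigQJacobiOPS (h : Regular q α β s p) (hs : c + d = s) (hp : c * d = p) :
    IsBigQJacobiOPS q α β s p (weightFunctional h hs hp) (bigQJacobi q α β c d) where
  pos := weightFunctional_pos h hs hp
  monic n := (bigQJacobi_spec h hs hp n).1
  natDegree n := (bigQJacobi_spec h hs hp n).2.1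
  orth n k hk := by
    rw [← (bigQJacobi_spec h hs hp n).2.2 k hk, weightFunctional_apply]
    simp only [eval_mul, eval_pow, eval_X]
  q_pos := h.q_pos
  q_lt_one := h.q_lt_one
  αβ_neg := mul_neg_of_pos_of_neg h.α_pos h.β_neg
  p_pos := h.p_pos
  moments k := by
    have := moment_recurrence h hs hp k
    simpa only [moment, weightFunctional_apply, eval_pow, eval_X] using this

end WeightFunctional

/-! ### Scaled parameters -/

section Scaling

variable {q α β s p : ℝ}

lemma Regular.scale (h : Regular q α β s p) (m : ℤ) :
    Regular q α β (s * q ^ m) (p * (q ^ m) ^ 2) where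
  q_pos := h.q_pos
  q_lt_one := h.q_lt_one
  α_pos := h.α_pos
  β_neg := h.β_neg
  p_pos := mul_pos h.p_pos (pow_pos (zpow_pos h.q_pos _) 2)
  left_pos n := by
    have := h.left_pos (m + n)
    rw [zpow_add₀ h.q_pos.ne'] at this
    convert this using 1
    unfold pairFactor; ring
  right_pos n := by
    have := h.right_pos (m + n)
    rw [zpow_add₀ h.q_pos.ne'] at this
    convert this using 1
    unfold pairFactor; ring

/-- The subleading coefficient in the scaled variables: with `c, d` replaced by
`c q^{1-N}, d q^{1-N}` and `Q = q^{N+j}`, it depends on `E = Q` and on `z = q^{1+j}`. -/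
def scaledSub (q α β s p E z : ℝ) : ℝ :=
  -(q * (1 - E) * ((α + β) - s * z)) / ((1 - q) * (α * β - p * z ^ 2))

/-- The recurrence coefficient `a_n` in the scaled variables. -/
def scaledRatio (q α β s p E z : ℝ) : ℝ :=
  -(q / (α * β)) * (1 - E) * (E - p * z ^ 2 / (α * β)) * pairFactor α s p z * pairFactor β s p z /
    ((1 - p * z ^ 2 / (α * β) / q) * (1 - p * z ^ 2 / (α * β)) ^ 2 *
      (1 - p * z ^ 2 / (α * β) * q))

lemma subCoeff_scale (Q r : ℝ) :
    subCoeff q α β (s * r) (p * r ^ 2) Q = scaledSub q α β s p Q (r * Q) := by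
  unfold subCoeff scaledSub
  ring_nf

lemma normRatio_scale (Q r : ℝ) :
    normRatio q α β (s * r) (p * r ^ 2) Q = scaledRatio q α β s p Q (r * Q) := by
  unfold normRatio scaledRatio pairFactor
  rw [show p * r ^ 2 * Q ^ 2 = p * (r * Q) ^ 2 by ring, show s * r * Q = s * (r * Q) by ring]

lemma abs_affine_le {A B z : ℝ} (hz : 1 ≤ z) : |A - B * z| ≤ (|A| + |B|) * z := by
  have h1 : |A - B * z| ≤ |A| + |B * z| := abs_sub _ _
  rw [abs_mul, abs_of_nonneg (zero_le_one.trans hz)] at h1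
  nlinarith [abs_nonneg A]

lemma exists_scaledSub_le (h : Regular q α β s p) : ∃ C, 0 ≤ C ∧ ∀ E z : ℝ, 0 ≤ E → E ≤ 1 → q ≤ z →
    |scaledSub q α β s p E z| ≤ C * z⁻¹ := by
  have hq := h.q_pos
  have hq1 : 0 < 1 - q := sub_pos.2 h.q_lt_one
  have hp := h.p_pos
  refine ⟨q * (|α + β| / q + |s|) / ((1 - q) * p), by positivity, fun E z hE0 hE1 hz => ?_⟩
  have hz0 : 0 < z := hq.trans_le hz
  have hαβ := mul_neg_of_pos_of_neg h.α_pos h.β_neg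
  unfold scaledSub
  rw [abs_div, abs_neg, abs_mul, abs_mul, abs_mul, abs_of_pos hq, abs_of_nonneg (sub_nonneg.2 hE1),
    abs_of_pos hq1]
  have h1 : |α + β - s * z| ≤ (|α + β| / q + |s|) * z := by
    have h2 : |α + β| / q * q ≤ |α + β| / q * z := by gcongr
    rw [div_mul_cancel₀ _ hq.ne'] at h2
    have h3 := abs_sub (α + β) (s * z)
    rw [abs_mul, abs_of_pos hz0] at h3
    linarith
  have h2 : p * z ^ 2 ≤ |α * β - p * z ^ 2| := by
    rw [abs_sub_comm]
    exact (le_abs_self _).trans' (by linarith)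
  calc q * (1 - E) * |α + β - s * z| / ((1 - q) * |α * β - p * z ^ 2|)
      ≤ q * 1 * ((|α + β| / q + |s|) * z) / ((1 - q) * (p * z ^ 2)) := by
        gcongr
        linarith
    _ = _ := by field_simp

lemma abs_pairFactor_le (a s : ℝ) {p z : ℝ} (hp : 0 < p) (hz : 1 ≤ z) :
    |pairFactor a s p z| ≤ (1 + |s / a| + p / a ^ 2) * z ^ 2 := by
  have h1 : pairFactor a s p z = (1 - s / a * z) + p / a ^ 2 * z ^ 2 := by
    unfold pairFactor; ring
  rw [h1]
  have h2 := abs_affine_le (A := 1) (B := s / a) hz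
  have h3 : z ≤ z ^ 2 := by nlinarith
  have h4 : 0 ≤ p / a ^ 2 := by positivity
  calc _ ≤ |1 - s / a * z| + |p / a ^ 2 * z ^ 2| := abs_add_le _ _
    _ ≤ (|1| + |s / a|) * z + p / a ^ 2 * z ^ 2 := by
      gcongr
      rw [abs_of_nonneg (by positivity)]
    _ ≤ (|1| + |s / a|) * z ^ 2 + p / a ^ 2 * z ^ 2 := by gcongr
    _ = _ := by rw [abs_one]; ring

/-- The denominator of `scaledRatio` grows like `z⁸`. -/
lemma denom_bounds {q t z : ℝ} (hq0 : 0 < q) (hq1 : q < 1) (ht : 0 < t) (hz : 1 ≤ z) :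
    t ^ 4 * z ^ 8 ≤ (1 + t * z ^ 2 / q) * (1 + t * z ^ 2) ^ 2 * (1 + t * z ^ 2 * q) ∧
    (1 + t * z ^ 2 / q) * (1 + t * z ^ 2) ^ 2 * (1 + t * z ^ 2 * q) ≤
      (1 + t / q) * (1 + t) ^ 2 * (1 + t * q) * z ^ 8 := by
  have hz2 : 1 ≤ z ^ 2 := one_le_pow₀ hz
  constructor
  · calc t ^ 4 * z ^ 8 = (t * z ^ 2 / q) * (t * z ^ 2) ^ 2 * (t * z ^ 2 * q) := by
          field_simp
      _ ≤ _ := by gcongr <;> linarith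
  · have e : ∀ c, 0 ≤ c → 1 + c * z ^ 2 ≤ (1 + c) * z ^ 2 := fun c hc => by nlinarith
    calc _ = (1 + t / q * z ^ 2) * (1 + t * z ^ 2) ^ 2 * (1 + t * q * z ^ 2) := by ring
      _ ≤ ((1 + t / q) * z ^ 2) * ((1 + t) * z ^ 2) ^ 2 * ((1 + t * q) * z ^ 2) := by
          gcongr
          · exact e _ (by positivity)
          · exact e _ (by positivity)
          · exact e _ (by positivity)
      _ = _ := by ring

lemma scaledRatio_eq (E z : ℝ) : scaledRatio q α β s p E z =
    (q / -(α * β)) * (1 - E) * (E + p / -(α * β) * z ^ 2) * pairFactor α s p z *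
      pairFactor β s p z / ((1 + p / -(α * β) * z ^ 2 / q) * (1 + p / -(α * β) * z ^ 2) ^ 2 *
      (1 + p / -(α * β) * z ^ 2 * q)) := by
  unfold scaledRatio
  simp only [div_neg, neg_mul, neg_div, ← sub_eq_add_neg]
  ring_nf

lemma exists_scaledRatio_le (h : Regular q α β s p) : ∃ C, 0 ≤ C ∧ ∀ E z : ℝ, 0 ≤ E → E ≤ 1 →
    1 ≤ z → |scaledRatio q α β s p E z| ≤ C * (z⁻¹) ^ 2 := by
  have hq := h.q_pos
  have hαβ : 0 < -(α * β) := neg_pos.2 (mul_neg_of_pos_of_neg h.α_pos h.β_neg)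
  have hp := h.p_pos
  have ht : 0 < p / -(α * β) := div_pos hp hαβ
  set t := p / -(α * β) with ht_def
  set A := 1 + |s / α| + p / α ^ 2
  set B := 1 + |s / β| + p / β ^ 2
  have hA : 0 ≤ A := by positivity
  have hB : 0 ≤ B := by positivity
  refine ⟨(q / -(α * β)) * (1 + t) * A * B / t ^ 4, by positivity, fun E z hE0 hE1 hz => ?_⟩
  have hz0 : 0 < z := zero_lt_one.trans_le hz
  rw [scaledRatio_eq, ← ht_def]
  obtain ⟨hd, -⟩ := denom_bounds hq h.q_lt_one ht hz
  have hd0 : 0 < t ^ 4 * z ^ 8 := by positivity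
  have e1 : E + t * z ^ 2 ≤ (1 + t) * z ^ 2 := by
    have : 1 ≤ z ^ 2 := one_le_pow₀ hz
    nlinarith
  have e2 : 0 ≤ E + t * z ^ 2 := by positivity
  rw [abs_div, abs_of_pos (hd0.trans_le hd), abs_mul, abs_mul, abs_mul, abs_mul,
    abs_of_nonneg (sub_nonneg.2 hE1), abs_of_nonneg e2, abs_of_pos (div_pos hq hαβ)]
  have e3 := abs_pairFactor_le α s hp hz
  have e4 := abs_pairFactor_le β s hp hz
  calc _ ≤ (q / -(α * β)) * 1 * ((1 + t) * z ^ 2) * (A * z ^ 2) * (B * z ^ 2) / (t ^ 4 * z ^ 8) := by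
        gcongr
        linarith
    _ = _ := by field_simp

/-- After division by `q ^ (-2n)` the pair factor converges to `p / a ^ 2 > 0`; the finitely many
remaining values are positive. -/
lemma exists_pairFactor_ge {q a s p : ℝ} (hq0 : 0 < q) (hq1 : q < 1) (ha : a ≠ 0) (hp : 0 < p)
    (hpos : ∀ n : ℤ, 0 < pairFactor a s p (q ^ n)) :
    ∃ c, 0 < c ∧ ∀ n : ℕ, c * (q ^ (-(n : ℤ))) ^ 2 ≤ pairFactor a s p (q ^ (-(n : ℤ))) := by
  have hform : ∀ n : ℕ, pairFactor a s p (q ^ (-(n : ℤ))) =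
      ((q ^ n) ^ 2 - s / a * q ^ n + p / a ^ 2) * (q ^ (-(n : ℤ))) ^ 2 := by
    intro n
    unfold pairFactor
    rw [zpow_neg, zpow_natCast]
    have : q ^ n ≠ 0 := (pow_pos hq0 n).ne'
    field_simp
  set f : ℕ → ℝ := fun n => (q ^ n) ^ 2 - s / a * q ^ n + p / a ^ 2 with hf
  have hfpos : ∀ n, 0 < f n := by
    intro n
    have := hpos (-(n : ℤ))
    rw [hform] at this
    exact pos_of_mul_pos_left this (sq_nonneg _)
  have hlim : Tendsto f atTop (𝓝 (p / a ^ 2)) := by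
    have h0 := tendsto_pow_atTop_nhds_zero_of_lt_one hq0.le hq1
    have := ((h0.pow 2).sub (h0.const_mul (s / a))).add_const (p / a ^ 2)
    simpa using this
  have hl : 0 < p / a ^ 2 := by positivity
  obtain ⟨n0, hn0⟩ := eventually_atTop.1 (hlim.eventually (lt_mem_nhds (half_lt_self hl)))
  have hmin : ∀ m : ℕ, ∃ c, 0 < c ∧ ∀ n < m, c ≤ f n := by
    intro m
    induction m with
    | zero => exact ⟨1, one_pos, by simp⟩
    | succ m ih =>
      obtain ⟨c, hc, h⟩ := ih
      refine ⟨min c (f m), lt_min hc (hfpos m), fun n hn => ?_⟩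
      rcases Nat.lt_succ_iff_lt_or_eq.1 hn with h' | rfl
      · exact (min_le_left _ _).trans (h n h')
      · exact min_le_right _ _
  obtain ⟨c, hc, h⟩ := hmin n0
  refine ⟨min c (p / a ^ 2 / 2), lt_min hc (by positivity), fun n => ?_⟩
  rw [hform]
  refine mul_le_mul_of_nonneg_right ?_ (sq_nonneg _)
  rcases lt_or_ge n n0 with h' | h'
  · exact (min_le_left _ _).trans (h n h')
  · exact (min_le_right _ _).trans (hn0 n h').le

lemma scaledRatio_zero_pos (h : Regular q α β s p) (n : ℤ) :
    0 < scaledRatio q α β s p 0 (q ^ n) := by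
  have hq := h.q_pos
  have hαβ : 0 < -(α * β) := neg_pos.2 (mul_neg_of_pos_of_neg h.α_pos h.β_neg)
  have hp := h.p_pos
  have ht : 0 < p / -(α * β) := div_pos hp hαβ
  have h1 := h.left_pos n
  have h2 := h.right_pos n
  have hz : 0 < q ^ n := zpow_pos hq _
  rw [scaledRatio_eq]
  have : 0 < q / -(α * β) := div_pos hq hαβ
  generalize p / -(α * β) = t at *
  generalize q / -(α * β) = u at *
  rw [sub_zero, zero_add]
  positivity

lemma exists_scaledRatio_ge (h : Regular q α β s p) : ∃ c, 0 < c ∧ ∀ n : ℕ,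
    c * ((q ^ (-(n : ℤ)))⁻¹) ^ 2 ≤ scaledRatio q α β s p 0 (q ^ (-(n : ℤ))) := by
  have hq := h.q_pos
  have hαβ : 0 < -(α * β) := neg_pos.2 (mul_neg_of_pos_of_neg h.α_pos h.β_neg)
  have hp := h.p_pos
  have ht : 0 < p / -(α * β) := div_pos hp hαβ
  obtain ⟨A, hA, h1⟩ := exists_pairFactor_ge hq h.q_lt_one h.α_pos.ne' hp h.left_pos
  obtain ⟨B, hB, h2⟩ := exists_pairFactor_ge hq h.q_lt_one h.β_neg.ne hp h.right_pos
  set t := p / -(α * β) with ht_def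
  obtain ⟨u, hu_def⟩ : ∃ u, u = q / -(α * β) := ⟨_, rfl⟩
  have hu : 0 < u := hu_def ▸ div_pos hq hαβ
  refine ⟨u * t * A * B / ((1 + t / q) * (1 + t) ^ 2 * (1 + t * q)), by positivity, fun n => ?_⟩
  have hz : 1 ≤ q ^ (-(n : ℤ)) := by
    rw [zpow_neg, zpow_natCast]
    exact one_le_inv₀ (pow_pos hq n) |>.2 (pow_le_one₀ hq.le h.q_lt_one.le)
  have h1 := h1 n
  have h2 := h2 n
  rw [scaledRatio_eq, ← ht_def, ← hu_def]
  generalize q ^ (-(n : ℤ)) = z at *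
  have hz0 : 0 < z := zero_lt_one.trans_le hz
  obtain ⟨-, hd⟩ := denom_bounds hq h.q_lt_one ht hz
  rw [sub_zero, zero_add]
  calc _ = u * 1 * (t * z ^ 2) * (A * z ^ 2) * (B * z ^ 2) /
        ((1 + t / q) * (1 + t) ^ 2 * (1 + t * q) * z ^ 8) := by field_simp
    _ ≤ _ := by
        have h3 : 0 < pairFactor α s p z := lt_of_lt_of_le (by positivity) h1
        have h4 : 0 < pairFactor β s p z := lt_of_lt_of_le (by positivity) h2
        gcongr

end Scaling

/-! ### Systems of orthogonal polynomials with stabilising recurrences -/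

section StableFamily
open Polynomial

/-- A family of systems of monic polynomials, `P N j` being the polynomial of degree `N + j` of the
`N`-th system (and `0` for `N + j < 0`), with three term recurrences whose coefficients `a N j`,
`b N j` converge as `N → ∞` to `a' j > 0`, `b' j`. As `j → -∞` they decay like `q^{-2j}` and
`q^{-j}`, uniformly in `N`, and the decay of `a'` is not faster. -/
structure IsStableFamily (q : ℝ) (P : ℕ → ℤ → ℝ[X]) (a b : ℕ → ℤ → ℝ) (a' b' : ℤ → ℝ) : Prop where
  q_pos : 0 < q
  q_lt_one : q < 1
  zero_of_neg : ∀ (N : ℕ) (j : ℤ), (N : ℤ) + j < 0 → P N j = 0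
  monic : ∀ (N : ℕ) (j : ℤ), 0 ≤ (N : ℤ) + j → (P N j).Monic
  natDegree : ∀ (N : ℕ) (j : ℤ), 0 ≤ (N : ℤ) + j → ((P N j).natDegree : ℤ) = N + j
  three_term : ∀ (N : ℕ) (j : ℤ), 0 ≤ (N : ℤ) + j →
    X * P N j = P N (j + 1) + C (b N j) * P N j + C (a N j) * P N (j - 1)
  a_bot : ∀ N : ℕ, a N (-(N : ℤ)) = 0
  tendsto_a : ∀ j, Tendsto (fun N => a N j) atTop (𝓝 (a' j))
  tendsto_b : ∀ j, Tendsto (fun N => b N j) atTop (𝓝 (b' j))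
  bound : ∃ C, 0 ≤ C ∧ ∀ (N : ℕ) (j : ℤ), j < 0 → |b N j| ≤ C * q ^ (-j) ∧ |a N j| ≤ C * (q ^ (-j)) ^ 2
  a_pos : ∀ j, 0 < a' j
  lower : ∃ c, 0 < c ∧ ∀ j < 0, c * (q ^ (-j)) ^ 2 ≤ a' j

variable {q α β s p : ℝ} {γ δ : ℂ}

/-- The big `q`-Jacobi polynomials with parameters `γ q^{1-N}, δ q^{1-N}`, with the degree counted
from `N`. -/
def shiftedPoly (q α β : ℝ) (γ δ : ℂ) (N : ℕ) (j : ℤ) : ℝ[X] :=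
  if 0 ≤ (N : ℤ) + j then
    bigQJacobi q α β (γ * (q : ℂ) ^ (1 - (N : ℤ))) (δ * (q : ℂ) ^ (1 - (N : ℤ))) ((N : ℤ) + j).toNat
  else 0

/-- The coefficient `a` of the recurrence of `shiftedPoly`. -/
def shiftedA (q α β s p : ℝ) (N : ℕ) (j : ℤ) : ℝ :=
  if 0 ≤ (N : ℤ) + j then scaledRatio q α β s p (q ^ ((N : ℤ) + j)) (q ^ (1 + j)) else 0

/-- The coefficient `b` of the recurrence of `shiftedPoly`. -/
def shiftedB (q α β s p : ℝ) (N : ℕ) (j : ℤ) : ℝ :=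
  if 0 ≤ (N : ℤ) + j then scaledSub q α β s p (q ^ ((N : ℤ) + j)) (q ^ (1 + j)) -
    scaledSub q α β s p (q ^ ((N : ℤ) + j + 1)) (q ^ (1 + j + 1)) else 0

lemma scaled_add (hs : γ + δ = s) (m : ℤ) :
    γ * (q : ℂ) ^ m + δ * (q : ℂ) ^ m = ((s * q ^ m : ℝ) : ℂ) := by
  push_cast; rw [← hs]; ring

lemma scaled_mul (hp : γ * δ = p) (m : ℤ) :
    γ * (q : ℂ) ^ m * (δ * (q : ℂ) ^ m) = ((p * (q ^ m) ^ 2 : ℝ) : ℂ) := by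
  push_cast; rw [← hp]; ring

/-- The functional of the weight with parameters `γ q^{1-N}, δ q^{1-N}`. -/
def shiftedFunctional (h : Regular q α β s p) (hs : γ + δ = s) (hp : γ * δ = p) (N : ℕ) :
    ℝ[X] →ₗ[ℝ] ℝ :=
  weightFunctional (h.scale (1 - (N : ℤ))) (scaled_add hs _) (scaled_mul hp _)

lemma shifted_isOPS (h : Regular q α β s p) (hs : γ + δ = s) (hp : γ * δ = p) (N : ℕ) :
    IsBigQJacobiOPS q α β (s * q ^ (1 - (N : ℤ))) (p * (q ^ (1 - (N : ℤ))) ^ 2)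
      (shiftedFunctional h hs hp N)
      (bigQJacobi q α β (γ * (q : ℂ) ^ (1 - (N : ℤ))) (δ * (q : ℂ) ^ (1 - (N : ℤ)))) :=
  isBigQJacobiOPS _ _ _

lemma shiftedPoly_natCast {N : ℕ} {j : ℤ} {n : ℕ} (hn : (N : ℤ) + j = n) :
    shiftedPoly q α β γ δ N j =
      bigQJacobi q α β (γ * (q : ℂ) ^ (1 - (N : ℤ))) (δ * (q : ℂ) ^ (1 - (N : ℤ))) n := by
  unfold shiftedPoly
  rw [if_pos (by omega), hn, Int.toNat_natCast]

lemma shiftedPoly_neg {N : ℕ} {j : ℤ} (hn : (N : ℤ) + j < 0) : shiftedPoly q α β γ δ N j = 0 :=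
  if_neg (by omega)

lemma subCoeff_shift (hq : q ≠ 0) {N : ℕ} {j : ℤ} {n : ℕ} (hn : (N : ℤ) + j = n) :
    subCoeff q α β (s * q ^ (1 - (N : ℤ))) (p * (q ^ (1 - (N : ℤ))) ^ 2) (q ^ n) =
      scaledSub q α β s p (q ^ ((N : ℤ) + j)) (q ^ (1 + j)) := by
  rw [subCoeff_scale, ← zpow_natCast, ← hn, ← zpow_add₀ hq]
  congr 2; ring

lemma normRatio_shift (hq : q ≠ 0) {N : ℕ} {j : ℤ} {n : ℕ} (hn : (N : ℤ) + j = n) :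
    normRatio q α β (s * q ^ (1 - (N : ℤ))) (p * (q ^ (1 - (N : ℤ))) ^ 2) (q ^ n) =
      scaledRatio q α β s p (q ^ ((N : ℤ) + j)) (q ^ (1 + j)) := by
  rw [normRatio_scale, ← zpow_natCast, ← hn, ← zpow_add₀ hq]
  congr 2; ring

lemma shifted_rec (h : Regular q α β s p) (hs : γ + δ = s) (hp : γ * δ = p) (N : ℕ) (j : ℤ)
    (hj : 0 ≤ (N : ℤ) + j) :
    X * shiftedPoly q α β γ δ N j = shiftedPoly q α β γ δ N (j + 1) +
      C (shiftedB q α β s p N j) * shiftedPoly q α β γ δ N j +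
      C (shiftedA q α β s p N j) * shiftedPoly q α β γ δ N (j - 1) := by
  have hq := h.q_pos.ne'
  have hP := shifted_isOPS h hs hp N
  obtain ⟨n, hn⟩ := Int.eq_ofNat_of_zero_le hj
  have hn1 : (N : ℤ) + (j + 1) = (n + 1 : ℕ) := by push_cast; omega
  have e2 := subCoeff_shift (α := α) (β := β) (s := s) (p := p) hq hn1
  rw [show 1 + (j + 1) = 1 + j + 1 by ring, show (N : ℤ) + (j + 1) = N + j + 1 by ring] at e2
  rw [shiftedPoly_natCast hn, shiftedPoly_natCast hn1]
  unfold shiftedB shiftedA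
  rw [if_pos hj, if_pos hj, ← e2, ← subCoeff_shift hq hn, ← normRatio_shift hq hn]
  rcases n with _ | n
  · rw [shiftedPoly_neg (by omega), hP.toIsMonicOPS.three_term_zero]
    have := hP.coeff_sub_one 0
    rw [zero_add] at this
    rw [this]
    have h1 : subCoeff q α β (s * q ^ (1 - (N : ℤ))) (p * (q ^ (1 - (N : ℤ))) ^ 2) (q ^ 0) = 0 := by
      simp [subCoeff]
    rw [h1]
    simp
  · rw [shiftedPoly_natCast (n := n) (by push_cast at hn ⊢; omega), hP.toIsMonicOPS.three_term n,
      hP.norm_ratio, hP.coeff_sub_one, hP.coeff_sub_one]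

lemma shifted_norm_ratio (h : Regular q α β s p) (hs : γ + δ = s) (hp : γ * δ = p) (N : ℕ) (j : ℤ)
    (hj : 0 < (N : ℤ) + j) :
    shiftedFunctional h hs hp N (shiftedPoly q α β γ δ N j * shiftedPoly q α β γ δ N j) /
    shiftedFunctional h hs hp N
      (shiftedPoly q α β γ δ N (j - 1) * shiftedPoly q α β γ δ N (j - 1)) =
      shiftedA q α β s p N j := by
  have hq := h.q_pos.ne'
  obtain ⟨n, hn⟩ := Int.eq_ofNat_of_zero_le hj.le
  obtain ⟨n, rfl⟩ : ∃ m, n = m + 1 := ⟨n - 1, by omega⟩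
  unfold shiftedA
  rw [if_pos hj.le, shiftedPoly_natCast hn, shiftedPoly_natCast (n := n) (by push_cast at hn; omega),
    ← normRatio_shift hq hn]
  exact (shifted_isOPS h hs hp N).norm_ratio n

lemma tendsto_zpow_add (hq0 : 0 < q) (hq1 : q < 1) (j : ℤ) :
    Tendsto (fun N : ℕ => q ^ ((N : ℤ) + j)) atTop (𝓝 0) := by
  have := (tendsto_pow_atTop_nhds_zero_of_lt_one hq0.le hq1).mul_const (q ^ j)
  rw [zero_mul] at this
  refine this.congr fun N => ?_
  rw [zpow_add₀ hq0.ne', zpow_natCast]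

lemma eventually_nonneg_add (j : ℤ) : ∀ᶠ N : ℕ in atTop, 0 ≤ (N : ℤ) + j := by
  filter_upwards [eventually_ge_atTop (-j).toNat] with N hN
  omega

lemma shifted_isStable (h : Regular q α β s p) (hs : γ + δ = s) (hp : γ * δ = p) :
    IsStableFamily q (shiftedPoly q α β γ δ) (shiftedA q α β s p) (shiftedB q α β s p)
      (fun j => scaledRatio q α β s p 0 (q ^ (1 + j)))
      (fun j => scaledSub q α β s p 0 (q ^ (1 + j)) - scaledSub q α β s p 0 (q ^ (1 + j + 1))) where
  q_pos := h.q_pos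
  q_lt_one := h.q_lt_one
  zero_of_neg N j hj := shiftedPoly_neg hj
  monic N j hj := by
    obtain ⟨n, hn⟩ := Int.eq_ofNat_of_zero_le hj
    rw [shiftedPoly_natCast hn]
    exact (shifted_isOPS h hs hp N).monic n
  natDegree N j hj := by
    obtain ⟨n, hn⟩ := Int.eq_ofNat_of_zero_le hj
    rw [shiftedPoly_natCast hn, (shifted_isOPS h hs hp N).natDegree n, hn]
  three_term N j hj := shifted_rec h hs hp N j hj
  a_bot N := by simp [shiftedA, scaledRatio]
  tendsto_a j := by
    have hc : Continuous fun E => scaledRatio q α β s p E (q ^ (1 + j)) := by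
      unfold scaledRatio; fun_prop
    refine ((hc.tendsto 0).comp (tendsto_zpow_add h.q_pos h.q_lt_one j)).congr' ?_
    filter_upwards [eventually_nonneg_add j] with N hN
    simp [shiftedA, hN]
  tendsto_b j := by
    have hc : ∀ z, Continuous fun E => scaledSub q α β s p E z := by
      intro z; unfold scaledSub; fun_prop
    have h2 := tendsto_zpow_add h.q_pos h.q_lt_one (j + 1)
    refine ((((hc (q ^ (1 + j))).tendsto 0).comp (tendsto_zpow_add h.q_pos h.q_lt_one j)).sub
      (((hc (q ^ (1 + j + 1))).tendsto 0).comp h2)).congr' ?_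
    filter_upwards [eventually_nonneg_add j] with N hN
    simp [shiftedB, hN, add_assoc]
  bound := by
    have hq := h.q_pos
    obtain ⟨C1, hC1, h1⟩ := exists_scaledSub_le h
    obtain ⟨C2, hC2, h2⟩ := exists_scaledRatio_le h
    have hE : ∀ i : ℤ, 0 ≤ i → q ^ i ≤ 1 := fun i hi => zpow_le_one₀ hq h.q_lt_one.le hi
    have hE0 : ∀ i : ℤ, 0 ≤ q ^ i := fun i => (zpow_pos hq i).le
    have hz : ∀ i : ℤ, i ≤ 0 → 1 ≤ q ^ i := fun i hi =>
      one_le_zpow_of_nonpos₀ hq h.q_lt_one.le hi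
    have hinv1 : ∀ j : ℤ, (q ^ (1 + j))⁻¹ = q⁻¹ * q ^ (-j) := fun j => by
      rw [zpow_add₀ hq.ne', zpow_one, mul_inv, zpow_neg]
    have hinv2 : ∀ j : ℤ, (q ^ (1 + j + 1))⁻¹ = q⁻¹ ^ 2 * q ^ (-j) := fun j => by
      rw [show 1 + j + 1 = 2 + j by ring, zpow_add₀ hq.ne', mul_inv, zpow_neg, inv_pow]
      norm_cast
    refine ⟨max (C1 * q⁻¹ + C1 * q⁻¹ ^ 2) (C2 * q⁻¹ ^ 2), le_max_of_le_right (by positivity),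
      fun N j hj => ?_⟩
    have hqj := hE0 (-j)
    rcases lt_or_ge ((N : ℤ) + j) 0 with hN | hN
    · rw [shiftedB, shiftedA, if_neg (by omega), if_neg (by omega), abs_zero]
      constructor <;> positivity
    · rw [shiftedB, shiftedA, if_pos hN, if_pos hN]
      constructor
      · refine le_trans ?_ (mul_le_mul_of_nonneg_right (le_max_left _ _) hqj)
        have g1 := h1 (q ^ ((N : ℤ) + j)) (q ^ (1 + j)) (hE0 _) (hE _ hN)
          (h.q_lt_one.le.trans (hz _ (by omega)))
        have hq2 : q ≤ q ^ (1 + j + 1) := by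
          have := hz (1 + j) (by omega)
          rw [zpow_add_one₀ hq.ne']
          nlinarith
        have g2 := h1 (q ^ ((N : ℤ) + j + 1)) (q ^ (1 + j + 1)) (hE0 _) (hE _ (by omega)) hq2
        rw [hinv1] at g1
        rw [hinv2] at g2
        refine (abs_sub _ _).trans ((add_le_add g1 g2).trans (le_of_eq ?_))
        ring
      · refine le_trans ?_ (mul_le_mul_of_nonneg_right (le_max_right _ _) (sq_nonneg _))
        have g1 := h2 (q ^ ((N : ℤ) + j)) (q ^ (1 + j)) (hE0 _) (hE _ hN) (hz _ (by omega))
        rw [hinv1] at g1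
        refine g1.trans (le_of_eq ?_)
        ring
  a_pos j := scaledRatio_zero_pos h _
  lower := by
    have hq := h.q_pos
    obtain ⟨c, hc, h1⟩ := exists_scaledRatio_ge h
    refine ⟨c * (q⁻¹) ^ 2, by positivity, fun j hj => ?_⟩
    obtain ⟨n, hn⟩ := Int.eq_ofNat_of_zero_le (show 0 ≤ -(1 + j) by omega)
    have := h1 n
    rw [show -(n : ℤ) = 1 + j by omega] at this
    refine le_trans (le_of_eq ?_) this
    rw [zpow_add₀ hq.ne', zpow_neg, zpow_one, mul_inv]
    ring

end StableFamily

/-! ### Multiplication by powers of the variable -/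

section PowerCoefficients
open Polynomial

/-- The matrix entries of the multiplication by `x^k`: `x^k P_j = ∑_r powCoeff a b k j r • P_{j+r}`
when `x P_j = P_{j+1} + b_j P_j + a_j P_{j-1}`. -/
def powCoeff (a b : ℤ → ℝ) : ℕ → ℤ → ℤ → ℝ
  | 0, _, r => if r = 0 then 1 else 0
  | k + 1, j, r => powCoeff a b k j (r - 1) + b (j + r) * powCoeff a b k j r +
      a (j + r + 1) * powCoeff a b k j (r + 1)

lemma powCoeff_eq_zero (a b : ℤ → ℝ) (k : ℕ) (j r : ℤ) (h : (k : ℤ) < |r|) :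
    powCoeff a b k j r = 0 := by
  induction k generalizing r with
  | zero =>
    have : r ≠ 0 := by rintro rfl; simp at h
    simp [powCoeff, this]
  | succ k ih =>
    have h' : (k : ℤ) + 1 < |r| := by exact_mod_cast h
    rw [powCoeff, ih r (by omega), ih (r - 1), ih (r + 1)]
    · ring
    · rcases abs_cases r with ⟨h1, h2⟩ | ⟨h1, h2⟩
      · rw [abs_of_nonneg (by omega)]; omega
      · rw [abs_of_nonpos (by omega)]; omega
    · rcases abs_cases r with ⟨h1, h2⟩ | ⟨h1, h2⟩
      · rw [abs_of_nonneg (by omega)]; omega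
      · rw [abs_of_nonpos (by omega)]; omega

lemma powCoeff_top (a b : ℤ → ℝ) (k : ℕ) (j : ℤ) : powCoeff a b k j k = 1 := by
  induction k with
  | zero => simp [powCoeff]
  | succ k ih =>
    rw [powCoeff, powCoeff_eq_zero a b k j ((k + 1 : ℕ) : ℤ), powCoeff_eq_zero a b k j (_ + 1)]
    · push_cast
      rw [add_sub_cancel_right, ih]; ring
    · rw [abs_of_nonneg (by omega)]; omega
    · rw [abs_of_nonneg (by omega)]; omega

/-- A sum over a symmetric window does not change under a shift by one of a function supported in
the smaller window. -/
lemma sum_window_shift {M : Type*} [AddCommMonoid M] (k : ℕ) (g : ℤ → M)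
    (hg : ∀ r, (k : ℤ) < |r| → g r = 0) (t : ℤ) (ht : |t| ≤ 1) :
    ∑ r ∈ Finset.Icc (-(k : ℤ)) k, g r =
      ∑ r ∈ Finset.Icc (-((k + 1 : ℕ) : ℤ)) ((k + 1 : ℕ) : ℤ), g (r + t) := by
  have ht' := abs_le.1 ht
  rw [← finsum_eq_sum_of_support_subset (f := g), ← finsum_eq_sum_of_support_subset,
    ← finsum_comp_equiv (Equiv.addRight t)]
  · rfl
  · intro r hr
    rw [Finset.coe_Icc, Set.mem_Icc]
    by_contra hcon
    refine hr (hg _ ?_)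
    rw [lt_abs]
    push_cast at hcon
    omega
  · intro r hr
    rw [Finset.coe_Icc, Set.mem_Icc]
    by_contra hcon
    refine hr (hg _ ?_)
    rw [lt_abs]
    omega

/-- The `(j, j + r)` entry of the `k`-th power of a Jacobi matrix whose coefficients decay
geometrically as `j → -∞`: each step that is not a step up contributes a power of `q ^ (-j)`. -/
lemma exists_powCoeff_le {q C : ℝ} (hq0 : 0 < q) (hq1 : q < 1) (hC : 0 ≤ C) (k : ℕ) :
    ∃ C', 0 ≤ C' ∧ ∀ a b : ℤ → ℝ,
      (∀ j < 0, |b j| ≤ C * q ^ (-j) ∧ |a j| ≤ C * (q ^ (-j)) ^ 2) →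
      ∀ j : ℤ, j < -(k : ℤ) → ∀ r : ℤ,
        |powCoeff a b k j r| ≤ C' * (q ^ (-j)) ^ ((k : ℤ) - r) := by
  induction k with
  | zero =>
    refine ⟨1, zero_le_one, fun a b _ j _ r => ?_⟩
    by_cases hr : r = 0
    · simp [powCoeff, hr]
    · simp only [powCoeff, hr, if_false, abs_zero]
      have := zpow_pos hq0 (-j)
      positivity
  | succ k ih =>
    obtain ⟨C', hC', h⟩ := ih
    set D := q ^ (-(k : ℤ)) with hD
    have hD0 : 0 < D := zpow_pos hq0 _
    refine ⟨C' + C * D * C' + C * D ^ 2 * C', by positivity, fun a b hab j hj r => ?_⟩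
    push_cast at hj
    have hy : 0 < q ^ (-j) := zpow_pos hq0 _
    have hr : ∀ r : ℤ, r ≤ k → q ^ (-(j + r)) ≤ D * q ^ (-j) := by
      intro r hr
      rw [neg_add, zpow_add₀ hq0.ne', mul_comm]
      gcongr ?_ * _
      exact zpow_le_zpow_right_of_le_one₀ hq0 hq1.le (by omega)
    have t1 := h a b hab j (by omega) (r - 1)
    have t2 : |b (j + r) * powCoeff a b k j r| ≤
        C * D * C' * (q ^ (-j)) ^ (((k + 1 : ℕ) : ℤ) - r) := by
      rcases lt_or_ge (k : ℤ) |r| with hr' | hr'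
      · rw [powCoeff_eq_zero _ _ _ _ _ hr', mul_zero, abs_zero]; positivity
      · have hr' := abs_le.1 hr'
        rw [abs_mul]
        calc _ ≤ C * (D * q ^ (-j)) * (C' * (q ^ (-j)) ^ ((k : ℤ) - r)) := by
              gcongr
              · exact (hab _ (by omega)).1.trans (by gcongr; exact hr r hr'.2)
              · exact h a b hab j (by omega) r
          _ = C * D * C' * ((q ^ (-j)) ^ ((k : ℤ) - r) * q ^ (-j)) := by ring
          _ = _ := by
              rw [← zpow_add_one₀ hy.ne']
              congr 2; push_cast; ring
    have t3 : |a (j + r + 1) * powCoeff a b k j (r + 1)| ≤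
        C * D ^ 2 * C' * (q ^ (-j)) ^ (((k + 1 : ℕ) : ℤ) - r) := by
      rcases lt_or_ge (k : ℤ) |r + 1| with hr' | hr'
      · rw [powCoeff_eq_zero _ _ _ _ _ hr', mul_zero, abs_zero]; positivity
      · have hr' := abs_le.1 hr'
        rw [abs_mul]
        calc _ ≤ C * (D * q ^ (-j)) ^ 2 * (C' * (q ^ (-j)) ^ ((k : ℤ) - (r + 1))) := by
              gcongr
              · refine (hab _ (by omega)).2.trans ?_
                rw [add_assoc]
                have := zpow_pos hq0 (-(j + (r + 1)))
                gcongr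
                exact hr (r + 1) hr'.2
              · exact h a b hab j (by omega) (r + 1)
          _ = C * D ^ 2 * C' * ((q ^ (-j)) ^ ((k : ℤ) - (r + 1)) * (q ^ (-j)) ^ (2 : ℤ)) := by
              rw [zpow_ofNat]; ring
          _ = _ := by
              rw [← zpow_add₀ hy.ne']
              congr 2; push_cast; ring
    rw [powCoeff]
    have e1 : (k : ℤ) - (r - 1) = ((k + 1 : ℕ) : ℤ) - r := by push_cast; ring
    rw [e1] at t1
    refine (abs_add_le _ _).trans ((add_le_add (abs_add_le _ _) le_rfl).trans ?_)
    linarith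

namespace IsStableFamily

variable {q : ℝ} {P : ℕ → ℤ → ℝ[X]} {a b : ℕ → ℤ → ℝ} {a' b' : ℤ → ℝ}

lemma powCoeff_eq_zero_of_neg (h : IsStableFamily q P a b a' b') (N k : ℕ) {j r : ℤ}
    (hj : 0 ≤ (N : ℤ) + j) (hr : (N : ℤ) + j + r < 0) : powCoeff (a N) (b N) k j r = 0 := by
  induction k generalizing r with
  | zero =>
    have : r ≠ 0 := by omega
    simp [powCoeff, this]
  | succ k ih =>
    rw [powCoeff, ih (by omega), ih hr]
    rcases eq_or_ne ((N : ℤ) + j + r + 1) 0 with h0 | h0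
    · rw [show j + r + 1 = -(N : ℤ) by omega, h.a_bot]; ring
    · rw [ih (r := r + 1) (by omega)]; ring

lemma X_pow_mul (h : IsStableFamily q P a b a' b') (N k : ℕ) {j : ℤ} (hj : 0 ≤ (N : ℤ) + j) :
    X ^ k * P N j =
      ∑ r ∈ Finset.Icc (-(k : ℤ)) k, C (powCoeff (a N) (b N) k j r) * P N (j + r) := by
  induction k with
  | zero => simp [powCoeff]
  | succ k ih =>
    set c := powCoeff (a N) (b N) k j with hc
    have hc0 : ∀ r, (k : ℤ) < |r| → c r = 0 := fun r hr => powCoeff_eq_zero _ _ _ _ _ hr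
    have step : ∀ r, X * (C (c r) * P N (j + r)) = C (c r) * P N (j + r + 1) +
        C (c r) * (C (b N (j + r)) * P N (j + r)) +
        C (c r) * (C (a N (j + r)) * P N (j + r - 1)) := by
      intro r
      rcases lt_or_ge ((N : ℤ) + j + r) 0 with hr | hr
      · have : c r = 0 := h.powCoeff_eq_zero_of_neg N k hj hr
        simp [this]
      · rw [mul_left_comm, h.three_term N (j + r) (by omega)]; ring
    rw [pow_succ', mul_assoc, ih, Finset.mul_sum, Finset.sum_congr rfl fun r _ => step r,
      Finset.sum_add_distrib, Finset.sum_add_distrib,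
      sum_window_shift k (fun r => C (c r) * P N (j + r + 1)) (fun r hr => by simp [hc0 r hr]) (-1)
        (by simp),
      sum_window_shift k (fun r => C (c r) * (C (b N (j + r)) * P N (j + r)))
        (fun r hr => by simp [hc0 r hr]) 0 (by simp),
      sum_window_shift k (fun r => C (c r) * (C (a N (j + r)) * P N (j + r - 1)))
        (fun r hr => by simp [hc0 r hr]) 1 (by simp),
      ← Finset.sum_add_distrib, ← Finset.sum_add_distrib]
    refine Finset.sum_congr rfl fun r _ => ?_
    rw [powCoeff, ← hc]
    simp only [add_zero, map_add, map_mul]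
    rw [show j + (r + -1) + 1 = j + r by ring, show j + (r + 1) - 1 = j + r by ring,
      show r + -1 = r - 1 by ring, show j + (r + 1) = j + r + 1 by ring]
    ring

lemma tendsto_powCoeff (h : IsStableFamily q P a b a' b') (k : ℕ) (j r : ℤ) :
    Tendsto (fun N => powCoeff (a N) (b N) k j r) atTop (𝓝 (powCoeff a' b' k j r)) := by
  induction k generalizing r with
  | zero => exact tendsto_const_nhds
  | succ k ih =>
    exact ((ih _).add ((h.tendsto_b _).mul (ih _))).add ((h.tendsto_a _).mul (ih _))

lemma exists_powCoeff_diag_le (h : IsStableFamily q P a b a' b') (k : ℕ) :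
    ∃ C, 0 ≤ C ∧ ∀ N (j : ℤ), j < -(k : ℤ) →
      |powCoeff (a N) (b N) k j 0| ≤ C * (q ^ (-j)) ^ k := by
  obtain ⟨C, hC, hb⟩ := h.bound
  obtain ⟨C', hC', h'⟩ := exists_powCoeff_le h.q_pos h.q_lt_one hC k
  refine ⟨C', hC', fun N j hj => ?_⟩
  have := h' (a N) (b N) (hb N) j hj 0
  rwa [sub_zero, zpow_natCast] at this

/-- The sums of the diagonal entries of the deep rows converge, by domination. -/
lemma tendsto_sum_powCoeff_diag (h : IsStableFamily q P a b a' b') {k m : ℕ} (hk : 1 ≤ k)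
    (hm : k ≤ m) : ∃ l, Tendsto
      (fun N : ℕ => ∑ i ∈ Finset.Ico m N, powCoeff (a N) (b N) k (-1 - (i : ℤ)) 0) atTop (𝓝 l) := by
  obtain ⟨C, hC, hb⟩ := h.exists_powCoeff_diag_le k
  have hq := h.q_pos
  refine ⟨∑' i : ℕ, if m ≤ i then powCoeff a' b' k (-1 - (i : ℤ)) 0 else 0, ?_⟩
  have key := tendsto_tsum_of_dominated_convergence (𝓕 := atTop)
    (f := fun (N i : ℕ) => if i ∈ Finset.Ico m N then powCoeff (a N) (b N) k (-1 - (i : ℤ)) 0 else 0)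
    (g := fun i : ℕ => if m ≤ i then powCoeff a' b' k (-1 - (i : ℤ)) 0 else 0)
    (bound := fun i => C * q ^ i)
    ((summable_geometric_of_lt_one hq.le h.q_lt_one).mul_left C) ?_ ?_
  · refine key.congr fun N => ?_
    rw [tsum_eq_sum (s := Finset.Ico m N) fun i hi => if_neg hi]
    exact Finset.sum_congr rfl fun i hi => if_pos hi
  · intro i
    by_cases hi : m ≤ i
    · rw [if_pos hi]
      refine (h.tendsto_powCoeff k (-1 - (i : ℤ)) 0).congr' ?_
      filter_upwards [eventually_gt_atTop i] with N hN
      rw [if_pos (Finset.mem_Ico.2 ⟨hi, hN⟩)]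
    · rw [if_neg hi]
      refine tendsto_const_nhds.congr fun N => ?_
      rw [if_neg fun hcon => hi (Finset.mem_Ico.1 hcon).1]
  · refine Eventually.of_forall fun N i => ?_
    split_ifs with hi
    · have hi := Finset.mem_Ico.1 hi
      refine (hb N _ (by omega)).trans ?_
      gcongr
      have e : q ^ (-(-1 - (i : ℤ))) = q ^ (i + 1) := by
        rw [← zpow_natCast]; congr 1; push_cast; ring
      rw [e, ← pow_mul]
      exact pow_le_pow_of_le_one hq.le h.q_lt_one.le (by nlinarith)
    · rw [norm_zero]; positivity

end IsStableFamily
end PowerCoefficients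

/-! ### Alternants -/

section Alternants

variable {P : ℕ → ℤ → Polynomial ℝ}

/-- The matrix `[P_{w_i}(x_j)]` of size `N` attached to a word `w : ℕ → ℤ`. -/
def alternantMatrix (P : ℕ → ℤ → Polynomial ℝ) (N : ℕ) (w : ℕ → ℤ) :
    Matrix (Fin N) (Fin N) (MvPolynomial (Fin N) ℝ) :=
  Matrix.of fun i j => Polynomial.aeval (MvPolynomial.X j : MvPolynomial (Fin N) ℝ) (P N (w i))

/-- The alternant `det [P_{w_i}(x_j)]`. -/
def alternant (P : ℕ → ℤ → Polynomial ℝ) (N : ℕ) (w : ℕ → ℤ) : MvPolynomial (Fin N) ℝ :=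
  (alternantMatrix P N w).det

/-- The word `w` agrees with the vacuum `-1, -2, -3, …` from the index `m` on. -/
def IsWord (m : ℕ) (w : ℕ → ℤ) : Prop := ∀ i, m ≤ i → w i = -1 - (i : ℤ)

/-- The degree of a word relative to the vacuum. -/
def wordDegree (m : ℕ) (w : ℕ → ℤ) : ℤ := ∑ i ∈ Finset.range m, (w i + 1 + i)

/-- The strictly decreasing word `λ_i - i` (`i = 1, 2, …`) of a partition. -/
def wordOf (ν : YoungDiagram) (i : ℕ) : ℤ := (ν.rowLen i : ℤ) - 1 - i

lemma rowLen_eq_zero {ν : YoungDiagram} {i : ℕ} (h : ν.colLen 0 ≤ i) : ν.rowLen i = 0 := by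
  by_contra hne
  have h1 : (i, 0) ∈ ν := YoungDiagram.mem_iff_lt_rowLen.2 (Nat.pos_of_ne_zero hne)
  exact absurd (YoungDiagram.mem_iff_lt_colLen.1 h1) (by omega)

lemma isWord_wordOf {ν : YoungDiagram} {m : ℕ} (h : ν.colLen 0 ≤ m) : IsWord m (wordOf ν) := by
  intro i hi
  simp [wordOf, rowLen_eq_zero (h.trans hi)]

lemma card_eq_sum_rowLen {ν : YoungDiagram} {m : ℕ} (h : ν.colLen 0 ≤ m) :
    ν.card = ∑ i ∈ Finset.range m, ν.rowLen i := by
  have hmap : ∀ c ∈ ν.cells, c.1 ∈ Finset.range m := by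
    intro c hc
    rw [Finset.mem_range]
    refine lt_of_lt_of_le ?_ h
    rw [← YoungDiagram.mem_iff_lt_colLen]
    exact ν.up_left_mem le_rfl (Nat.zero_le c.2) (YoungDiagram.mem_cells _ |>.1 hc)
  rw [YoungDiagram.card, Finset.card_eq_sum_card_fiberwise hmap]
  refine Finset.sum_congr rfl fun i _ => ?_
  rw [YoungDiagram.rowLen_eq_card]
  rfl

lemma wordDegree_wordOf {ν : YoungDiagram} {m : ℕ} (h : ν.colLen 0 ≤ m) :
    wordDegree m (wordOf ν) = ν.card := by
  rw [card_eq_sum_rowLen h, wordDegree]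
  push_cast
  refine Finset.sum_congr rfl fun i _ => ?_
  rw [wordOf]; ring

lemma wordOf_strictAnti (ν : YoungDiagram) : StrictAnti (wordOf ν) := by
  intro i j hij
  have := ν.rowLen_anti i j hij.le
  unfold wordOf
  omega

lemma ext_rowLen {ν ν' : YoungDiagram} (h : ∀ i, ν.rowLen i = ν'.rowLen i) :
    ν = ν' := by
  refine YoungDiagram.ext (Finset.ext ?_)
  rintro ⟨i, j⟩
  rw [YoungDiagram.mem_cells, YoungDiagram.mem_cells, YoungDiagram.mem_iff_lt_rowLen,
    YoungDiagram.mem_iff_lt_rowLen, h]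

lemma exists_youngDiagram {l : ℕ → ℕ} (hl : Antitone l) {m : ℕ} (hm : ∀ i, m ≤ i → l i = 0) :
    ∃ ν : YoungDiagram, ∀ i, ν.rowLen i = l i := by
  let ν : YoungDiagram :=
    { cells := ((Finset.range m) ×ˢ (Finset.range (l 0))).filter fun c => c.2 < l c.1
      isLowerSet := by
        rintro ⟨i, j⟩ ⟨i', j'⟩ hle hc
        obtain ⟨h1, h2⟩ : i' ≤ i ∧ j' ≤ j := hle
        simp only [Finset.coe_filter, Finset.mem_product, Finset.mem_range, Set.mem_ofPred_eq] at hc ⊢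
        have := hl h1
        exact ⟨⟨by omega, by omega⟩, by omega⟩ }
  refine ⟨ν, fun i => ?_⟩
  have hmem : ∀ j, (i, j) ∈ ν ↔ j < l i := by
    intro j
    rw [← YoungDiagram.mem_cells]
    simp only [ν, Finset.mem_filter, Finset.mem_product, Finset.mem_range]
    refine ⟨fun h => h.2, fun h => ⟨⟨?_, ?_⟩, h⟩⟩
    · by_contra hcon
      have := hm i (by omega)
      omega
    · have := hl (Nat.zero_le i)
      omega
  have h2 : ∀ j, j < ν.rowLen i ↔ j < l i := fun j => by
    rw [← YoungDiagram.mem_iff_lt_rowLen, hmem]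
  have := h2 (l i)
  have := h2 (ν.rowLen i)
  omega

lemma IsWord.mono {m m' : ℕ} {w : ℕ → ℤ} (h : IsWord m w) (hm : m ≤ m') : IsWord m' w :=
  fun i hi => h i (hm.trans hi)

lemma wordDegree_mono {m m' : ℕ} {w : ℕ → ℤ} (h : IsWord m w) (hm : m ≤ m') :
    wordDegree m' w = wordDegree m w := by
  unfold wordDegree
  rw [← Finset.sum_range_add_sum_Ico _ hm]
  simp only [add_eq_left]
  refine Finset.sum_eq_zero fun i hi => ?_
  rw [h i (Finset.mem_Ico.1 hi).1]; ring

lemma IsWord.update {m : ℕ} {w : ℕ → ℤ} (h : IsWord m w) {i : ℕ} (hi : i < m) (v : ℤ) :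
    IsWord m (Function.update w i v) := by
  intro i' hi'
  rw [Function.update_of_ne (by omega)]
  exact h i' hi'

lemma wordDegree_update {m : ℕ} (w : ℕ → ℤ) {i : ℕ} (hi : i < m) (r : ℤ) :
    wordDegree m (Function.update w i (w i + r)) = wordDegree m w + r := by
  unfold wordDegree
  have hi' : i ∈ Finset.range m := Finset.mem_range.2 hi
  rw [← Finset.add_sum_erase _ _ hi', ← Finset.add_sum_erase _ (fun i => w i + 1 + (i : ℤ)) hi',
    Function.update_self, Finset.sum_congr rfl fun j hj => by
      rw [Function.update_of_ne (Finset.ne_of_mem_erase hj)]]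
  ring

lemma alternant_eq_zero_of_eq {N : ℕ} {w : ℕ → ℤ} {i j : ℕ} (hi : i < N) (hj : j < N)
    (hij : i ≠ j) (h : w i = w j) : alternant P N w = 0 := by
  refine Matrix.det_zero_of_row_eq (i := ⟨i, hi⟩) (j := ⟨j, hj⟩) (by simpa using hij) ?_
  ext k : 1
  simp [alternantMatrix, h]

lemma alternant_eq_zero_of_row {N : ℕ} {w : ℕ → ℤ} {i : ℕ} (hi : i < N) (h : P N (w i) = 0) :
    alternant P N w = 0 := by
  refine Matrix.det_eq_zero_of_row_eq_zero ⟨i, hi⟩ fun j => ?_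
  simp [alternantMatrix, h]

/-- Every word either has vanishing alternants, or it is a rearrangement of the word of a
partition, with the same alternants up to a constant sign. -/
lemma exists_sorted {m : ℕ} {w : ℕ → ℤ} (hw : IsWord m w) (P : ℕ → ℤ → Polynomial ℝ) :
    (∀ᶠ N in atTop, alternant P N w = 0) ∨
    ∃ (ν : YoungDiagram) (ε : ℝ), (ν.card : ℤ) = wordDegree m w ∧
      ∀ᶠ N in atTop, alternant P N w = MvPolynomial.C ε * alternant P N (wordOf ν) := by
  by_cases hinj : Function.Injective w
  swap
  · left
    simp only [Function.Injective, not_forall] at hinj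
    obtain ⟨i, j, h, hij⟩ := hinj
    filter_upwards [eventually_gt_atTop (max i j)] with N hN
    exact alternant_eq_zero_of_eq ((le_max_left _ _).trans_lt hN) ((le_max_right _ _).trans_lt hN)
      hij h
  right
  -- An injective word cannot repeat an entry of its tail `-1 - i`, which bounds the others below.
  have hlow : ∀ i < m, -(m : ℤ) ≤ w i := by
    intro i hi
    by_contra! hcon
    have h1 := hw (-1 - w i).toNat (by omega)
    rw [show -1 - (((-1 - w i).toNat : ℕ) : ℤ) = w i by omega] at h1
    have := hinj h1
    omega
  set σ : Equiv.Perm (Fin m) := Tuple.sort fun i : Fin m => -(w i) with hσ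
  have hmono : Monotone ((fun i : Fin m => -(w i)) ∘ σ) := Tuple.monotone_sort _
  set w' : ℕ → ℤ := fun i => if h : i < m then w (σ ⟨i, h⟩) else -1 - (i : ℤ) with hw'
  have hw'1 : ∀ i (h : i < m), w' i = w (σ ⟨i, h⟩) := fun i h => by simp [hw', h]
  have hw'2 : ∀ i, m ≤ i → w' i = -1 - (i : ℤ) := fun i h => by
    simp only [hw']; rw [dif_neg (by omega)]
  have hanti : StrictAnti w' := by
    refine strictAnti_nat_of_succ_lt fun i => ?_
    rcases lt_trichotomy (i + 1) m with h | h | h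
    · rw [hw'1 _ h, hw'1 i (by omega)]
      have h1 : -(w (σ ⟨i, by omega⟩)) ≤ -(w (σ ⟨i + 1, h⟩)) :=
        hmono (show (⟨i, by omega⟩ : Fin m) ≤ ⟨i + 1, h⟩ by simp)
      have h2 : w (σ ⟨i, by omega⟩) ≠ w (σ ⟨i + 1, h⟩) := by
        intro h3
        have := σ.injective (Fin.ext (hinj h3))
        simp at this
      omega
    · rw [hw'2 _ h.ge, hw'1 i (by omega)]
      have := hlow (σ ⟨i, by omega⟩) (σ ⟨i, by omega⟩).2
      push_cast
      omega
    · rw [hw'2 _ h.le, hw'2 i (by omega)]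
      push_cast; omega
  -- `w' i + 1 + i` is weakly decreasing and vanishes eventually
  have hstep : ∀ i, w' (i + 1) + 1 + ((i + 1 : ℕ) : ℤ) ≤ w' i + 1 + i := by
    intro i
    have := hanti (Nat.lt_succ_self i)
    push_cast
    simp only [Nat.succ_eq_add_one] at this
    omega
  have hantit : Antitone fun i : ℕ => w' i + 1 + i := antitone_nat_of_succ_le hstep
  have hnonneg : ∀ i : ℕ, 0 ≤ w' i + 1 + i := by
    intro i
    have h1 : w' (max i m) + 1 + ((max i m : ℕ) : ℤ) ≤ w' i + 1 + i := hantit (le_max_left i m)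
    rw [hw'2 _ (le_max_right i m)] at h1
    omega
  obtain ⟨ν, hν⟩ := exists_youngDiagram (l := fun i => (w' i + 1 + i).toNat)
    (fun i j hij => Int.toNat_le_toNat (hantit hij)) (m := m) (fun i hi => by
      simp only [hw'2 i hi]; omega)
  have hword : wordOf ν = w' := by
    ext i
    rw [wordOf, hν i]
    have := hnonneg i
    omega
  have hcol : ν.colLen 0 ≤ m := by
    by_contra! hcon
    have h1 := YoungDiagram.mem_iff_lt_rowLen.1 (YoungDiagram.mem_iff_lt_colLen.2 hcon)
    rw [hν m, hw'2 m le_rfl] at h1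
    omega
  refine ⟨ν, (Equiv.Perm.sign σ : ℤˣ), ?_, ?_⟩
  · rw [← wordDegree_wordOf hcol, hword]
    unfold wordDegree
    rw [Finset.sum_add_distrib, Finset.sum_add_distrib, Finset.sum_add_distrib,
      Finset.sum_add_distrib]
    congr 2
    rw [← Fin.sum_univ_eq_sum_range, ← Fin.sum_univ_eq_sum_range, ← Equiv.sum_comp σ fun i => w i]
    exact Finset.sum_congr rfl fun i _ => hw'1 i i.2
  · filter_upwards [eventually_ge_atTop m] with N hN
    set τ : Equiv.Perm (Fin N) := σ.viaFintypeEmbedding (Fin.castLEEmb hN) with hτ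
    have hsign : Equiv.Perm.sign τ = Equiv.Perm.sign σ := Equiv.Perm.viaFintypeEmbedding_sign σ _
    have hτw : ∀ i : Fin N, w' i = w (τ i) := by
      intro i
      by_cases hi : (i : ℕ) < m
      · have h1 : i = Fin.castLEEmb hN ⟨i, hi⟩ := by ext; simp
        rw [hw'1 i hi]
        conv_rhs => rw [h1, hτ, Equiv.Perm.viaFintypeEmbedding_apply_image]
        simp
      · have h1 : i ∉ Set.range (Fin.castLEEmb hN) := by
          rintro ⟨k, hk⟩
          have := congrArg Fin.val hk
          simp at this
          omega
        rw [hτ, Equiv.Perm.viaFintypeEmbedding_apply_notMem_range σ _ h1, hw'2 i (by omega),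
          hw i (by omega)]
    have hmat : alternantMatrix P N (wordOf ν) = (alternantMatrix P N w).submatrix τ id := by
      ext i j : 2
      simp [alternantMatrix, hword, hτw]
    unfold alternant
    rw [hmat, Matrix.det_permute, hsign, ← mul_assoc]
    rcases Int.units_eq_one_or (Equiv.Perm.sign σ) with h | h <;> simp [h]

end Alternants

/-! ### Stabilisation of products with symmetric functions -/

section Stabilisation

/-- Sequences of antisymmetric polynomials that eventually are finite combinations of the alternants
of partitions `ν` with `|ν| ≤ d`, with convergent coefficients that are eventually constant for
`|ν| = d`. -/
inductive Stabilises (P : ℕ → ℤ → Polynomial ℝ) (d : ℤ) :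
    ((N : ℕ) → MvPolynomial (Fin N) ℝ) → Prop
  | zero : Stabilises P d fun _ => 0
  | add {f g : (N : ℕ) → MvPolynomial (Fin N) ℝ} :
      Stabilises P d f → Stabilises P d g → Stabilises P d fun N => f N + g N
  | single (c : ℕ → ℝ) (l : ℝ) (ν : YoungDiagram) (hdeg : (ν.card : ℤ) ≤ d)
      (hc : Tendsto c atTop (𝓝 l)) (htop : (ν.card : ℤ) = d → ∀ᶠ N in atTop, c N = l) :
      Stabilises P d fun N => MvPolynomial.C (c N) * alternant P N (wordOf ν)
  | congr {f g : (N : ℕ) → MvPolynomial (Fin N) ℝ} :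
      (∀ᶠ N in atTop, f N = g N) → Stabilises P d f → Stabilises P d g

namespace Stabilises

variable {P : ℕ → ℤ → Polynomial ℝ} {f g : (N : ℕ) → MvPolynomial (Fin N) ℝ} {d d' : ℤ}

lemma mono (h : Stabilises P d f) (hd : d ≤ d') : Stabilises P d' f := by
  induction h with
  | zero => exact zero
  | add _ _ h1 h2 => exact add h1 h2
  | single c l ν hdeg hc htop =>
    exact single c l ν (hdeg.trans hd) hc fun h => htop (by omega)
  | congr he _ h1 => exact congr he h1

lemma smul (h : Stabilises P d f) {c : ℕ → ℝ} {l : ℝ} (hc : ∀ᶠ N in atTop, c N = l) :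
    Stabilises P d fun N => MvPolynomial.C (c N) * f N := by
  induction h with
  | zero => exact congr (Eventually.of_forall fun N => by rw [mul_zero]) (zero)
  | add _ _ h1 h2 => exact congr (Eventually.of_forall fun N => by rw [mul_add]) (add h1 h2)
  | single c' l' ν hdeg hc' htop =>
    refine congr (Eventually.of_forall fun N => ?_)
      (single (fun N => c N * c' N) (l * l') ν hdeg
        ((tendsto_const_nhds.congr' (hc.mono fun _ h => h.symm)).mul hc') fun h => ?_)
    · rw [map_mul, mul_assoc]
    · filter_upwards [hc, htop h] with N h1 h2
      rw [h1, h2]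
  | congr he _ h1 => exact congr (he.mono fun N hN => by rw [hN]) h1

lemma smul_of_lt (h : Stabilises P d f) (hd : d < d') {c : ℕ → ℝ} {l : ℝ}
    (hc : Tendsto c atTop (𝓝 l)) : Stabilises P d' fun N => MvPolynomial.C (c N) * f N := by
  induction h with
  | zero => exact congr (Eventually.of_forall fun N => by rw [mul_zero]) (zero)
  | add _ _ h1 h2 =>
    exact congr (Eventually.of_forall fun N => by rw [mul_add]) (add h1 h2)
  | single c' l' ν hdeg hc' htop =>
    refine congr (Eventually.of_forall fun N => ?_)
      (single (fun N => c N * c' N) (l * l') ν (hdeg.trans hd.le) (hc.mul hc') fun h => ?_)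
    · rw [map_mul, mul_assoc]
    · omega
  | congr he _ h1 => exact congr (he.mono fun N hN => by rw [hN]) h1

lemma sum {ι : Type*} (s : Finset ι) {F : ι → (N : ℕ) → MvPolynomial (Fin N) ℝ}
    (h : ∀ i ∈ s, Stabilises P d (F i)) : Stabilises P d fun N => ∑ i ∈ s, F i N := by
  classical
  induction s using Finset.induction_on with
  | empty => simpa using zero
  | insert i s hi ih =>
    refine congr (Eventually.of_forall fun N => (Finset.sum_insert hi).symm)
      (add (h i (Finset.mem_insert_self i s)) (ih fun j hj => h j (Finset.mem_insert_of_mem hj)))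

lemma of_word {m : ℕ} {w : ℕ → ℤ} (hw : IsWord m w) :
    Stabilises P (wordDegree m w) fun N => alternant P N w := by
  rcases exists_sorted hw P with h | ⟨ν, ε, h1, h2⟩
  · exact congr (h.mono fun _ h => h.symm) (zero)
  · exact congr (h2.mono fun _ h => h.symm)
      (single (fun _ => ε) ε ν h1.le tendsto_const_nhds fun _ => Eventually.of_forall fun _ => rfl)

end Stabilises

/-- Multiplying the rows of a matrix one at a time by `y`, and adding up the determinants. -/
lemma sum_det_updateRow_mul {R : Type*} [CommRing R] {n : Type*} [Fintype n] [DecidableEq n]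
    (M : Matrix n n R) (y : n → R) :
    ∑ i, (M.updateRow i fun j => y j * M i j).det = (∑ j, y j) * M.det := by
  simp only [Matrix.det_apply']
  rw [Finset.sum_comm, Finset.mul_sum]
  refine Finset.sum_congr rfl fun σ _ => ?_
  have h1 : ∀ i, ∏ j, M.updateRow i (fun j => y j * M i j) (σ j) j =
      y (σ.symm i) * ∏ j, M (σ j) j := by
    intro i
    have h2 : ∀ j, M.updateRow i (fun j => y j * M i j) (σ j) j =
        (if j = σ.symm i then y j else 1) * M (σ j) j := by
      intro j
      by_cases hj : j = σ.symm i
      · subst hj; simp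
      · have : σ j ≠ i := fun h => hj (by rw [← h, Equiv.symm_apply_apply])
        rw [Matrix.updateRow_ne this, if_neg hj, one_mul]
    rw [Finset.prod_congr rfl fun j _ => h2 j, Finset.prod_mul_distrib, Finset.prod_ite_eq']
    simp
  simp only [h1]
  rw [← Finset.mul_sum, ← Finset.sum_mul, Equiv.sum_comp σ.symm y]
  ring

namespace IsStableFamily

variable {q : ℝ} {P : ℕ → ℤ → Polynomial ℝ} {a b : ℕ → ℤ → ℝ} {a' b' : ℤ → ℝ}

/-- Multiplication of an alternant by a power sum. -/
lemma psum_mul_alternant_eq (h : IsStableFamily q P a b a' b') {N : ℕ} (k : ℕ) {w : ℕ → ℤ}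
    (hw : ∀ i < N, 0 ≤ (N : ℤ) + w i) :
    MvPolynomial.psum (Fin N) ℝ k * alternant P N w =
      ∑ i ∈ Finset.range N, ∑ r ∈ Finset.Icc (-(k : ℤ)) k,
        MvPolynomial.C (powCoeff (a N) (b N) k (w i) r) *
          alternant P N (Function.update w i (w i + r)) := by
  rw [MvPolynomial.psum, alternant, ← sum_det_updateRow_mul,
    ← Fin.sum_univ_eq_sum_range (fun i => ∑ r ∈ Finset.Icc (-(k : ℤ)) k,
        MvPolynomial.C (powCoeff (a N) (b N) k (w i) r) *
          alternant P N (Function.update w i (w i + r)))]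
  refine Finset.sum_congr rfl fun i _ => ?_
  have hrow : (fun j => MvPolynomial.X j ^ k * alternantMatrix P N w i j) =
      ∑ r ∈ Finset.Icc (-(k : ℤ)) k, (MvPolynomial.C (powCoeff (a N) (b N) k (w i) r) :
        MvPolynomial (Fin N) ℝ) • fun j => Polynomial.aeval
          (MvPolynomial.X j : MvPolynomial (Fin N) ℝ) (P N (w i + r)) := by
    ext j : 1
    have h1 := congrArg (Polynomial.aeval (MvPolynomial.X j : MvPolynomial (Fin N) ℝ))
      (h.X_pow_mul N k (hw i i.2))
    simp only [map_mul, map_pow, Polynomial.aeval_X, map_sum, Polynomial.aeval_C] at h1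
    rw [Finset.sum_apply]
    simpa [alternantMatrix] using h1
  rw [hrow]
  have h2 := map_sum ((Matrix.detRowAlternating (R := MvPolynomial (Fin N) ℝ)
    (n := Fin N)).toMultilinearMap.toLinearMap (alternantMatrix P N w) i)
    (fun r => (MvPolynomial.C (powCoeff (a N) (b N) k (w i) r) :
        MvPolynomial (Fin N) ℝ) • fun j => Polynomial.aeval
          (MvPolynomial.X j : MvPolynomial (Fin N) ℝ) (P N (w i + r))) (Finset.Icc (-(k : ℤ)) k)
  refine h2.trans (Finset.sum_congr rfl fun r _ => ?_)
  rw [map_smul, smul_eq_mul]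
  congr 1
  change Matrix.det (Matrix.updateRow (alternantMatrix P N w) i _) = _
  unfold alternant
  congr 1
  refine Matrix.ext fun i' j => ?_
  by_cases hi : i' = i
  · subst hi; simp [alternantMatrix]
  · have : (i' : ℕ) ≠ i := fun h => hi (Fin.ext h)
    simp [alternantMatrix, Matrix.updateRow_ne hi, Function.update_of_ne this]

/-- Only the rows near the top of the word, and the diagonal entries of the deep rows, contribute to
the product with a power sum. -/
lemma psum_mul_alternant (h : IsStableFamily q P a b a' b') {k m : ℕ} {w : ℕ → ℤ}
    (hw : IsWord m w) :
    ∀ᶠ N in atTop, MvPolynomial.psum (Fin N) ℝ k * alternant P N w =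
      (∑ i ∈ Finset.range (m + k), ∑ r ∈ Finset.Icc (-(k : ℤ)) k,
        MvPolynomial.C (powCoeff (a N) (b N) k (w i) r) *
          alternant P N (Function.update w i (w i + r))) +
      MvPolynomial.C (∑ i ∈ Finset.Ico (m + k) N, powCoeff (a N) (b N) k (-1 - (i : ℤ)) 0) *
        alternant P N w := by
  have hlow : ∀ᶠ N : ℕ in atTop, ∀ i ∈ Finset.range m, 0 ≤ (N : ℤ) + w i :=
    (Finset.eventually_all _).2 fun i _ => eventually_nonneg_add (w i)
  filter_upwards [hlow, eventually_ge_atTop (m + k)] with N hN hmN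
  have hN' : ∀ i < N, 0 ≤ (N : ℤ) + w i := by
    intro i hi
    rcases lt_or_ge i m with hm | hm
    · exact hN i (Finset.mem_range.2 hm)
    · rw [hw i hm]; omega
  rw [h.psum_mul_alternant_eq k hN', ← Finset.sum_range_add_sum_Ico _ hmN, map_sum,
    Finset.sum_mul]
  congr 1
  refine Finset.sum_congr rfl fun i hi => ?_
  obtain ⟨hi1, hi2⟩ := Finset.mem_Ico.1 hi
  rw [Finset.sum_eq_single 0]
  · rw [add_zero, Function.update_eq_self, hw i (by omega)]
  · intro r hr hr0
    rw [Finset.mem_Icc] at hr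
    rw [hw i (by omega)]
    rcases lt_or_ge ((i : ℤ) - r) N with hlt | hge
    · rw [alternant_eq_zero_of_eq (i := i) (j := ((i : ℤ) - r).toNat) hi2 (by omega) (by omega),
        mul_zero]
      rw [Function.update_self, Function.update_of_ne (by omega), hw _ (by omega)]
      omega
    · rw [alternant_eq_zero_of_row hi2, mul_zero]
      rw [Function.update_self]
      exact h.zero_of_neg N _ (by omega)
  · intro h0
    exact absurd (Finset.mem_Icc.2 (by omega)) h0

lemma stabilises_psum_mul_word (h : IsStableFamily q P a b a' b') {k m : ℕ} (hk : 1 ≤ k)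
    {w : ℕ → ℤ} (hw : IsWord m w) : Stabilises P (wordDegree m w + k) fun N =>
      MvPolynomial.psum (Fin N) ℝ k * alternant P N w := by
  refine Stabilises.congr ((h.psum_mul_alternant (k := k) hw).mono fun _ h => h.symm)
    (Stabilises.add (Stabilises.sum _ fun i hi => Stabilises.sum _ fun r hr => ?_) ?_)
  · have hi := Finset.mem_range.1 hi
    have hr := Finset.mem_Icc.1 hr
    have hw' := hw.mono (show m ≤ m + k by omega)
    have h1 := Stabilises.of_word (P := P) (hw'.update hi (w i + r))
    rw [wordDegree_update w hi, wordDegree_mono hw (by omega)] at h1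
    rcases hr.2.lt_or_eq with hlt | rfl
    · exact h1.smul_of_lt (by omega) (h.tendsto_powCoeff k (w i) r)
    · exact h1.smul (l := 1) (Eventually.of_forall fun N => powCoeff_top _ _ _ _)
  · obtain ⟨l, hl⟩ := h.tendsto_sum_powCoeff_diag hk (show k ≤ m + k by omega)
    exact (Stabilises.of_word hw).smul_of_lt (by omega) hl

lemma stabilises_psum_mul (h : IsStableFamily q P a b a' b') {k : ℕ} (hk : 1 ≤ k) {d : ℤ}
    {f : (N : ℕ) → MvPolynomial (Fin N) ℝ} (hf : Stabilises P d f) :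
    Stabilises P (d + k) fun N => MvPolynomial.psum (Fin N) ℝ k * f N := by
  induction hf with
  | zero => exact Stabilises.congr (Eventually.of_forall fun N => by rw [mul_zero]) Stabilises.zero
  | add _ _ h1 h2 =>
    exact Stabilises.congr (Eventually.of_forall fun N => by rw [mul_add]) (h1.add h2)
  | congr he _ h1 => exact Stabilises.congr (he.mono fun N hN => by rw [hN]) h1
  | single c l ν hdeg hc htop =>
    have h1 := h.stabilises_psum_mul_word hk (isWord_wordOf (le_refl (ν.colLen 0)))
    rw [wordDegree_wordOf le_rfl] at h1
    have e : ∀ N, MvPolynomial.C (c N) * (MvPolynomial.psum (Fin N) ℝ k * alternant P N (wordOf ν)) =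
      MvPolynomial.psum (Fin N) ℝ k * (MvPolynomial.C (c N) * alternant P N (wordOf ν)) :=
      fun N => mul_left_comm _ _ _
    refine Stabilises.congr (Eventually.of_forall e) ?_
    rcases hdeg.lt_or_eq with hlt | heq
    · exact h1.smul_of_lt (by omega) hc
    · exact (h1.smul (htop heq)).mono (by omega)

lemma stabilises_monomial_mul (h : IsStableFamily q P a b a' b') (m : ℕ →₀ ℕ) :
    ∀ {d : ℤ} {f : (N : ℕ) → MvPolynomial (Fin N) ℝ}, Stabilises P d f →
    Stabilises P (d + Finsupp.weight (fun k : ℕ => k + 1) m) fun N =>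
      Sym.proj N (MvPolynomial.monomial m 1) * f N := by
  induction m using Finsupp.induction_linear with
  | zero =>
    intro d f hf
    simp only [MvPolynomial.monomial_zero', map_one, one_mul, map_zero, Nat.cast_zero, add_zero]
    exact hf
  | add m m' h1 h2 =>
    intro d f hf
    have := h1 (h2 hf)
    rw [map_add, Nat.cast_add, add_comm (Nat.cast _), ← add_assoc]
    refine Stabilises.congr (Eventually.of_forall fun N => ?_) this
    rw [← mul_assoc, ← map_mul, MvPolynomial.monomial_mul, one_mul]
  | single i n =>
    intro d f hf
    induction n with
    | zero =>
      simp only [Finsupp.single_zero, MvPolynomial.monomial_zero', map_one, one_mul, map_zero,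
        Nat.cast_zero, add_zero]
      exact hf
    | succ n ih =>
      have := h.stabilises_psum_mul (k := i + 1) (by omega) ih
      rw [Finsupp.weight_single] at this ⊢
      refine Stabilises.congr (Eventually.of_forall fun N => ?_) (this.mono (le_of_eq ?_))
      · rw [← mul_assoc]
        congr 1
        rw [Sym.proj, MvPolynomial.aeval_monomial, MvPolynomial.aeval_monomial,
          Finsupp.prod_single_index (by simp), Finsupp.prod_single_index (by simp)]
        simp [pow_succ']
      · push_cast [smul_eq_mul]; ring

lemma stabilises_proj (h : IsStableFamily q P a b a' b') {F : Sym} {d : ℕ} (hF : F.degree ≤ d) :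
    Stabilises P d fun N => Sym.proj N F * alternant P N (wordOf ⊥) := by
  have h0 : Stabilises P 0 fun N => alternant P N (wordOf ⊥) := by
    refine Stabilises.congr (Eventually.of_forall fun N => ?_)
      (Stabilises.single (fun _ => 1) 1 ⊥ (by simp [YoungDiagram.card]) tendsto_const_nhds
        fun _ => Eventually.of_forall fun _ => rfl)
    simp
  have h1 : ∀ m ∈ F.support, Stabilises P d fun N =>
      MvPolynomial.C (F.coeff m) *
        (Sym.proj N (MvPolynomial.monomial m 1) * alternant P N (wordOf ⊥)) := by
    intro m hm
    refine Stabilises.smul (l := F.coeff m) ?_ (Eventually.of_forall fun _ => rfl)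
    refine (h.stabilises_monomial_mul m h0).mono ?_
    rw [zero_add]
    exact_mod_cast (MvPolynomial.le_weightedTotalDegree _ hm).trans hF
  refine Stabilises.congr (Eventually.of_forall fun N => ?_) (Stabilises.sum _ h1)
  conv_rhs => rw [F.as_sum]
  rw [map_sum, Finset.sum_mul]
  refine Finset.sum_congr rfl fun m _ => ?_
  rw [← mul_assoc]
  congr 1
  rw [show MvPolynomial.monomial m (F.coeff m) = F.coeff m • MvPolynomial.monomial m (1 : ℝ) by
    rw [MvPolynomial.smul_monomial, smul_eq_mul, mul_one], map_smul, MvPolynomial.smul_eq_C_mul]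

end IsStableFamily

end Stabilisation

/-! ### Symmetric and alternating polynomials -/

section SymmetricPolynomials

open MvPolynomial

variable {N : ℕ}

lemma vandermondeProd_ne_zero (N : ℕ) : vandermondeProd N ≠ 0 := by
  unfold vandermondeProd
  refine Finset.prod_ne_zero_iff.2 fun i _ => Finset.prod_ne_zero_iff.2 fun j hj => ?_
  rw [sub_ne_zero]
  exact fun h => (Finset.mem_Ioi.1 hj).ne (X_injective h)

lemma isHomogeneous_vandermondeProd (N : ℕ) :
    (vandermondeProd N).IsHomogeneous (∑ i : Fin N, (N - 1 - (i : ℕ))) := by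
  unfold vandermondeProd
  refine IsHomogeneous.prod _ _ _ fun i _ => ?_
  have h := IsHomogeneous.prod (Finset.Ioi i)
    (fun j => (X i - X j : MvPolynomial (Fin N) ℝ)) (fun _ => 1)
    fun j _ => (isHomogeneous_X ℝ i).sub (isHomogeneous_X ℝ j)
  simpa using h

/-- The substitution `x_i := x_j`. -/
def identify (i j : Fin N) : MvPolynomial (Fin N) ℝ →ₐ[ℝ] MvPolynomial (Fin N) ℝ :=
  aeval (Function.update X i (X j))

lemma sub_dvd_sub_identify (i j : Fin N) (f : MvPolynomial (Fin N) ℝ) :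
    X i - X j ∣ f - identify i j f := by
  induction f using MvPolynomial.induction_on with
  | C a => simp [identify]
  | add f g hf hg =>
    rw [map_add, add_sub_add_comm]
    exact dvd_add hf hg
  | mul_X f k hf =>
    have h1 : X i - X j ∣ (X k - identify i j (X k) : MvPolynomial (Fin N) ℝ) := by
      by_cases hk : k = i
      · subst hk; simp [identify]
      · simp [identify, Function.update_of_ne hk]
    have h2 : f * X k - identify i j (f * X k) =
        (f - identify i j f) * X k + identify i j f * (X k - identify i j (X k)) := by
      rw [map_mul]; ring
    rw [h2]
    exact dvd_add (hf.mul_right _) (h1.mul_left _)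

lemma sub_dvd_of_identify {i j : Fin N} {f : MvPolynomial (Fin N) ℝ} (h : identify i j f = 0) :
    X i - X j ∣ f := by
  simpa [h] using sub_dvd_sub_identify i j f

lemma identify_sub_ne_zero {i j a b : Fin N} (hij : i < j) (hab : a < b) (hne : (a, b) ≠ (i, j)) :
    identify i j (X a - X b) ≠ 0 := by
  rw [map_sub, sub_ne_zero]
  simp only [identify, aeval_X, Function.update_apply]
  split_ifs with h1 h2 h2
  · omega
  · exact fun h => hne (by rw [h1, X_injective h])
  · exact fun h => by have := X_injective h; omega
  · exact fun h => hab.ne (X_injective h)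

lemma prod_sub_dvd (s : Finset (Fin N × Fin N)) {f : MvPolynomial (Fin N) ℝ}
    (hs : ∀ p ∈ s, p.1 < p.2) (h : ∀ p ∈ s, identify p.1 p.2 f = 0) :
    ∏ p ∈ s, (X p.1 - X p.2) ∣ f := by
  classical
  induction s using Finset.induction_on with
  | empty => simp
  | insert p s hp ih =>
    obtain ⟨g, rfl⟩ := ih (fun p hp => hs p (Finset.mem_insert_of_mem hp))
      fun p hp => h p (Finset.mem_insert_of_mem hp)
    rw [Finset.prod_insert hp, mul_comm]
    refine mul_dvd_mul_left _ (sub_dvd_of_identify ?_)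
    have h1 := h p (Finset.mem_insert_self p s)
    rw [map_mul, map_prod] at h1
    refine (mul_eq_zero.1 h1).resolve_left (Finset.prod_ne_zero_iff.2 fun r hr => ?_)
    refine identify_sub_ne_zero (hs p (Finset.mem_insert_self p s))
      (hs r (Finset.mem_insert_of_mem hr)) ?_
    intro h2
    rw [show r = p from h2] at hr
    exact hp hr

lemma vandermondeProd_dvd {f : MvPolynomial (Fin N) ℝ}
    (h : ∀ i j : Fin N, i < j → identify i j f = 0) : vandermondeProd N ∣ f := by
  have h1 : vandermondeProd N = ∏ p : (Fin N × Fin N) with p.1 < p.2, (X p.1 - X p.2) := by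
    unfold vandermondeProd
    rw [Finset.prod_filter, Fintype.prod_prod_type]
    refine Finset.prod_congr rfl fun i _ => ?_
    rw [← Finset.prod_filter]
    refine Finset.prod_congr ?_ fun _ _ => rfl
    ext j; simp
  rw [h1]
  refine prod_sub_dvd _ (fun p hp => ?_) fun p hp => h _ _ ?_ <;> simpa using hp

lemma identify_det (f : Fin N → Polynomial ℝ) {i j : Fin N} (hij : i ≠ j) :
    identify i j (Matrix.of fun a b : Fin N =>
      Polynomial.aeval (X b : MvPolynomial (Fin N) ℝ) (f a)).det = 0 := by
  rw [AlgHom.map_det]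
  refine Matrix.det_zero_of_column_eq hij fun k => ?_
  simp [identify, ← Polynomial.aeval_algHom_apply, Function.update_of_ne hij.symm]

lemma rename_det (f : Fin N → Polynomial ℝ) (σ : Equiv.Perm (Fin N)) :
    rename σ (Matrix.of fun a b : Fin N =>
      Polynomial.aeval (X b : MvPolynomial (Fin N) ℝ) (f a)).det =
    (Equiv.Perm.sign σ : MvPolynomial (Fin N) ℝ) * (Matrix.of fun a b : Fin N =>
      Polynomial.aeval (X b : MvPolynomial (Fin N) ℝ) (f a)).det := by
  rw [← Matrix.det_permute', AlgHom.map_det]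
  congr 1
  ext a b : 2
  simp [← Polynomial.aeval_algHom_apply]

lemma totalDegree_aeval_X_le (f : Polynomial ℝ) (j : Fin N) :
    (Polynomial.aeval (X j : MvPolynomial (Fin N) ℝ) f).totalDegree ≤ f.natDegree := by
  rw [Polynomial.aeval_eq_sum_range]
  refine totalDegree_finsetSum_le fun i hi => ?_
  refine (totalDegree_smul_le _ _).trans ?_
  rw [totalDegree_X_pow]
  exact Nat.lt_succ_iff.1 (Finset.mem_range.1 hi)

lemma totalDegree_det_le (f : Fin N → Polynomial ℝ) :
    (Matrix.of fun a b : Fin N =>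
      Polynomial.aeval (X b : MvPolynomial (Fin N) ℝ) (f a)).det.totalDegree ≤
      ∑ a, (f a).natDegree := by
  rw [Matrix.det_apply]
  refine totalDegree_finsetSum_le fun σ _ => ?_
  refine (totalDegree_smul_le _ _).trans ((totalDegree_finsetProd _ _).trans ?_)
  rw [← Equiv.sum_comp σ fun a => (f a).natDegree]
  exact Finset.sum_le_sum fun i _ => totalDegree_aeval_X_le _ _

/-- Every symmetric polynomial is a polynomial in the power sums. -/
lemma exists_proj_eq {F : MvPolynomial (Fin N) ℝ} (hF : F.IsSymmetric) :
    ∃ L : Sym, Sym.proj N L = F := by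
  have hp : ∀ k, 1 ≤ k → psum (Fin N) ℝ k ∈ (Sym.proj N).range := by
    intro k hk
    refine ⟨X (k - 1), ?_⟩
    simp [Sym.proj, Nat.sub_add_cancel hk]
  have he : ∀ k, esymm (Fin N) ℝ k ∈ (Sym.proj N).range := by
    intro k
    induction k using Nat.strong_induction_on with
    | _ k ih =>
    rcases Nat.eq_zero_or_pos k with rfl | hk
    · rw [esymm_zero]; exact one_mem _
    have h1 := mul_esymm_eq_sum (Fin N) ℝ k
    have h2 : ((k : ℝ)⁻¹) • ((k : MvPolynomial (Fin N) ℝ) * esymm (Fin N) ℝ k) =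
        esymm (Fin N) ℝ k := by
      rw [show (k : MvPolynomial (Fin N) ℝ) = C (k : ℝ) by simp, ← smul_eq_C_mul, smul_smul,
        inv_mul_cancel₀ (by positivity), one_smul]
    rw [← h2, h1]
    refine Subalgebra.smul_mem _ (mul_mem (pow_mem (neg_mem (one_mem _)) _)
      (sum_mem fun a ha => ?_)) _
    rw [Finset.mem_filter, Finset.HasAntidiagonal.mem_antidiagonal] at ha
    refine mul_mem (mul_mem (pow_mem (neg_mem (one_mem _)) _) (ih _ ?_)) (hp _ ?_)
    · exact ha.2
    · have := ha.2; omega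
  obtain ⟨Q, hQ⟩ := esymmAlgHom_surjective (σ := Fin N) (R := ℝ) (n := N) (by simp) ⟨F, hF⟩
  have h3 := congrArg Subtype.val hQ
  rw [esymmAlgHom_apply] at h3
  change aeval _ Q = F at h3
  have h4 : F ∈ (Sym.proj N).range := by
    rw [← h3, aeval_def, eval₂_eq]
    exact sum_mem fun m _ => mul_mem (algebraMap_mem (Sym.proj N).range _)
      (prod_mem fun i _ => pow_mem (he _) _)
  exact h4

lemma isHomogeneous_proj_monomial (m : ℕ →₀ ℕ) (c : ℝ) :
    (Sym.proj N (monomial m c)).IsHomogeneous (Finsupp.weight (fun k : ℕ => k + 1) m) := by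
  have h1 : Sym.proj N (monomial m c) = C c * m.prod fun i k => psum (Fin N) ℝ (i + 1) ^ k := by
    rw [Sym.proj, aeval_monomial]; rfl
  rw [h1]
  refine IsHomogeneous.C_mul ?_ _
  rw [Finsupp.weight_apply, Finsupp.prod, Finsupp.sum]
  refine IsHomogeneous.prod _ _ _ fun i _ => ?_
  rw [smul_eq_mul, mul_comm]
  refine IsHomogeneous.pow ?_ _
  exact IsHomogeneous.sum _ _ _ fun j _ => isHomogeneous_X_pow j _

lemma degree_le_iff {F : Sym} {d : ℕ} : F.degree ≤ d ↔
    ∀ m ∈ F.support, Finsupp.weight (fun k : ℕ => k + 1) m ≤ d := by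
  rw [Sym.degree, weightedTotalDegree, Finset.sup_le_iff]

/-- A symmetric polynomial of degree at most `d` is the projection of a symmetric function of
degree at most `d`. -/
lemma exists_degree_le_proj_eq {F : MvPolynomial (Fin N) ℝ} (hF : F.IsSymmetric) {d : ℕ}
    (hd : F.totalDegree ≤ d) : ∃ L : Sym, L.degree ≤ d ∧ Sym.proj N L = F := by
  classical
  obtain ⟨L, rfl⟩ := exists_proj_eq hF
  let s := L.support.filter fun m => Finsupp.weight (fun k : ℕ => k + 1) m ≤ d
  refine ⟨∑ m ∈ s, monomial m (L.coeff m), ?_, ?_⟩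
  · rw [degree_le_iff]
    intro m hm
    obtain ⟨n, hn, hn'⟩ := Finset.mem_biUnion.1 (support_sum hm)
    have := Finset.mem_singleton.1 (support_monomial_subset hn')
    subst this
    exact (Finset.mem_filter.1 hn).2
  · have h1 : ∑ n ∈ Finset.range (d + 1), homogeneousComponent n (Sym.proj N L) =
        Sym.proj N L := by
      conv_rhs => rw [← sum_homogeneousComponent (Sym.proj N L)]
      refine (Finset.sum_subset (Finset.range_mono (by omega)) fun n _ hn => ?_).symm
      exact homogeneousComponent_eq_zero _ _ (by simpa using hn)
    rw [← h1]
    conv_rhs => rw [L.as_sum]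
    simp only [map_sum]
    rw [Finset.sum_comm, Finset.sum_filter]
    refine Finset.sum_congr rfl fun m _ => ?_
    rw [Finset.sum_congr rfl fun n _ =>
      homogeneousComponent_of_mem (isHomogeneous_proj_monomial (N := N) m (L.coeff m))]
    simp

end SymmetricPolynomials

namespace IsStableFamily

variable {q : ℝ} {P : ℕ → ℤ → Polynomial ℝ} {a b : ℕ → ℤ → ℝ} {a' b' : ℤ → ℝ}

lemma alternant_bot (h : IsStableFamily q P a b a' b') (N : ℕ) :
    alternant P N (wordOf ⊥) = vandermondeProd N := by
  have hv := Matrix.det_eval_matrixOfPolynomials_eq_det_vandermonde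
    (fun i : Fin N => (MvPolynomial.X i.rev : MvPolynomial (Fin N) ℝ))
    (fun j => (P N ((j : ℤ) - N)).map MvPolynomial.C) (fun j => by
      have h1 := h.natDegree N ((j : ℤ) - N) (by omega)
      rw [(h.monic N _ (by omega)).natDegree_map]; omega)
    (fun j => (h.monic N _ (by omega)).map _)
  rw [Matrix.det_vandermonde] at hv
  have hl : alternant P N (wordOf ⊥) = (Matrix.of fun i j : Fin N =>
      Polynomial.eval (MvPolynomial.X i.rev) ((P N ((j : ℤ) - N)).map
        (MvPolynomial.C : ℝ →+* MvPolynomial (Fin N) ℝ))).det := by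
    rw [alternant, ← Matrix.det_transpose, ← Matrix.det_submatrix_equiv_self Fin.revPerm]
    congr 1
    ext i j : 2
    have hw : wordOf ⊥ (j.rev : ℕ) = (j : ℤ) - N := by
      simp only [wordOf, Fin.val_rev]
      have : (⊥ : YoungDiagram).rowLen (N - (j + 1)) = 0 := by
        rw [YoungDiagram.rowLen_eq_card]
        simp [YoungDiagram.row]
      rw [this]; omega
    simp only [alternantMatrix, Matrix.submatrix_apply, Matrix.transpose_apply, Matrix.of_apply,
      Fin.revPerm_apply, hw, Polynomial.eval_map]
    rfl
  rw [hl, ← hv, vandermondeProd]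
  have e1 : ∀ f : Fin N → Fin N → MvPolynomial (Fin N) ℝ,
      ∏ i, ∏ j ∈ Finset.Ioi i, f i j = ∏ i, ∏ j, if i < j then f i j else 1 := by
    intro f
    refine Finset.prod_congr rfl fun i _ => ?_
    rw [← Finset.prod_filter]
    refine Finset.prod_congr ?_ fun _ _ => rfl
    ext j; simp
  rw [e1, e1, ← Equiv.prod_comp Fin.revPerm, Finset.prod_congr rfl fun i _ =>
    (Equiv.prod_comp Fin.revPerm _).symm, Finset.prod_comm]
  refine Finset.prod_congr rfl fun i _ => Finset.prod_congr rfl fun j _ => ?_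
  simp [Fin.rev_lt_rev]

lemma natDegree_wordOf (h : IsStableFamily q P a b a' b') (ν : YoungDiagram) {N i : ℕ}
    (hi : i < N) : (P N (wordOf ν i)).natDegree = ν.rowLen i + (N - 1 - i) := by
  have := h.natDegree N (wordOf ν i) (by unfold wordOf; omega)
  unfold wordOf at this ⊢
  omega

/-- The quotient of an alternant by the Vandermonde product is the projection of a symmetric
function of degree at most the size of the partition. -/
lemma exists_proj_mul_eq_alternant (h : IsStableFamily q P a b a' b') (N : ℕ) (ν : YoungDiagram) :
    ∃ L : Sym, L.degree ≤ ν.card ∧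
      Sym.proj N L * vandermondeProd N = alternant P N (wordOf ν) := by
  have hV := vandermondeProd_ne_zero N
  obtain ⟨F, hF⟩ : vandermondeProd N ∣ alternant P N (wordOf ν) :=
    vandermondeProd_dvd fun i j hij => identify_det _ hij.ne
  have hsym : F.IsSymmetric := by
    intro σ
    have h1 : MvPolynomial.rename σ (alternant P N (wordOf ν)) = _ := rename_det _ σ
    have h2 : MvPolynomial.rename σ (alternant P N (wordOf ⊥)) = _ := rename_det _ σ
    change _ = _ * alternant P N _ at h1
    change _ = _ * alternant P N _ at h2
    rw [h.alternant_bot] at h2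
    rw [hF, map_mul, h2] at h1
    have h3 : (Equiv.Perm.sign σ : MvPolynomial (Fin N) ℝ) ≠ 0 := by
      rcases Int.units_eq_one_or (Equiv.Perm.sign σ) with e | e <;> simp [e]
    refine mul_left_cancel₀ (mul_ne_zero h3 hV) ?_
    rw [h1, mul_assoc]
  have hdeg : F.totalDegree ≤ ν.card := by
    by_cases hF0 : F = 0
    · simp [hF0]
    have h1 := MvPolynomial.totalDegree_mul_of_isDomain hV hF0
    rw [← hF, (isHomogeneous_vandermondeProd N).totalDegree hV] at h1
    have h2 : (alternant P N (wordOf ν)).totalDegree ≤ _ := totalDegree_det_le _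
    rw [Finset.sum_congr rfl fun i _ => h.natDegree_wordOf ν i.2, Finset.sum_add_distrib] at h2
    have h3 : ∑ i : Fin N, ν.rowLen i ≤ ν.card := by
      rw [card_eq_sum_rowLen (le_max_left _ N), Fin.sum_univ_eq_sum_range (fun i => ν.rowLen i)]
      exact Finset.sum_le_sum_of_subset (Finset.range_mono (le_max_right _ _))
    omega
  obtain ⟨L, hL, hL'⟩ := exists_degree_le_proj_eq hsym hdeg
  exact ⟨L, hL, by rw [hL', hF, mul_comm]⟩

end IsStableFamily

/-- The numerators of the shifted polynomials are the alternants of the stable family. -/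
lemma altNumerator_eq (q α β : ℝ) (γ δ : ℂ) (N : ℕ) (ν : YoungDiagram) :
    altNumerator q α β (γ * (q : ℂ) ^ (1 - (N : ℤ))) (δ * (q : ℂ) ^ (1 - (N : ℤ))) N ν =
      alternant (shiftedPoly q α β γ δ) N (wordOf ν) := by
  unfold altNumerator alternant alternantMatrix
  congr 1
  ext i j : 2
  rw [Matrix.of_apply, Matrix.of_apply, shiftedPoly_natCast]
  unfold wordOf
  have := i.2
  omega

/-- The monomials in the power sums of degree at most `d` inject into the partitions of size at
most `d`. -/
lemma exists_injective_monomial (d : ℕ) :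
    ∃ e : {m : ℕ →₀ ℕ // Finsupp.weight (fun k : ℕ => k + 1) m ≤ d} →
      {ν : YoungDiagram // ν.card ≤ d}, Function.Injective e := by
  have key : ∀ m : ℕ →₀ ℕ, ∃ ν : YoungDiagram,
      ν.card = Finsupp.weight (fun k : ℕ => k + 1) m ∧
      ∀ k, ν.rowLen k = m k + ν.rowLen (k + 1) := by
    intro m
    let l : ℕ → ℕ := fun k => m.sum fun j n => if k ≤ j then n else 0
    have hl : Antitone l := by
      intro k k' hk
      refine Finset.sum_le_sum fun j _ => ?_
      simp only
      split_ifs <;> omega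
    let M := m.support.sup id + 1
    have hM : ∀ j ∈ m.support, j < M := fun j hj =>
      Nat.lt_succ_iff.2 (Finset.le_sup (f := id) hj)
    have hz : ∀ i, M ≤ i → l i = 0 := by
      intro i hi
      refine Finset.sum_eq_zero fun j hj => if_neg ?_
      have := hM j hj
      omega
    obtain ⟨ν, hν⟩ := exists_youngDiagram hl hz
    refine ⟨ν, ?_, fun k => ?_⟩
    · rw [card_eq_sum_rowLen (le_max_left _ M), Finsupp.weight_apply]
      simp only [hν, l, Finsupp.sum]
      rw [Finset.sum_comm]
      refine Finset.sum_congr rfl fun j hj => ?_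
      have h1 := hM j hj
      rw [← Finset.sum_filter]
      have h2 : (Finset.range (max (ν.colLen 0) M)).filter (· ≤ j) = Finset.range (j + 1) := by
        ext i
        simp only [Finset.mem_filter, Finset.mem_range, lt_max_iff]
        omega
      rw [h2, Finset.sum_const, Finset.card_range, smul_eq_mul, smul_eq_mul, mul_comm]
    · rw [hν, hν]
      have h1 : m k = m.sum fun j n => if j = k then n else 0 := by
        rw [Finsupp.sum_ite_eq']
        simp
      simp only [l]
      rw [h1, ← Finsupp.sum_add]
      refine Finsupp.sum_congr fun j _ => ?_
      split_ifs <;> omega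
  choose f hf hf' using key
  refine ⟨fun m => ⟨f m, by rw [hf]; exact m.2⟩, fun m m' hmm => ?_⟩
  have h1 : f m = f m' := congrArg Subtype.val hmm
  ext k
  have h2 := hf' m k
  rw [h1, hf' m' k] at h2
  omega

lemma finite_card_le (d : ℕ) : Finite {ν : YoungDiagram // ν.card ≤ d} := by
  let f : {ν : YoungDiagram // ν.card ≤ d} →
      Finset.powerset (Finset.range d ×ˢ Finset.range d) := fun ν => ⟨ν.1.cells, by
    rw [Finset.mem_powerset]
    rintro ⟨i, j⟩ hc
    have hc' : (i, j) ∈ ν.1 := hc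
    have hν := ν.2
    rw [Finset.mem_product, Finset.mem_range, Finset.mem_range]
    have h1 := YoungDiagram.mem_iff_lt_colLen.1 hc'
    have h2 := YoungDiagram.mem_iff_lt_rowLen.1 hc'
    have h3 : ν.1.colLen j ≤ ν.1.card := by
      rw [YoungDiagram.colLen_eq_card]; exact Finset.card_le_card (Finset.filter_subset _ _)
    have h4 : ν.1.rowLen i ≤ ν.1.card := by
      rw [YoungDiagram.rowLen_eq_card]; exact Finset.card_le_card (Finset.filter_subset _ _)
    constructor <;> simp only <;> omega⟩
  refine Finite.of_injective f fun ν ν' h => ?_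
  exact Subtype.ext (YoungDiagram.ext (congrArg Subtype.val h))

/-! ### Integrals of products of determinants -/

section Andreief

variable {T : Type*} [MeasurableSpace T] {μ : Measure T} [SigmaFinite μ]

/-- **Andréief's identity**: the integral of a product of two determinants. -/
lemma integral_det_mul_det {n : ℕ} (f g : Fin n → T → ℝ)
    (hfg : ∀ i j, Integrable (fun t => f i t * g j t) μ) :
    ∫ t : Fin n → T, (Matrix.of fun i j => f i (t j)).det * (Matrix.of fun i j => g i (t j)).det
      ∂(Measure.pi fun _ => μ) =
    n.factorial * (Matrix.of fun i j => ∫ t, f i t * g j t ∂μ).det := by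
  have h1 : ∀ t : Fin n → T,
      (Matrix.of fun i j => f i (t j)).det * (Matrix.of fun i j => g i (t j)).det =
      ∑ σ : Equiv.Perm (Fin n), ∑ τ : Equiv.Perm (Fin n),
        ((Equiv.Perm.sign σ : ℝ) * (Equiv.Perm.sign τ : ℝ)) *
          ∏ i, (f (σ i) (t i) * g (τ i) (t i)) := by
    intro t
    rw [Matrix.det_apply', Matrix.det_apply', Finset.sum_mul_sum]
    refine Finset.sum_congr rfl fun σ _ => Finset.sum_congr rfl fun τ _ => ?_
    simp only [Matrix.of_apply, Finset.prod_mul_distrib]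
    ring
  have h2 : ∀ σ τ : Equiv.Perm (Fin n), Integrable (fun t : Fin n → T =>
      ((Equiv.Perm.sign σ : ℝ) * (Equiv.Perm.sign τ : ℝ)) *
        ∏ i, (f (σ i) (t i) * g (τ i) (t i))) (Measure.pi fun _ => μ) := fun σ τ =>
    (Integrable.fintype_prod fun i => hfg (σ i) (τ i)).const_mul _
  simp only [h1]
  rw [integral_finsetSum _ fun σ _ => integrable_finsetSum _ fun τ _ => h2 σ τ]
  have h3 : ∀ σ : Equiv.Perm (Fin n), ∫ t : Fin n → T, ∑ τ : Equiv.Perm (Fin n),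
        ((Equiv.Perm.sign σ : ℝ) * (Equiv.Perm.sign τ : ℝ)) *
          ∏ i, (f (σ i) (t i) * g (τ i) (t i)) ∂(Measure.pi fun _ => μ) =
      (Matrix.of fun i j => ∫ t, f i t * g j t ∂μ).det := by
    intro σ
    rw [integral_finsetSum _ fun τ _ => h2 σ τ]
    set A : Matrix (Fin n) (Fin n) ℝ := Matrix.of fun i j => ∫ t, f i t * g j t ∂μ with hA
    have h4 : A.det = (Equiv.Perm.sign σ : ℝ) * (A.submatrix σ id).det := by
      rw [Matrix.det_permute, ← mul_assoc]
      rcases Int.units_eq_one_or (Equiv.Perm.sign σ) with e | e <;> simp [e]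
    rw [h4, ← Matrix.det_transpose, Matrix.det_apply', Finset.mul_sum]
    refine Finset.sum_congr rfl fun τ _ => ?_
    rw [integral_const_mul, integral_fintype_prod_eq_prod (fun i t => f (σ i) t * g (τ i) t),
      mul_assoc]
    rfl
  rw [Finset.sum_congr rfl fun σ _ => h3 σ, Finset.sum_const, Finset.card_univ,
    Fintype.card_perm, Fintype.card_fin, nsmul_eq_mul]

end Andreief

/-- The determinant of a positive semidefinite matrix close to the identity. -/
lemma det_le_exp_trace {n : ℕ} {A : Matrix (Fin n) (Fin n) ℝ} (hA : A.PosSemidef) :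
    A.det ≤ Real.exp (A.trace - n) := by
  rw [hA.isHermitian.det_eq_prod_eigenvalues, hA.isHermitian.trace_eq_sum_eigenvalues]
  have h1 : ∑ i, ((hA.isHermitian.eigenvalues i : ℝ)) - n =
      ∑ i, (hA.isHermitian.eigenvalues i - 1) := by
    simp [Finset.sum_sub_distrib]
  simp only [RCLike.ofReal_real_eq_id, id_eq]
  rw [h1, Real.exp_sum]
  refine Finset.prod_le_prod (fun i _ => hA.eigenvalues_nonneg i) fun i _ => ?_
  have := Real.add_one_le_exp (hA.isHermitian.eigenvalues i - 1)
  linarith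

lemma exists_eval_bound {T : Type*} {v : T → ℝ} (hv : ∃ R, ∀ t, |v t| ≤ R) {N : ℕ}
    (f : MvPolynomial (Fin N) ℝ) : ∃ B, ∀ t : Fin N → T, |MvPolynomial.eval (v ∘ t) f| ≤ B := by
  obtain ⟨R, hR⟩ := hv
  induction f using MvPolynomial.induction_on with
  | C r => exact ⟨|r|, fun t => by simp⟩
  | add f g hf hg =>
    obtain ⟨B, hB⟩ := hf
    obtain ⟨B', hB'⟩ := hg
    refine ⟨B + B', fun t => ?_⟩
    rw [map_add]
    exact (abs_add_le _ _).trans (add_le_add (hB t) (hB' t))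
  | mul_X f i hf =>
    obtain ⟨B, hB⟩ := hf
    refine ⟨B * R, fun t => ?_⟩
    rw [map_mul, abs_mul, MvPolynomial.eval_X]
    exact mul_le_mul (hB t) (hR _) (abs_nonneg _) ((abs_nonneg _).trans (hB t))

lemma eval_alternant {T : Type*} {v : T → ℝ} {P : ℕ → ℤ → Polynomial ℝ} (N : ℕ) (w : ℕ → ℤ) (t : Fin N → T) :
    MvPolynomial.eval (v ∘ t) (alternant P N w) =
      (Matrix.of fun i j : Fin N => (P N (w i)).eval (v (t j))).det := by
  rw [alternant, RingHom.map_det]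
  congr 1
  ext i j : 2
  simp only [alternantMatrix, RingHom.mapMatrix_apply, Matrix.map_apply, Matrix.of_apply]
  change MvPolynomial.aeval (v ∘ t) _ = _
  rw [← Polynomial.aeval_algHom_apply, MvPolynomial.aeval_X]
  rfl

/-- Polynomials `P N j`, orthogonal with respect to the image of a measure `μ N` under a bounded
map `v` to the real line; `a N j` is the ratio of the squared norms of `P N j` and
`P N (j - 1)`. -/
structure IsOrthogonalModel {T : Type*} [MeasurableSpace T] (v : T → ℝ) (μ : ℕ → Measure T)
    (P : ℕ → ℤ → Polynomial ℝ) (a : ℕ → ℤ → ℝ) : Prop where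
  isFiniteMeasure : ∀ N, IsFiniteMeasure (μ N)
  bounded : ∃ R, ∀ t, |v t| ≤ R
  orth : ∀ N i j, i ≠ j → ∫ t, (P N i).eval (v t) * (P N j).eval (v t) ∂(μ N) = 0
  norm_pos : ∀ (N : ℕ) (j : ℤ), 0 ≤ (N : ℤ) + j →
    0 < ∫ t, (P N j).eval (v t) * (P N j).eval (v t) ∂(μ N)
  norm_ratio : ∀ (N : ℕ) (j : ℤ), 0 < (N : ℤ) + j →
    (∫ t, (P N j).eval (v t) * (P N j).eval (v t) ∂(μ N)) =
      a N j * ∫ t, (P N (j - 1)).eval (v t) * (P N (j - 1)).eval (v t) ∂(μ N)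

/-! ### The scalar product of alternants -/

section Form

variable {T : Type*} [MeasurableSpace T] {v : T → ℝ} {μ : ℕ → Measure T}
  {P : ℕ → ℤ → Polynomial ℝ} {a : ℕ → ℤ → ℝ}

/-- The bilinear form `∫ f(v(t_1), …, v(t_N)) g(v(t_1), …, v(t_N)) μ_N(dt_1) ⋯ μ_N(dt_N)`. -/
def evalForm (v : T → ℝ) (μ : ℕ → Measure T) (N : ℕ) (f g : MvPolynomial (Fin N) ℝ) : ℝ :=
  ∫ t : Fin N → T, MvPolynomial.eval (v ∘ t) f * MvPolynomial.eval (v ∘ t) g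
    ∂(Measure.pi fun _ => μ N)

lemma evalForm_C_mul_left (N : ℕ) (c : ℝ) (f k : MvPolynomial (Fin N) ℝ) :
    evalForm v μ N (MvPolynomial.C c * f) k = c * evalForm v μ N f k := by
  unfold evalForm
  rw [← integral_const_mul]
  simp only [map_mul, MvPolynomial.eval_C, mul_assoc]

lemma evalForm_comm (N : ℕ) (f k : MvPolynomial (Fin N) ℝ) :
    evalForm v μ N f k = evalForm v μ N k f := by
  unfold evalForm
  simp only [mul_comm]

variable [Countable T] [DiscreteMeasurableSpace T]

lemma integrable_of_abs_le {S : Type*} [MeasurableSpace S] [DiscreteMeasurableSpace S]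
    [Countable S] {ρ : Measure S} [IsFiniteMeasure ρ] {f : S → ℝ} {B : ℝ} (hB : ∀ t, |f t| ≤ B) :
    Integrable f ρ :=
  Integrable.of_bound (Measurable.of_discrete).aestronglyMeasurable B (Eventually.of_forall hB)

namespace IsOrthogonalModel

variable (h : IsOrthogonalModel v μ P a)
include h

lemma integrable_eval (N : ℕ) (f : MvPolynomial (Fin N) ℝ) :
    Integrable (fun t : Fin N → T => MvPolynomial.eval (v ∘ t) f) (Measure.pi fun _ => μ N) := by
  have := h.isFiniteMeasure
  obtain ⟨B, hB⟩ := exists_eval_bound h.bounded f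
  exact integrable_of_abs_le hB

lemma integrable_eval_mul (N : ℕ) (f g : MvPolynomial (Fin N) ℝ) :
    Integrable (fun t : Fin N → T => MvPolynomial.eval (v ∘ t) f * MvPolynomial.eval (v ∘ t) g)
      (Measure.pi fun _ => μ N) := by
  simpa only [map_mul] using h.integrable_eval N (f * g)

lemma evalForm_add_left (N : ℕ) (f g k : MvPolynomial (Fin N) ℝ) :
    evalForm v μ N (f + g) k = evalForm v μ N f k + evalForm v μ N g k := by
  unfold evalForm
  rw [← integral_add (h.integrable_eval_mul N f k) (h.integrable_eval_mul N g k)]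
  simp only [map_add, add_mul]

lemma evalForm_sum_left {ι : Type*} (N : ℕ) (s : Finset ι) (f : ι → MvPolynomial (Fin N) ℝ)
    (k : MvPolynomial (Fin N) ℝ) :
    evalForm v μ N (∑ i ∈ s, f i) k = ∑ i ∈ s, evalForm v μ N (f i) k := by
  unfold evalForm
  rw [← integral_finsetSum _ fun i _ => h.integrable_eval_mul N (f i) k]
  simp only [map_sum, Finset.sum_mul]

lemma integrable_polynomial_mul (N : ℕ) (f g : Polynomial ℝ) :
    Integrable (fun t => f.eval (v t) * g.eval (v t)) (μ N) := by
  have := h.isFiniteMeasure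
  obtain ⟨R, hR⟩ := h.bounded
  obtain ⟨B, hB⟩ := (isCompact_Icc (a := -R) (b := R)).exists_bound_of_continuousOn
    (f := fun x => (f * g).eval x) (f * g).continuous.continuousOn
  refine integrable_of_abs_le (B := B) fun t => ?_
  rw [← Polynomial.eval_mul]
  exact hB _ (abs_le.1 (hR t))

lemma evalForm_alternant (N : ℕ) (w w' : ℕ → ℤ) :
    evalForm v μ N (alternant P N w) (alternant P N w') = N.factorial * (Matrix.of fun i j : Fin N =>
      ∫ t, (P N (w i)).eval (v t) * (P N (w' j)).eval (v t) ∂(μ N)).det := by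
  have := h.isFiniteMeasure
  unfold evalForm
  simp only [eval_alternant]
  exact integral_det_mul_det (fun (i : Fin N) t => (P N (w i)).eval (v t))
    (fun (i : Fin N) t => (P N (w' i)).eval (v t)) fun i j => h.integrable_polynomial_mul N _ _

lemma evalForm_alternant_self (N : ℕ) (ν : YoungDiagram) :
    evalForm v μ N (alternant P N (wordOf ν)) (alternant P N (wordOf ν)) =
      N.factorial * ∏ i ∈ Finset.range N, ∫ t, (P N (wordOf ν i)).eval (v t) *
        (P N (wordOf ν i)).eval (v t) ∂(μ N) := by
  rw [h.evalForm_alternant, ← Fin.prod_univ_eq_prod_range (fun i => ∫ t,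
    (P N (wordOf ν i)).eval (v t) * (P N (wordOf ν i)).eval (v t) ∂(μ N)), ← Matrix.det_diagonal]
  congr 2
  ext i j
  rw [Matrix.of_apply, Matrix.diagonal_apply]
  split_ifs with hij
  · rw [hij]
  · refine h.orth N _ _ fun e => hij ?_
    exact Fin.ext ((wordOf_strictAnti ν).injective e)

lemma evalForm_alternant_self_pos (N : ℕ) (ν : YoungDiagram) :
    0 < evalForm v μ N (alternant P N (wordOf ν)) (alternant P N (wordOf ν)) := by
  rw [h.evalForm_alternant_self]
  refine mul_pos (by positivity) (Finset.prod_pos fun i hi => h.norm_pos N _ ?_)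
  have := Finset.mem_range.1 hi
  unfold wordOf
  omega

lemma evalForm_alternant_ne {N : ℕ} {ν ν' : YoungDiagram} (hne : ν ≠ ν') (hν : ν.colLen 0 ≤ N)
    (hν' : ν'.colLen 0 ≤ N) :
    evalForm v μ N (alternant P N (wordOf ν)) (alternant P N (wordOf ν')) = 0 := by
  classical
  have hex : ∃ i, ν.rowLen i ≠ ν'.rowLen i := by
    by_contra! hcon
    exact hne (ext_rowLen hcon)
  let i := Nat.find hex
  have hi : ν.rowLen i ≠ ν'.rowLen i := Nat.find_spec hex
  have hlt : ∀ j < i, ν.rowLen j = ν'.rowLen j := fun j hj => not_not.1 (Nat.find_min hex hj)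
  have hiN : i < N := by
    by_contra hcon
    exact hi (by rw [rowLen_eq_zero (by omega), rowLen_eq_zero (by omega)])
  -- At the first row where the partitions differ, the longer row is orthogonal to everything.
  have key : ∀ ν ν' : YoungDiagram, (∀ j < i, ν.rowLen j = ν'.rowLen j) →
      ν'.rowLen i < ν.rowLen i →
      evalForm v μ N (alternant P N (wordOf ν)) (alternant P N (wordOf ν')) = 0 := by
    intro ν ν' hlt hi
    rw [h.evalForm_alternant, Matrix.det_eq_zero_of_row_eq_zero ⟨i, hiN⟩, mul_zero]
    intro j
    refine h.orth N _ _ ?_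
    rcases lt_or_ge (j : ℕ) i with hj | hj
    · have := wordOf_strictAnti ν hj
      have e := hlt j hj
      unfold wordOf at this ⊢
      simp only
      omega
    · have := (wordOf_strictAnti ν').antitone hj
      unfold wordOf at this ⊢
      simp only
      omega
  rcases lt_or_gt_of_ne hi with hi | hi
  · rw [evalForm_comm]
    exact key ν' ν (fun j hj => (hlt j hj).symm) hi
  · exact key ν ν' hlt hi

omit [Countable T] [DiscreteMeasurableSpace T] in
lemma norm_add (N : ℕ) (j : ℤ) (hj : 0 ≤ (N : ℤ) + j) (n : ℕ) :
    ∫ t, (P N (j + n)).eval (v t) * (P N (j + n)).eval (v t) ∂(μ N) =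
      (∏ k ∈ Finset.range n, a N (j + k + 1)) *
        ∫ t, (P N j).eval (v t) * (P N j).eval (v t) ∂(μ N) := by
  induction n with
  | zero => simp
  | succ n ih =>
    rw [Finset.prod_range_succ, mul_comm (Finset.prod _ _), mul_assoc, ← ih]
    have := h.norm_ratio N (j + n + 1) (by omega)
    rw [add_sub_cancel_right] at this
    push_cast
    rw [← add_assoc, this]

/-- The squared norm of the alternant of a partition relative to that of the vacuum is the product
of the recurrence coefficients over the contents of the boxes. -/
lemma evalForm_alternant_self_eq {N : ℕ} {ν : YoungDiagram} (hN : ν.colLen 0 ≤ N) :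
    evalForm v μ N (alternant P N (wordOf ν)) (alternant P N (wordOf ν)) =
      (∏ i ∈ Finset.range (ν.colLen 0), ∏ k ∈ Finset.range (ν.rowLen i), a N ((k : ℤ) - i)) *
        evalForm v μ N (alternant P N (wordOf ⊥)) (alternant P N (wordOf ⊥)) := by
  have hbot : ∀ i, (⊥ : YoungDiagram).rowLen i = 0 := fun i => rowLen_eq_zero (by
    rw [YoungDiagram.colLen_eq_card]; simp [YoungDiagram.col])
  have h1 : ∏ i ∈ Finset.range (ν.colLen 0), ∏ k ∈ Finset.range (ν.rowLen i), a N ((k : ℤ) - i) =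
      ∏ i ∈ Finset.range N, ∏ k ∈ Finset.range (ν.rowLen i), a N ((k : ℤ) - i) := by
    refine Finset.prod_subset (Finset.range_mono hN) fun i _ hi => ?_
    rw [rowLen_eq_zero (by simpa using hi), Finset.prod_range_zero]
  rw [h1, h.evalForm_alternant_self, h.evalForm_alternant_self, mul_left_comm,
    ← Finset.prod_mul_distrib]
  congr 1
  refine Finset.prod_congr rfl fun i hi => ?_
  have hi := Finset.mem_range.1 hi
  have h2 := h.norm_add N (-1 - (i : ℤ)) (by omega) (ν.rowLen i)
  have e1 : wordOf ν i = -1 - (i : ℤ) + ν.rowLen i := by unfold wordOf; ring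
  have e2 : wordOf ⊥ i = -1 - (i : ℤ) := by simp [wordOf, hbot]
  rw [e1, h2, e2]
  congr 1
  refine Finset.prod_congr rfl fun k _ => ?_
  congr 1
  ring

end IsOrthogonalModel
end Form

/-- The partitions of size at most `d`. -/
def partitionsLE (d : ℕ) : Finset YoungDiagram :=
  have h : {ν : YoungDiagram | ν.card ≤ d}.Finite := finite_card_le d
  h.toFinset

lemma mem_partitionsLE {d : ℕ} {ν : YoungDiagram} : ν ∈ partitionsLE d ↔ ν.card ≤ d := by
  exact (Set.Finite.mem_toFinset _).trans Iff.rfl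

lemma Stabilises.exists_expansion {P : ℕ → ℤ → Polynomial ℝ} {d : ℤ}
    {f : (N : ℕ) → MvPolynomial (Fin N) ℝ} (hf : Stabilises P d f) :
    ∃ (S : Finset YoungDiagram) (c : YoungDiagram → ℕ → ℝ) (l : YoungDiagram → ℝ),
      (∀ ν ∈ S, (ν.card : ℤ) ≤ d) ∧
      (∀ᶠ N in atTop, f N = ∑ ν ∈ S, MvPolynomial.C (c ν N) * alternant P N (wordOf ν)) ∧
      (∀ ν, Tendsto (c ν) atTop (𝓝 (l ν))) ∧
      (∀ ν, (ν.card : ℤ) = d → ∀ᶠ N in atTop, c ν N = l ν) ∧ ∀ ν ∉ S, c ν = 0 := by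
  classical
  induction hf with
  | zero =>
    exact ⟨∅, 0, 0, by simp, by simp, fun ν => tendsto_const_nhds,
      fun ν _ => Eventually.of_forall fun _ => rfl, fun ν _ => rfl⟩
  | add _ _ ih1 ih2 =>
    obtain ⟨S, c, l, h1, h2, h3, h4, h5⟩ := ih1
    obtain ⟨S', c', l', h1', h2', h3', h4', h5'⟩ := ih2
    refine ⟨S ∪ S', c + c', l + l', ?_, ?_, fun ν => (h3 ν).add (h3' ν), fun ν hν => ?_, ?_⟩
    · intro ν hν
      exact (Finset.mem_union.1 hν).elim (h1 ν) (h1' ν)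
    · filter_upwards [h2, h2'] with N hN hN'
      rw [hN, hN', Finset.sum_subset (show S ⊆ S ∪ S' from Finset.subset_union_left) fun ν _ hν => by
          rw [h5 ν hν]; simp,
        Finset.sum_subset (show S' ⊆ S ∪ S' from Finset.subset_union_right) fun ν _ hν => by
          rw [h5' ν hν]; simp, ← Finset.sum_add_distrib]
      refine Finset.sum_congr rfl fun ν _ => ?_
      simp [add_mul]
    · filter_upwards [h4 ν hν, h4' ν hν] with N hN hN'
      simp [hN, hN']
    · intro ν hν
      rw [Finset.mem_union, not_or] at hν
      simp [h5 ν hν.1, h5' ν hν.2]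
  | single c l ν hdeg hc htop =>
    refine ⟨{ν}, fun ν' N => if ν' = ν then c N else 0, fun ν' => if ν' = ν then l else 0,
      ?_, ?_, fun ν' => ?_, fun ν' hν' => ?_, ?_⟩
    · simpa using hdeg
    · simp
    · by_cases e : ν' = ν
      · simpa [e] using hc
      · simp [e]
    · by_cases e : ν' = ν
      · subst e
        simpa using htop hν'
      · simp [e]
    · intro ν' hν'
      ext N
      simp [Finset.mem_singleton.not.1 hν']
  | congr he _ h1 =>
    obtain ⟨S, c, l, h1, h2, h3⟩ := h1
    refine ⟨S, c, l, h1, ?_, h3⟩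
    filter_upwards [he, h2] with N hN hN'
    rw [← hN, hN']

/-! ### The limiting coefficients of a symmetric function -/

section Fock

variable {T : Type*} [MeasurableSpace T]

/-- The coefficient of the alternant of `ν` in the alternating polynomial `F · V`, where `F` is a
symmetric function and `V` the Vandermonde product in `N` variables. -/
def levelCoeff (v : T → ℝ) (μ : ℕ → Measure T) (P : ℕ → ℤ → Polynomial ℝ) (N : ℕ)
    (ν : YoungDiagram) (F : Sym) : ℝ :=
  evalForm v μ N (Sym.proj N F * alternant P N (wordOf ⊥)) (alternant P N (wordOf ν)) /
    evalForm v μ N (alternant P N (wordOf ν)) (alternant P N (wordOf ν))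

/-- The limit, as the number of variables grows, of the coefficients `levelCoeff`. -/
def fockCoeff (v : T → ℝ) (μ : ℕ → Measure T) (P : ℕ → ℤ → Polynomial ℝ) (ν : YoungDiagram)
    (F : Sym) : ℝ :=
  limUnder atTop fun N => levelCoeff v μ P N ν F

variable {v : T → ℝ} {μ : ℕ → Measure T} {P : ℕ → ℤ → Polynomial ℝ} {q : ℝ} {a b : ℕ → ℤ → ℝ}
  {a' b' : ℤ → ℝ}

lemma levelCoeff_smul (N : ℕ) (ν : YoungDiagram) (r : ℝ) (F : Sym) :
    levelCoeff v μ P N ν (r • F) = r * levelCoeff v μ P N ν F := by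
  unfold levelCoeff
  rw [map_smul, MvPolynomial.smul_eq_C_mul, mul_assoc, evalForm_C_mul_left, mul_div_assoc]

variable [Countable T] [DiscreteMeasurableSpace T]

namespace IsOrthogonalModel

variable (hm : IsOrthogonalModel v μ P a)
include hm

lemma levelCoeff_add (N : ℕ) (ν : YoungDiagram) (F G : Sym) :
    levelCoeff v μ P N ν (F + G) = levelCoeff v μ P N ν F + levelCoeff v μ P N ν G := by
  unfold levelCoeff
  rw [map_add, add_mul, hm.evalForm_add_left, add_div]

lemma levelCoeff_sum {ι : Type*} (s : Finset ι) (N : ℕ) (ν : YoungDiagram) (F : ι → Sym) :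
    levelCoeff v μ P N ν (∑ i ∈ s, F i) = ∑ i ∈ s, levelCoeff v μ P N ν (F i) := by
  unfold levelCoeff
  rw [map_sum, Finset.sum_mul, hm.evalForm_sum_left, Finset.sum_div]

/-- Orthogonality recovers the coefficients of an expansion in alternants. -/
lemma evalForm_sum_alternant {N : ℕ} {S : Finset YoungDiagram} (hS : ∀ ν ∈ S, ν.colLen 0 ≤ N)
    (c : YoungDiagram → ℝ) (hc : ∀ ν ∉ S, c ν = 0) {ν : YoungDiagram} (hν : ν.colLen 0 ≤ N) :
    evalForm v μ N (∑ ν ∈ S, MvPolynomial.C (c ν) * alternant P N (wordOf ν))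
      (alternant P N (wordOf ν)) /
    evalForm v μ N (alternant P N (wordOf ν)) (alternant P N (wordOf ν)) = c ν := by
  rw [hm.evalForm_sum_left, div_eq_iff (hm.evalForm_alternant_self_pos N ν).ne']
  simp only [evalForm_C_mul_left]
  rw [Finset.sum_eq_single ν]
  · intro ν' hν' hne
    rw [hm.evalForm_alternant_ne hne (hS ν' hν') hν, mul_zero]
  · intro hν'
    rw [hc ν hν', zero_mul]

variable (hs : IsStableFamily q P a b a' b')
include hs

lemma exists_levelCoeff {F : Sym} {d : ℕ} (hF : F.degree ≤ d) :
    ∃ l : YoungDiagram → ℝ,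
      (∀ᶠ N in atTop, Sym.proj N F * alternant P N (wordOf ⊥) = ∑ ν ∈ partitionsLE d,
        MvPolynomial.C (levelCoeff v μ P N ν F) * alternant P N (wordOf ν)) ∧
      (∀ ν, Tendsto (fun N => levelCoeff v μ P N ν F) atTop (𝓝 (l ν))) ∧
      (∀ ν : YoungDiagram, d ≤ ν.card → ∀ᶠ N in atTop, levelCoeff v μ P N ν F = l ν) ∧
      ∀ ν : YoungDiagram, d < ν.card → l ν = 0 := by
  obtain ⟨S, c, l, h1, h2, h3, h4, h5⟩ := (hs.stabilises_proj hF).exists_expansion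
  have hS : S ⊆ partitionsLE d := fun ν hν => mem_partitionsLE.2 (by exact_mod_cast h1 ν hν)
  have hlen : ∀ᶠ N in atTop, ∀ ν ∈ S, ν.colLen 0 ≤ N :=
    (Finset.eventually_all _).2 fun ν _ => eventually_ge_atTop _
  have hcoeff : ∀ ν, ∀ᶠ N in atTop, levelCoeff v μ P N ν F = c ν N := by
    intro ν
    filter_upwards [h2, hlen, eventually_ge_atTop (ν.colLen 0)] with N hN hl hν
    unfold levelCoeff
    rw [hN]
    exact hm.evalForm_sum_alternant hl (fun ν => c ν N) (fun ν hν => by rw [h5 ν hν]; rfl) hν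
  refine ⟨l, ?_, fun ν => (h3 ν).congr' ((hcoeff ν).mono fun N hN => hN.symm), fun ν hν => ?_,
    fun ν hν => ?_⟩
  · have hall : ∀ᶠ N in atTop, ∀ ν ∈ partitionsLE d, levelCoeff v μ P N ν F = c ν N :=
      (Finset.eventually_all _).2 fun ν _ => hcoeff ν
    filter_upwards [h2, hall] with N hN hc
    rw [hN, Finset.sum_subset hS fun ν _ hν => by rw [h5 ν hν]; simp]
    exact Finset.sum_congr rfl fun ν hν => by rw [hc ν hν]
  · rcases hν.eq_or_lt with hd | hd
    · filter_upwards [hcoeff ν, h4 ν (by exact_mod_cast hd.symm)] with N hN hN'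
      rw [hN, hN']
    · have hνS : ν ∉ S := fun h => absurd (mem_partitionsLE.1 (hS h)) (by omega)
      have hl : l ν = 0 := tendsto_nhds_unique (h3 ν) (by rw [h5 ν hνS]; exact tendsto_const_nhds)
      filter_upwards [hcoeff ν] with N hN
      rw [hN, h5 ν hνS, hl]; rfl
  · have hνS : ν ∉ S := fun h => absurd (mem_partitionsLE.1 (hS h)) (by omega)
    exact tendsto_nhds_unique (h3 ν) (by rw [h5 ν hνS]; exact tendsto_const_nhds)

lemma tendsto_levelCoeff (ν : YoungDiagram) (F : Sym) :
    Tendsto (fun N => levelCoeff v μ P N ν F) atTop (𝓝 (fockCoeff v μ P ν F)) := by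
  obtain ⟨l, -, h2, -⟩ := hm.exists_levelCoeff hs (le_refl F.degree)
  exact tendsto_nhds_limUnder ⟨l ν, h2 ν⟩

lemma fockCoeff_add (ν : YoungDiagram) (F G : Sym) :
    fockCoeff v μ P ν (F + G) = fockCoeff v μ P ν F + fockCoeff v μ P ν G :=
  tendsto_nhds_unique (hm.tendsto_levelCoeff hs ν (F + G))
    (((hm.tendsto_levelCoeff hs ν F).add (hm.tendsto_levelCoeff hs ν G)).congr fun N =>
      (hm.levelCoeff_add N ν F G).symm)

lemma fockCoeff_smul (ν : YoungDiagram) (r : ℝ) (F : Sym) :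
    fockCoeff v μ P ν (r • F) = r * fockCoeff v μ P ν F :=
  tendsto_nhds_unique (hm.tendsto_levelCoeff hs ν (r • F))
    (((hm.tendsto_levelCoeff hs ν F).const_mul r).congr fun N =>
      (levelCoeff_smul N ν r F).symm)

/-- The linear map that sends a symmetric function to the family of its limiting coefficients. -/
def fock : Sym →ₗ[ℝ] YoungDiagram → ℝ where
  toFun F ν := fockCoeff v μ P ν F
  map_add' F G := funext fun ν => hm.fockCoeff_add hs ν F G
  map_smul' r F := funext fun ν => hm.fockCoeff_smul hs ν r F

lemma tendsto_fock (ν : YoungDiagram) (F : Sym) :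
    Tendsto (fun N => levelCoeff v μ P N ν F) atTop (𝓝 (hm.fock hs F ν)) :=
  hm.tendsto_levelCoeff hs ν F

lemma eventually_expansion {F : Sym} {d : ℕ} (hF : F.degree ≤ d) :
    ∀ᶠ N in atTop, Sym.proj N F * alternant P N (wordOf ⊥) = ∑ ν ∈ partitionsLE d,
        MvPolynomial.C (levelCoeff v μ P N ν F) * alternant P N (wordOf ν) := by
  obtain ⟨l, h1, -⟩ := hm.exists_levelCoeff hs hF
  exact h1

lemma fock_eq_zero {F : Sym} {d : ℕ} (hF : F.degree ≤ d) {ν : YoungDiagram} (hν : d < ν.card) :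
    hm.fock hs F ν = 0 := by
  obtain ⟨l, -, h2, -, h4⟩ := hm.exists_levelCoeff hs hF
  rw [← h4 ν hν]
  exact tendsto_nhds_unique (hm.tendsto_fock hs ν F) (h2 ν)

lemma eventually_levelCoeff_eq {F : Sym} {d : ℕ} (hF : F.degree ≤ d) {ν : YoungDiagram}
    (hν : d ≤ ν.card) : ∀ᶠ N in atTop, levelCoeff v μ P N ν F = hm.fock hs F ν := by
  obtain ⟨l, -, h2, h3, -⟩ := hm.exists_levelCoeff hs hF
  rw [tendsto_nhds_unique (hm.tendsto_fock hs ν F) (h2 ν)]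
  exact h3 ν hν

end IsOrthogonalModel

/-- The exponents of the monomials of degree at most `d` in the power sums. -/
def monomialsLE (d : ℕ) : Finset (ℕ →₀ ℕ) :=
  have h : {m : ℕ →₀ ℕ | Finsupp.weight (fun k : ℕ => k + 1) m ≤ d}.Finite :=
    have := finite_card_le d
    Finite.of_injective _ (exists_injective_monomial d).choose_spec
  h.toFinset

lemma mem_monomialsLE {d : ℕ} {m : ℕ →₀ ℕ} :
    m ∈ monomialsLE d ↔ Finsupp.weight (fun k : ℕ => k + 1) m ≤ d := by
  exact (Set.Finite.mem_toFinset _).trans Iff.rfl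

lemma card_monomialsLE_le (d : ℕ) : (monomialsLE d).card ≤ (partitionsLE d).card := by
  obtain ⟨e, he⟩ := exists_injective_monomial d
  have := finite_card_le d
  have h1 := Nat.card_le_card_of_injective e he
  rw [Nat.subtype_card (monomialsLE d) fun m => mem_monomialsLE,
    Nat.subtype_card (partitionsLE d) fun ν => mem_partitionsLE] at h1
  exact h1

lemma eq_sum_monomialsLE {F : Sym} {d : ℕ} (hF : F.degree ≤ d) :
    F = ∑ m ∈ monomialsLE d, F.coeff m • MvPolynomial.monomial m 1 := by
  conv_lhs => rw [F.as_sum]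
  refine (Finset.sum_subset (fun m hm => mem_monomialsLE.2 (degree_le_iff.1 hF m hm))
    fun m _ hm => ?_).trans (Finset.sum_congr rfl fun m _ => ?_)
  · rw [MvPolynomial.notMem_support_iff.1 hm, MvPolynomial.monomial_zero]
  · rw [MvPolynomial.smul_monomial, smul_eq_mul, mul_one]

lemma degree_monomial_le (m : ℕ →₀ ℕ) (c : ℝ) :
    Sym.degree (MvPolynomial.monomial m c) ≤ Finsupp.weight (fun k : ℕ => k + 1) m := by
  rw [degree_le_iff]
  intro m' hm'
  rw [Finset.mem_singleton.1 (MvPolynomial.support_monomial_subset hm')]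

lemma degree_sum_smul_le {ι : Type*} (s : Finset ι) (c : ι → ℝ) (F : ι → Sym) {d : ℕ}
    (h : ∀ i ∈ s, (F i).degree ≤ d) : Sym.degree (∑ i ∈ s, c i • F i) ≤ d := by
  classical
  rw [degree_le_iff]
  intro m hm
  obtain ⟨i, hi, hm'⟩ := Finset.mem_biUnion.1 (MvPolynomial.support_sum hm)
  exact degree_le_iff.1 (h i hi) m (MvPolynomial.support_smul hm')

namespace IsOrthogonalModel

variable (hm : IsOrthogonalModel v μ P a) (hs : IsStableFamily q P a b a' b')
include hm hs

/-- The leading coefficients of all symmetric functions of degree `d` become stationary at the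
same number of variables. -/
lemma eventually_forall_levelCoeff_eq {d : ℕ} {ν : YoungDiagram} (hν : d ≤ ν.card) :
    ∀ᶠ N in atTop, ∀ F : Sym, F.degree ≤ d → levelCoeff v μ P N ν F = hm.fock hs F ν := by
  have h1 : ∀ᶠ N in atTop, ∀ m ∈ monomialsLE d,
      levelCoeff v μ P N ν (MvPolynomial.monomial m 1) =
        hm.fock hs (MvPolynomial.monomial m 1) ν :=
    (Finset.eventually_all _).2 fun m hm' => hm.eventually_levelCoeff_eq hs
      ((degree_monomial_le m 1).trans (mem_monomialsLE.1 hm')) hν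
  filter_upwards [h1] with N hN F hF
  rw [eq_sum_monomialsLE hF, hm.levelCoeff_sum, map_sum, Finset.sum_apply]
  refine Finset.sum_congr rfl fun m hm' => ?_
  rw [levelCoeff_smul, map_smul, Pi.smul_apply, smul_eq_mul, hN m hm']

open Classical in
lemma exists_fock_leading (ν : YoungDiagram) : ∃ L : Sym, L.degree ≤ ν.card ∧
    ∀ ν' : YoungDiagram, ν.card ≤ ν'.card →
      hm.fock hs L ν' = (Pi.single ν 1 : YoungDiagram → ℝ) ν' := by
  classical
  have h1 : ∀ᶠ N in atTop, ∀ ν' ∈ partitionsLE ν.card, ν.card ≤ ν'.card →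
      ∀ F : Sym, F.degree ≤ ν.card → levelCoeff v μ P N ν' F = hm.fock hs F ν' :=
    (Finset.eventually_all _).2 fun ν' _ => by
      by_cases hν' : ν.card ≤ ν'.card
      · filter_upwards [hm.eventually_forall_levelCoeff_eq hs hν'] with N hN _ using hN
      · exact Eventually.of_forall fun N h => absurd h hν'
  have h2 : ∀ᶠ N in atTop, ∀ ν' ∈ partitionsLE ν.card, ν'.colLen 0 ≤ N :=
    (Finset.eventually_all _).2 fun ν' _ => eventually_ge_atTop _
  obtain ⟨N, h1, h2⟩ := (h1.and h2).exists
  obtain ⟨L, hL, hL'⟩ := hs.exists_proj_mul_eq_alternant N ν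
  refine ⟨L, hL, fun ν' hν' => ?_⟩
  rcases hν'.eq_or_lt with he | hlt
  · have hmem : ν' ∈ partitionsLE ν.card := mem_partitionsLE.2 he.ge
    rw [← h1 ν' hmem hν' L hL]
    unfold levelCoeff
    rw [hs.alternant_bot, hL']
    rcases eq_or_ne ν' ν with rfl | hne
    · rw [div_self (hm.evalForm_alternant_self_pos N _).ne', Pi.single_eq_same]
    · rw [hm.evalForm_alternant_ne hne.symm (h2 ν (mem_partitionsLE.2 le_rfl)) (h2 ν' hmem),
        zero_div, Pi.single_eq_of_ne hne]
  · have hne : ν' ≠ ν := by rintro rfl; exact lt_irrefl _ hlt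
    rw [hm.fock_eq_zero hs hL hlt, Pi.single_eq_of_ne hne]

open Classical in
lemma exists_fock_eq_single (ν : YoungDiagram) : ∃ L : Sym, L.degree ≤ ν.card ∧
    hm.fock hs L = Pi.single ν 1 := by
  classical
  induction hn : ν.card using Nat.strong_induction_on generalizing ν with
  | _ n ih =>
  obtain ⟨L, hL, hL'⟩ := hm.exists_fock_leading hs ν
  choose! B hB hB' using fun (ν' : YoungDiagram) (h : ν'.card < n) => ih ν'.card h ν' rfl
  have hlt : ∀ ν' ∈ (partitionsLE n).filter (fun ν' => ν'.card < n), ν'.card < n :=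
    fun ν' h => (Finset.mem_filter.1 h).2
  refine ⟨L - ∑ ν' ∈ (partitionsLE n).filter (fun ν' => ν'.card < n), hm.fock hs L ν' • B ν',
    ?_, ?_⟩
  · have h1 := degree_sum_smul_le ((partitionsLE n).filter (fun ν' => ν'.card < n))
      (fun ν' => hm.fock hs L ν') B fun ν' h => (hB ν' (hlt ν' h)).trans (hlt ν' h).le
    rw [degree_le_iff] at h1 ⊢
    intro m hm'
    rcases Finset.mem_union.1 (MvPolynomial.support_sub ℕ _ _ hm') with h | h
    · exact (degree_le_iff.1 hL m h).trans hn.le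
    · exact h1 m h
  · rw [map_sub, map_sum]
    ext ν'
    rw [Pi.sub_apply, Finset.sum_apply]
    have h2 : ∀ μ' ∈ (partitionsLE n).filter (fun ν' => ν'.card < n),
        hm.fock hs (hm.fock hs L μ' • B μ') ν' = if ν' = μ' then hm.fock hs L ν' else 0 := by
      intro μ' h
      rw [map_smul, hB' μ' (hlt μ' h), Pi.smul_apply, Pi.single_apply]
      split_ifs with e
      · simp [e]
      · simp
    rw [Finset.sum_congr rfl h2, Finset.sum_ite_eq]
    by_cases hc : ν'.card < n
    · have hne : ν' ≠ ν := by rintro rfl; omega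
      rw [if_pos (Finset.mem_filter.2 ⟨mem_partitionsLE.2 hc.le, hc⟩), sub_self,
        Pi.single_eq_of_ne hne]
    · rw [if_neg (fun h => hc (hlt ν' h)), sub_zero, hL' ν' (by omega)]

/-- A symmetric function is determined by its limiting coefficients. -/
lemma fock_injective : Function.Injective (hm.fock hs) := by
  classical
  rw [injective_iff_map_eq_zero]
  intro F hF
  set d := F.degree with hd
  -- Among the symmetric functions of degree at most `d`, the limiting coefficients take all
  -- values, so it suffices to compare dimensions.
  let φ : (monomialsLE d → ℝ) →ₗ[ℝ] (partitionsLE d → ℝ) :=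
    LinearMap.pi fun ν => (LinearMap.proj (ν : YoungDiagram)).comp ((hm.fock hs).comp
      (Fintype.linearCombination ℝ fun m : monomialsLE d =>
        (MvPolynomial.monomial (m : ℕ →₀ ℕ) 1 : Sym)))
  have hφ : ∀ {G : Sym}, G.degree ≤ d → ∀ ν, φ (fun m => G.coeff m) ν = hm.fock hs G ν := by
    intro G hG ν
    simp only [φ, LinearMap.pi_apply, LinearMap.comp_apply, LinearMap.proj_apply,
      Fintype.linearCombination_apply]
    conv_rhs => rw [eq_sum_monomialsLE hG]
    rw [Finset.univ_eq_attach,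
      Finset.sum_attach (monomialsLE d) fun m => G.coeff m • MvPolynomial.monomial m 1]
  have hsurj : Function.Surjective φ := by
    intro g
    choose B hB hB' using hm.exists_fock_eq_single hs
    refine ⟨∑ μ' : partitionsLE d, g μ' • fun m : monomialsLE d => (B μ').coeff (m : ℕ →₀ ℕ), ?_⟩
    rw [map_sum]
    ext ν
    rw [Finset.sum_apply, Finset.sum_eq_single ν]
    · rw [map_smul, Pi.smul_apply, hφ ((hB ν).trans (mem_partitionsLE.1 ν.2)), hB']
      simp
    · intro μ' _ hne
      rw [map_smul, Pi.smul_apply, hφ ((hB μ').trans (mem_partitionsLE.1 μ'.2)), hB',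
        Pi.single_eq_of_ne (fun e => hne (Subtype.ext e.symm)), smul_zero]
    · simp
  have hcard : Module.finrank ℝ (monomialsLE d → ℝ) = Module.finrank ℝ (partitionsLE d → ℝ) := by
    refine le_antisymm ?_ (LinearMap.finrank_le_finrank_of_surjective hsurj)
    rw [Module.finrank_fintype_fun_eq_card, Module.finrank_fintype_fun_eq_card,
      Fintype.card_coe, Fintype.card_coe]
    exact card_monomialsLE_le d
  have hinj := (LinearMap.injective_iff_surjective_of_finrank_eq_finrank hcard).2 hsurj
  have h0 : (fun m : monomialsLE d => F.coeff m) = 0 := by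
    refine hinj ?_
    rw [map_zero]
    ext ν
    rw [hφ le_rfl, hF]
    rfl
  rw [eq_sum_monomialsLE hd.ge]
  refine Finset.sum_eq_zero fun m hm' => ?_
  rw [show F.coeff m = 0 from congrFun h0 ⟨m, hm'⟩, zero_smul]

end IsOrthogonalModel
end Fock

/-! ### Symmetric functions on the space of configurations -/

section ConfigurationSpace

variable {q α β s p : ℝ}

instance (q α β : ℝ) : CompactSpace (Config q α β) :=
  inferInstanceAs (CompactSpace (lattice q α β → Bool))

instance (q α β : ℝ) : T2Space (Config q α β) :=
  inferInstanceAs (T2Space (lattice q α β → Bool))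

instance (q α β : ℝ) : Countable (lattice q α β) := by
  have : lattice q α β = (Set.range fun k : ℕ => β⁻¹ * q ^ (k + 1)) ∪
      Set.range fun k : ℕ => α⁻¹ * q ^ (k + 1) := by
    ext x
    simp only [lattice, Set.mem_ofPred_eq, Set.mem_union, Set.mem_range, exists_or, eq_comm]
  rw [this]
  exact ((Set.countable_range _).union (Set.countable_range _)).to_subtype

instance (q α β : ℝ) : SecondCountableTopology (Config q α β) :=
  inferInstanceAs (SecondCountableTopology (lattice q α β → Bool))

instance (q α β : ℝ) : TopologicalSpace.PseudoMetrizableSpace (Config q α β) :=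
  inferInstanceAs (TopologicalSpace.PseudoMetrizableSpace (lattice q α β → Bool))

lemma continuous_config_apply (x : lattice q α β) :
    Continuous fun X : Config q α β => (X x : Bool) :=
  continuous_apply (A := fun _ : lattice q α β => Bool) x

/-- The sum of a function over the points of a configuration. -/
lemma tsum_points (X : Config q α β) (f : ℝ → ℝ) :
    ∑' x : X.points, f x = ∑' x : lattice q α β, if X x then f x else 0 := by
  have h1 : X.points = Set.range fun y : {x : lattice q α β // X x = true} => (y : ℝ) := by
    ext x
    constructor
    · rintro ⟨h, hX⟩
      exact ⟨⟨⟨x, h⟩, hX⟩, rfl⟩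
    · rintro ⟨⟨⟨x, h⟩, hX⟩, rfl⟩
      exact ⟨h, hX⟩
  have hinj : Function.Injective fun y : {x : lattice q α β // X x = true} => (y : ℝ) :=
    fun a b hab => Subtype.ext (Subtype.ext hab)
  rw [h1, tsum_range f hinj]
  exact (tsum_subtype {x : lattice q α β | X x = true} fun x => f x).trans
    (tsum_congr fun x => by rw [Set.indicator_apply]; rfl)

lemma evalAt_eq (F : Sym) (X : Config q α β) : F.evalAt X =
    MvPolynomial.aeval (fun k : ℕ => ∑' x : lattice q α β, if X x then (x : ℝ) ^ (k + 1) else 0)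
      F := by
  unfold Sym.evalAt
  congr 2
  ext k
  exact tsum_points X fun x => x ^ (k + 1)

lemma summable_abs_lattice_pow (h : Regular q α β s p) (k : ℕ) :
    Summable fun x : lattice q α β => |(x : ℝ)| ^ (k + 1) := by
  obtain ⟨R, hR, hR'⟩ := exists_lattice_bound h
  refine Summable.of_nonneg_of_le (fun x => by positivity) (fun x => ?_)
    ((summable_abs_lattice h).mul_left (R ^ k))
  rw [pow_succ]
  exact mul_le_mul_of_nonneg_right (pow_le_pow_left₀ (abs_nonneg _) (hR' x x.2) k) (abs_nonneg _)

lemma continuous_evalAt (h : Regular q α β s p) (F : Sym) :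
    Continuous fun X : Config q α β => F.evalAt X := by
  have hp : ∀ k : ℕ, Continuous fun X : Config q α β =>
      ∑' x : lattice q α β, if X x then (x : ℝ) ^ (k + 1) else 0 := by
    intro k
    refine continuous_tsum (u := fun x : lattice q α β => |(x : ℝ)| ^ (k + 1)) (fun x => ?_)
      (summable_abs_lattice_pow h k) fun x X => ?_
    · exact (continuous_of_discreteTopology (f := fun b : Bool =>
        if b then (x : ℝ) ^ (k + 1) else 0)).comp (continuous_config_apply x)
    · split_ifs
      · rw [Real.norm_eq_abs, abs_pow]
      · rw [norm_zero]; positivity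
  simp only [evalAt_eq]
  induction F using MvPolynomial.induction_on with
  | C r => simpa using continuous_const
  | add F G hF hG =>
    simp only [map_add]
    exact hF.add hG
  | mul_X F k hF =>
    simp only [map_mul, MvPolynomial.aeval_X]
    exact hF.mul (hp k)

lemma evalAt_add (F G : Sym) (X : Config q α β) : (F + G).evalAt X = F.evalAt X + G.evalAt X :=
  map_add _ _ _

lemma evalAt_mul (F G : Sym) (X : Config q α β) : (F * G).evalAt X = F.evalAt X * G.evalAt X :=
  map_mul _ _ _

lemma evalAt_smul (r : ℝ) (F : Sym) (X : Config q α β) : (r • F).evalAt X = r * F.evalAt X :=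
  map_smul _ _ _

lemma evalAt_one (X : Config q α β) : (1 : Sym).evalAt X = 1 := map_one _

lemma evalAt_sum {ι : Type*} (S : Finset ι) (F : ι → Sym) (X : Config q α β) :
    Sym.evalAt (∑ i ∈ S, F i) X = ∑ i ∈ S, (F i).evalAt X := map_sum _ _ _

/-- The symmetric functions, as continuous functions on the space of configurations. -/
def evalHom (h : Regular q α β s p) : Sym →ₐ[ℝ] C(Config q α β, ℝ) where
  toFun F := ⟨fun X => F.evalAt X, continuous_evalAt h F⟩
  map_one' := by ext X; exact evalAt_one X
  map_mul' F G := by ext X; exact evalAt_mul F G X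
  map_zero' := by
    ext X
    exact map_zero (MvPolynomial.aeval (R := ℝ) fun k : ℕ => ∑' x : X.points, (x : ℝ) ^ (k + 1))
  map_add' F G := by ext X; exact evalAt_add F G X
  commutes' r := by
    ext X
    exact (MvPolynomial.aeval (R := ℝ) fun k : ℕ => ∑' x : X.points, (x : ℝ) ^ (k + 1)).commutes r

lemma lattice_ne_zero (h : Regular q α β s p) {x : ℝ} (hx : x ∈ lattice q α β) : x ≠ 0 := by
  obtain ⟨k, rfl | rfl⟩ := hx
  · exact mul_ne_zero (inv_ne_zero h.β_neg.ne) (pow_ne_zero _ h.q_pos.ne')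
  · exact mul_ne_zero (inv_ne_zero h.α_pos.ne') (pow_ne_zero _ h.q_pos.ne')

/-- Symmetric functions separate configurations: the sums `∑_{x ∈ X} x f(x)` over polynomials `f`
that converge to the indicator of a point detect whether the point belongs to `X`. -/
lemma eq_of_forall_evalAt_eq (h : Regular q α β s p) {X Y : Config q α β}
    (hXY : ∀ F : Sym, F.evalAt X = F.evalAt Y) : X = Y := by
  let e : lattice q α β → ℝ := fun x => (if X x then 1 else 0) - if Y x then 1 else 0
  have he : ∀ x, |e x| ≤ 1 := by
    intro x
    simp only [e]
    split_ifs <;> simp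
  have hsum : ∀ k : ℕ, Summable fun x : lattice q α β => e x * (x : ℝ) ^ (k + 1) := fun k =>
    Summable.of_norm_bounded (summable_abs_lattice_pow h k) fun x => by
      rw [Real.norm_eq_abs, abs_mul, abs_pow]
      exact mul_le_of_le_one_left (by positivity) (he x)
  have hpow : ∀ k : ℕ, ∑' x, e x * (x : ℝ) ^ (k + 1) = 0 := by
    intro k
    have h1 := hXY (MvPolynomial.X k)
    rw [evalAt_eq, evalAt_eq, MvPolynomial.aeval_X, MvPolynomial.aeval_X] at h1
    have hs : ∀ Z : Config q α β,
        Summable fun x : lattice q α β => if Z x then (x : ℝ) ^ (k + 1) else 0 := fun Z =>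
      Summable.of_norm_bounded (summable_abs_lattice_pow h k) fun x => by
        split_ifs
        · rw [Real.norm_eq_abs, abs_pow]
        · rw [norm_zero]; positivity
    rw [← sub_eq_zero.2 h1, ← (hs X).tsum_sub (hs Y)]
    refine tsum_congr fun x => ?_
    simp only [e]
    split_ifs <;> simp
  have hpoly : ∀ f : Polynomial ℝ, ∑' x, e x * ((x : ℝ) * f.eval (x : ℝ)) = 0 := by
    intro f
    have h1 : ∀ x : lattice q α β, e x * ((x : ℝ) * f.eval (x : ℝ)) =
        ∑ k ∈ Finset.range (f.natDegree + 1), f.coeff k * (e x * (x : ℝ) ^ (k + 1)) := by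
      intro x
      rw [Polynomial.eval_eq_sum_range, Finset.mul_sum, Finset.mul_sum]
      exact Finset.sum_congr rfl fun k _ => by ring
    simp only [h1]
    rw [Summable.tsum_finsetSum fun k _ => (hsum k).mul_left _]
    simp only [tsum_mul_left, hpow, mul_zero, Finset.sum_const_zero]
  obtain ⟨R, hR, hR'⟩ := exists_lattice_bound h
  have hzero : ∀ y : lattice q α β, e y = 0 := by
    intro y
    let f : ℝ → ℝ := fun x => 1 - (x - y) ^ 2 / (4 * R ^ 2)
    have hf : ∀ x : lattice q α β, 0 ≤ f x ∧ f x ≤ 1 := by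
      intro x
      have h1 : |(x : ℝ) - y| ≤ 2 * R := (abs_sub _ _).trans (by linarith [hR' x x.2, hR' y y.2])
      have h2 : ((x : ℝ) - y) ^ 2 ≤ 4 * R ^ 2 := by
        nlinarith [abs_le.1 h1, sq_abs ((x : ℝ) - y), abs_nonneg ((x : ℝ) - y)]
      have h3 : ((x : ℝ) - y) ^ 2 / (4 * R ^ 2) ≤ 1 := div_le_one_of_le₀ h2 (by positivity)
      have h4 : 0 ≤ ((x : ℝ) - y) ^ 2 / (4 * R ^ 2) := by positivity
      simp only [f]
      constructor <;> linarith
    have hlim : Tendsto (fun m : ℕ => ∑' x : lattice q α β, e x * ((x : ℝ) * f x ^ m)) atTop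
        (𝓝 (∑' x : lattice q α β, if x = y then e y * (y : ℝ) else 0)) := by
      refine tendsto_tsum_of_dominated_convergence (summable_abs_lattice h) (fun x => ?_)
        (Eventually.of_forall fun m x => ?_)
      · by_cases hxy : x = y
        · subst hxy
          simp [f]
        · rw [if_neg hxy]
          have h5 : f x < 1 := by
            have h6 : 0 < ((x : ℝ) - y) ^ 2 / (4 * R ^ 2) := by
              have : (x : ℝ) - y ≠ 0 := sub_ne_zero.2 fun e => hxy (Subtype.ext e)
              positivity
            simp only [f]; linarith
          have := ((tendsto_pow_atTop_nhds_zero_of_lt_one (hf x).1 h5).const_mul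
            (x : ℝ)).const_mul (e x)
          simpa using this
      · rw [Real.norm_eq_abs, abs_mul, abs_mul, abs_of_nonneg (pow_nonneg (hf x).1 m)]
        have h7 : |(x : ℝ)| * f x ^ m ≤ |(x : ℝ)| :=
          mul_le_of_le_one_right (abs_nonneg _) (pow_le_one₀ (hf x).1 (hf x).2)
        exact (mul_le_of_le_one_left (mul_nonneg (abs_nonneg _) (pow_nonneg (hf x).1 m))
          (he x)).trans h7
    rw [tsum_ite_eq] at hlim
    have hconst : ∀ m : ℕ, ∑' x : lattice q α β, e x * ((x : ℝ) * f x ^ m) = 0 := by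
      intro m
      rw [← hpoly ((1 - Polynomial.C (1 / (4 * R ^ 2)) *
        (Polynomial.X - Polynomial.C (y : ℝ)) ^ 2) ^ m)]
      refine tsum_congr fun x => ?_
      simp only [f, Polynomial.eval_pow, Polynomial.eval_sub, Polynomial.eval_mul,
        Polynomial.eval_one, Polynomial.eval_C, Polynomial.eval_X]
      ring
    simp only [hconst] at hlim
    have h8 := tendsto_nhds_unique hlim tendsto_const_nhds
    exact (mul_eq_zero.1 h8).resolve_right (lattice_ne_zero h y.2)
  refine funext fun y => ?_
  have := hzero y
  simp only [e] at this
  cases hx : X y <;> cases hy : Y y <;> simp [hx, hy] at this ⊢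

lemma dense_evalHom (h : Regular q α β s p) :
    (evalHom h).range.topologicalClosure = ⊤ := by
  refine ContinuousMap.subalgebra_topologicalClosure_eq_top_of_separatesPoints _ ?_
  intro X Y hXY
  by_contra! hcon
  refine hXY (eq_of_forall_evalAt_eq h fun F => ?_)
  exact hcon _ ⟨evalHom h F, ⟨F, rfl⟩, rfl⟩

/-- Two probability measures on configurations coincide if they give the same expectation to all
symmetric functions. -/
lemma measure_ext_of_evalAt (h : Regular q α β s p) {M M' : Measure (Config q α β)}
    [IsProbabilityMeasure M] [IsProbabilityMeasure M']
    (hMM : ∀ F : Sym, ∫ X, F.evalAt X ∂M = ∫ X, F.evalAt X ∂M') : M = M' := by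
  refine ext_of_forall_integral_eq_of_IsFiniteMeasure fun f => ?_
  have hint : ∀ (K : Measure (Config q α β)) [IsProbabilityMeasure K],
      Continuous fun g : C(Config q α β, ℝ) => ∫ X, g X ∂K := by
    intro K _
    have h1 : LipschitzWith 1 fun g : C(Config q α β, ℝ) => ∫ X, g X ∂K := by
      refine LipschitzWith.of_dist_le_mul fun g g' => ?_
      have hi : ∀ g : C(Config q α β, ℝ), Integrable g K := fun g =>
        (BoundedContinuousFunction.mkOfCompact g).integrable K
      rw [dist_eq_norm, ← integral_sub (hi g) (hi g')]
      refine (norm_integral_le_of_norm_le_const (C := dist g g')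
        (Eventually.of_forall fun X => ?_)).trans ?_
      · rw [← dist_eq_norm]; exact ContinuousMap.dist_apply_le_dist X
      · simp
    exact h1.continuous
  have hcl : IsClosed {g : C(Config q α β, ℝ) | ∫ X, g X ∂M = ∫ X, g X ∂M'} :=
    isClosed_eq (hint M) (hint M')
  have hsub : ((evalHom h).range : Set C(Config q α β, ℝ)) ⊆
      {g : C(Config q α β, ℝ) | ∫ X, g X ∂M = ∫ X, g X ∂M'} := by
    rintro _ ⟨F, rfl⟩
    exact hMM F
  have hall := closure_minimal hsub hcl
  rw [← Subalgebra.topologicalClosure_coe, dense_evalHom h] at hall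
  exact hall (show f.toContinuousMap ∈ _ from trivial)

end ConfigurationSpace

/-! ### The shifted weights as measures -/

section LevelMeasures

variable {q α β s p : ℝ} {γ δ : ℂ}

/-- The measure on the lattice with the weight `W(x; q, α, β, c, d)`. -/
def weightMeasure (q α β : ℝ) (c d : ℂ) : Measure (lattice q α β) :=
  Measure.sum fun x : lattice q α β => ENNReal.ofReal (weight q α β c d x) • Measure.dirac x

lemma weightMeasure_singleton (q α β : ℝ) (c d : ℂ) (x : lattice q α β) :
    weightMeasure q α β c d {x} = ENNReal.ofReal (weight q α β c d x) := by
  unfold weightMeasure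
  rw [Measure.sum_apply _ (measurableSet_singleton x), tsum_eq_single x]
  · simp
  · intro y hy
    simp [hy]

lemma isFiniteMeasure_weightMeasure {c d : ℂ} (h : Regular q α β s p) (hs : c + d = s)
    (hp : c * d = p) : IsFiniteMeasure (weightMeasure q α β c d) := by
  refine ⟨?_⟩
  unfold weightMeasure
  rw [Measure.sum_apply _ MeasurableSet.univ]
  simpa using (summable_weight h hs hp).tsum_ofReal_lt_top

lemma integral_weightMeasure {c d : ℂ} (h : Regular q α β s p) (hs : c + d = s)
    (hp : c * d = p) (f : Polynomial ℝ) :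
    ∫ x, f.eval (x : ℝ) ∂(weightMeasure q α β c d) = weightFunctional h hs hp f := by
  have := isFiniteMeasure_weightMeasure h hs hp
  obtain ⟨B, hB⟩ := exists_polynomial_bound h f
  rw [integral_countable (integrable_of_abs_le (B := B) fun x => hB x), weightFunctional_apply]
  refine tsum_congr fun x => ?_
  rw [Measure.real, weightMeasure_singleton,
    ENNReal.toReal_ofReal (weight_pos h hs hp x.2).le, smul_eq_mul, mul_comm]

/-- The measure on the lattice with the weight `W(x; q, α, β, γ q^{1-N}, δ q^{1-N})`. -/
def shiftedMeasure (q α β : ℝ) (γ δ : ℂ) (N : ℕ) : Measure (lattice q α β) :=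
  weightMeasure q α β (γ * (q : ℂ) ^ (1 - (N : ℤ))) (δ * (q : ℂ) ^ (1 - (N : ℤ)))

lemma integral_shiftedMeasure (h : Regular q α β s p) (hs : γ + δ = s) (hp : γ * δ = p) (N : ℕ)
    (f g : Polynomial ℝ) :
    ∫ x : lattice q α β, f.eval (x : ℝ) * g.eval (x : ℝ) ∂(shiftedMeasure q α β γ δ N) =
      shiftedFunctional h hs hp N (f * g) := by
  rw [shiftedFunctional, ← integral_weightMeasure]
  simp only [Polynomial.eval_mul, shiftedMeasure]

/-- The polynomials with shifted parameters are orthogonal for the shifted weights. -/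
lemma shifted_isOrthogonalModel (h : Regular q α β s p) (hs : γ + δ = s) (hp : γ * δ = p) :
    IsOrthogonalModel (Subtype.val : lattice q α β → ℝ) (shiftedMeasure q α β γ δ)
      (shiftedPoly q α β γ δ) (shiftedA q α β s p) where
  isFiniteMeasure N :=
    isFiniteMeasure_weightMeasure (h.scale (1 - (N : ℤ))) (scaled_add hs _) (scaled_mul hp _)
  bounded := by
    obtain ⟨R, -, hR⟩ := exists_lattice_bound h
    exact ⟨R, fun x => hR x x.2⟩
  orth N i j hij := by
    rw [integral_shiftedMeasure h hs hp]
    have hst := shifted_isStable h hs hp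
    rcases lt_or_ge ((N : ℤ) + i) 0 with hi | hi
    · rw [hst.zero_of_neg N i hi, zero_mul, map_zero]
    rcases lt_or_ge ((N : ℤ) + j) 0 with hj | hj
    · rw [hst.zero_of_neg N j hj, mul_zero, map_zero]
    obtain ⟨n, hn⟩ := Int.eq_ofNat_of_zero_le hi
    obtain ⟨m, hm⟩ := Int.eq_ofNat_of_zero_le hj
    rw [shiftedPoly_natCast hn, shiftedPoly_natCast hm]
    exact (shifted_isOPS h hs hp N).toIsMonicOPS.orth_ne (by omega)
  norm_pos N j hj := by
    rw [integral_shiftedMeasure h hs hp]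
    exact (shifted_isOPS h hs hp N).pos _ ((shifted_isStable h hs hp).monic N j hj).ne_zero
  norm_ratio N j hj := by
    rw [integral_shiftedMeasure h hs hp, integral_shiftedMeasure h hs hp,
      ← shifted_norm_ratio h hs hp N j hj, div_mul_cancel₀]
    exact ((shifted_isOPS h hs hp N).pos _
      ((shifted_isStable h hs hp).monic N (j - 1) (by omega)).ne_zero).ne'

end LevelMeasures

/-! ### The big `q`-Jacobi symmetric functions -/

section LimitFunctions

variable {q α β s p : ℝ} {γ δ : ℂ}

/-- The coefficient map of the big `q`-Jacobi symmetric functions with shifted parameters. -/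
def bigFock (h : Regular q α β s p) (hs : γ + δ = s) (hp : γ * δ = p) :
    Sym →ₗ[ℝ] YoungDiagram → ℝ :=
  (shifted_isOrthogonalModel h hs hp).fock (shifted_isStable h hs hp)

lemma multiBigQJacobi_mul (h : Regular q α β s p) (hs : γ + δ = s) (hp : γ * δ = p) (N : ℕ)
    (ν : YoungDiagram) :
    multiBigQJacobi q α β (γ * (q : ℂ) ^ (1 - (N : ℤ))) (δ * (q : ℂ) ^ (1 - (N : ℤ))) N ν *
      vandermondeProd N = alternant (shiftedPoly q α β γ δ) N (wordOf ν) := by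
  obtain ⟨L, -, hL⟩ := (shifted_isStable h hs hp).exists_proj_mul_eq_alternant N ν
  have hex : ∃ F, F * vandermondeProd N =
      altNumerator q α β (γ * (q : ℂ) ^ (1 - (N : ℤ))) (δ * (q : ℂ) ^ (1 - (N : ℤ))) N ν :=
    ⟨_, hL.trans (altNumerator_eq q α β γ δ N ν).symm⟩
  unfold multiBigQJacobi
  rw [dif_pos hex, hex.choose_spec, altNumerator_eq]

open Classical in
lemma bigFock_of_converges (h : Regular q α β s p) (hs : γ + δ = s) (hp : γ * δ = p)
    {ν : YoungDiagram} {F : Sym} (hF : Sym.Converges (fun N => multiBigQJacobi q α β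
      (γ * (q : ℂ) ^ (1 - (N : ℤ))) (δ * (q : ℂ) ^ (1 - (N : ℤ))) N ν) F) :
    bigFock h hs hp F = Pi.single ν 1 := by
  obtain ⟨d, L, hL, hFd, hlim⟩ := hF
  have hm := shifted_isOrthogonalModel h hs hp
  have hst := shifted_isStable h hs hp
  ext ν'
  have h1 : Tendsto (fun N => levelCoeff Subtype.val (shiftedMeasure q α β γ δ)
      (shiftedPoly q α β γ δ) N ν' (L N)) atTop (𝓝 (bigFock h hs hp F ν')) := by
    have h2 : Tendsto (fun N => ∑ m ∈ monomialsLE d, (L N).coeff m *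
        levelCoeff Subtype.val (shiftedMeasure q α β γ δ) (shiftedPoly q α β γ δ) N ν'
          (MvPolynomial.monomial m 1)) atTop
        (𝓝 (∑ m ∈ monomialsLE d, F.coeff m *
          bigFock h hs hp (MvPolynomial.monomial m 1) ν')) :=
      tendsto_finsetSum _ fun m _ => (hlim m).mul (hm.tendsto_fock hst ν' _)
    have h3 : ∑ m ∈ monomialsLE d, F.coeff m * bigFock h hs hp (MvPolynomial.monomial m 1) ν' =
        bigFock h hs hp F ν' := by
      conv_rhs => rw [eq_sum_monomialsLE hFd]
      rw [map_sum, Finset.sum_apply]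
      exact Finset.sum_congr rfl fun m _ => by rw [map_smul, Pi.smul_apply, smul_eq_mul]
    rw [← h3]
    refine h2.congr' ?_
    filter_upwards [hL] with N hN
    conv_rhs => rw [eq_sum_monomialsLE hN.1]
    rw [hm.levelCoeff_sum]
    exact Finset.sum_congr rfl fun m _ => (levelCoeff_smul _ _ _ _).symm
  refine tendsto_nhds_unique h1 (tendsto_const_nhds.congr' ?_)
  filter_upwards [hL, eventually_ge_atTop (ν.colLen 0), eventually_ge_atTop (ν'.colLen 0)]
    with N hN hν hν'
  unfold levelCoeff
  rw [hN.2, hst.alternant_bot, multiBigQJacobi_mul h hs hp]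
  rcases eq_or_ne ν' ν with rfl | hne
  · rw [div_self (hm.evalForm_alternant_self_pos N _).ne', Pi.single_eq_same]
  · rw [hm.evalForm_alternant_ne hne.symm hν hν', zero_div, Pi.single_eq_of_ne hne]

open Classical in
/-- The big `q`-Jacobi symmetric polynomials with shifted parameters converge: in the basis of
`Sym` dual to the limiting coefficients, their coordinates form the inverse of a matrix that tends
to the identity. -/
lemma exists_converges (h : Regular q α β s p) (hs : γ + δ = s) (hp : γ * δ = p)
    (ν : YoungDiagram) : ∃ F : Sym, Sym.Converges (fun N => multiBigQJacobi q α β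
      (γ * (q : ℂ) ^ (1 - (N : ℤ))) (δ * (q : ℂ) ^ (1 - (N : ℤ))) N ν) F := by
  have hm := shifted_isOrthogonalModel h hs hp
  have hst := shifted_isStable h hs hp
  choose B hB hB' using hm.exists_fock_eq_single hst
  set d := ν.card with hd
  let ν₀ : partitionsLE d := ⟨ν, mem_partitionsLE.2 hd.ge⟩
  let A : ℕ → Matrix (partitionsLE d) (partitionsLE d) ℝ := fun N =>
    Matrix.of fun κ κ' => levelCoeff Subtype.val (shiftedMeasure q α β γ δ)
      (shiftedPoly q α β γ δ) N κ' (B κ)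
  have hA : Tendsto A atTop (𝓝 1) := by
    refine tendsto_pi_nhds.2 fun κ => tendsto_pi_nhds.2 fun κ' => ?_
    have h1 := hm.tendsto_fock hst κ' (B κ)
    rw [hB', Pi.single_apply] at h1
    rw [Matrix.one_apply]
    have h2 : (if κ = κ' then (1 : ℝ) else 0) = if (κ' : YoungDiagram) = κ then 1 else 0 := by
      simp only [Subtype.ext_iff, eq_comm]
    rw [h2]
    exact h1
  have hdet : Tendsto (fun N => (A N).det) atTop (𝓝 1) := by
    have := ((continuous_id.matrix_det (n := partitionsLE d) (R := ℝ)).tendsto 1).comp hA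
    simpa [Function.comp_def] using this
  have hadj : Tendsto (fun N => (A N).adjugate) atTop (𝓝 1) := by
    have := ((continuous_id.matrix_adjugate (n := partitionsLE d) (R := ℝ)).tendsto 1).comp hA
    simpa [Function.comp_def] using this
  let c : ℕ → partitionsLE d → ℝ := fun N κ => (A N).det⁻¹ * (A N).adjugate ν₀ κ
  have hc : ∀ κ, Tendsto (fun N => c N κ) atTop (𝓝 (if ν₀ = κ then 1 else 0)) := by
    intro κ
    have h1 := (hdet.inv₀ one_ne_zero).mul (tendsto_pi_nhds.1 (tendsto_pi_nhds.1 hadj ν₀) κ)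
    rwa [Matrix.one_apply, inv_one, one_mul] at h1
  refine ⟨B ν, d, fun N => ∑ κ, c N κ • B κ, ?_, hB ν, fun m => ?_⟩
  · have h1 : ∀ᶠ N in atTop, ∀ κ ∈ partitionsLE d, Sym.proj N (B κ) *
        alternant (shiftedPoly q α β γ δ) N (wordOf ⊥) = ∑ κ' ∈ partitionsLE d,
          MvPolynomial.C (levelCoeff Subtype.val (shiftedMeasure q α β γ δ)
            (shiftedPoly q α β γ δ) N κ' (B κ)) * alternant (shiftedPoly q α β γ δ) N (wordOf κ') :=
      (Finset.eventually_all _).2 fun κ hκ =>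
        hm.eventually_expansion hst ((hB κ).trans (mem_partitionsLE.1 hκ))
    filter_upwards [h1, hdet.eventually_ne one_ne_zero] with N hN hdetN
    refine ⟨degree_sum_smul_le _ _ _ fun κ _ => (hB κ).trans (mem_partitionsLE.1 κ.2), ?_⟩
    refine mul_right_cancel₀ (vandermondeProd_ne_zero N) ?_
    rw [multiBigQJacobi_mul h hs hp, ← hst.alternant_bot, map_sum, Finset.sum_mul]
    have h2 : ∀ κ : partitionsLE d, Sym.proj N (c N κ • B κ) *
        alternant (shiftedPoly q α β γ δ) N (wordOf ⊥) = ∑ κ' : partitionsLE d,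
          MvPolynomial.C (c N κ * A N κ κ') * alternant (shiftedPoly q α β γ δ) N (wordOf κ') := by
      intro κ
      rw [map_smul, smul_mul_assoc, hN κ κ.2, Finset.smul_sum,
        ← Finset.sum_coe_sort]
      refine Finset.sum_congr rfl fun κ' _ => ?_
      rw [MvPolynomial.smul_eq_C_mul, map_mul MvPolynomial.C (c N κ) (A N κ κ'), mul_assoc]
      rfl
    rw [Finset.sum_congr rfl fun κ _ => h2 κ, Finset.sum_comm]
    have h3 : ∀ κ' : partitionsLE d, ∑ κ, c N κ * A N κ κ' = if ν₀ = κ' then 1 else 0 := by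
      intro κ'
      have h4 := congrFun (congrFun (Matrix.adjugate_mul (A N)) ν₀) κ'
      rw [Matrix.mul_apply, Matrix.smul_apply, Matrix.one_apply, smul_eq_mul] at h4
      simp only [c, mul_assoc]
      rw [← Finset.mul_sum, h4, ← mul_assoc, inv_mul_cancel₀ hdetN, one_mul]
    simp only [← Finset.sum_mul, ← map_sum, h3]
    rw [Finset.sum_eq_single ν₀]
    · simp [ν₀]
    · intro κ _ hne
      rw [if_neg hne.symm, map_zero, zero_mul]
    · simp
  · have h1 : Tendsto (fun N => ∑ κ : partitionsLE d, c N κ * (B κ).coeff m) atTop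
        (𝓝 (∑ κ : partitionsLE d, (if ν₀ = κ then 1 else 0) * (B κ).coeff m)) :=
      tendsto_finsetSum _ fun κ _ => (hc κ).mul_const _
    simp only [ite_mul, one_mul, zero_mul, Finset.sum_ite_eq, Finset.mem_univ, if_true] at h1
    refine h1.congr fun N => ?_
    rw [MvPolynomial.coeff_sum]
    simp only [MvPolynomial.coeff_smul, smul_eq_mul]

open Classical in
lemma bigFock_Phi (h : Regular q α β s p) (hs : γ + δ = s) (hp : γ * δ = p) (ν : YoungDiagram) :
    bigFock h hs hp (Phi q α β γ δ ν) = Pi.single ν 1 := by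
  have hex := exists_converges h hs hp ν
  unfold Phi
  rw [dif_pos hex]
  exact bigFock_of_converges h hs hp hex.choose_spec

lemma bigFock_injective (h : Regular q α β s p) (hs : γ + δ = s) (hp : γ * δ = p) :
    Function.Injective (bigFock h hs hp) :=
  (shifted_isOrthogonalModel h hs hp).fock_injective _

/-- Every symmetric function is a combination of the functions `Φ_ν`. -/
lemma eq_sum_Phi (h : Regular q α β s p) (hs : γ + δ = s) (hp : γ * δ = p) (F : Sym) :
    F = ∑ ν ∈ partitionsLE F.degree, bigFock h hs hp F ν • Phi q α β γ δ ν := by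
  classical
  refine bigFock_injective h hs hp ?_
  rw [map_sum]
  ext ν
  rw [Finset.sum_apply]
  simp only [map_smul, bigFock_Phi, Pi.smul_apply, Pi.single_apply, smul_eq_mul, mul_ite, mul_one,
    mul_zero, Finset.sum_ite_eq]
  split_ifs with hν
  · rfl
  · exact (shifted_isOrthogonalModel h hs hp).fock_eq_zero _ le_rfl
      (not_le.1 fun hle => hν (mem_partitionsLE.2 hle))

lemma Phi_bot (h : Regular q α β s p) (hs : γ + δ = s) (hp : γ * δ = p) :
    Phi q α β γ δ ⊥ = 1 := by
  classical
  refine bigFock_injective h hs hp ?_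
  rw [bigFock_Phi]
  have hm := shifted_isOrthogonalModel h hs hp
  ext ν
  refine tendsto_nhds_unique (tendsto_const_nhds.congr' ?_)
    (hm.tendsto_fock (shifted_isStable h hs hp) ν 1)
  filter_upwards [eventually_ge_atTop (ν.colLen 0), eventually_ge_atTop
    ((⊥ : YoungDiagram).colLen 0)] with N hν hbot
  unfold levelCoeff
  rw [map_one, one_mul]
  rcases eq_or_ne ν ⊥ with rfl | hne
  · rw [div_self (hm.evalForm_alternant_self_pos N _).ne', Pi.single_eq_same]
  · rw [hm.evalForm_alternant_ne hne.symm hbot hν, zero_div, Pi.single_eq_of_ne hne]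

end LimitFunctions

/-! ### Bounds for gap probabilities -/

section HoleBound

variable {T : Type*} [MeasurableSpace T] {v : T → ℝ} {μ : ℕ → Measure T}
  {P : ℕ → ℤ → Polynomial ℝ} {q : ℝ} {a b : ℕ → ℤ → ℝ} {a' b' : ℤ → ℝ}

lemma abs_indicator_one_le {T : Type*} (B : Set T) (t : T) :
    |B.indicator (1 : T → ℝ) t| ≤ 1 := by
  by_cases ht : t ∈ B <;> simp [ht]

/-- The share of the squared norm of `P N j` that is carried by the set `B`. -/
def mass (v : T → ℝ) (μ : ℕ → Measure T) (P : ℕ → ℤ → Polynomial ℝ) (B : Set T) (N : ℕ) (j : ℤ) :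
    ℝ :=
  (∫ t, B.indicator 1 t * ((P N j).eval (v t) * (P N j).eval (v t)) ∂(μ N)) /
    ∫ t, (P N j).eval (v t) * (P N j).eval (v t) ∂(μ N)

lemma mass_nonneg (B : Set T) (N : ℕ) (j : ℤ) : 0 ≤ mass v μ P B N j := by
  refine div_nonneg (integral_nonneg fun t => ?_) (integral_nonneg fun t => mul_self_nonneg _)
  exact mul_nonneg (Set.indicator_nonneg (fun _ _ => zero_le_one) t) (mul_self_nonneg _)

variable [Countable T] [DiscreteMeasurableSpace T]

namespace IsOrthogonalModel

variable (hm : IsOrthogonalModel v μ P a)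
include hm

lemma integrable_bounded_mul {φ : T → ℝ} (hφ : ∀ t, |φ t| ≤ 1) (N : ℕ) (f g : Polynomial ℝ) :
    Integrable (fun t => φ t * (f.eval (v t) * g.eval (v t))) (μ N) := by
  have := hm.isFiniteMeasure
  refine (hm.integrable_polynomial_mul N f g).bdd_mul (c := 1)
    (Measurable.of_discrete).aestronglyMeasurable (Eventually.of_forall hφ)

/-- The expectation of `∏ φ(x_i)`, where `φ` is `1/2` on `B` and `1` off `B`, is the determinant of
a compression of the operator of multiplication by `φ`. It is small if many of the orthogonal
polynomials have much of their mass on `B`. -/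
lemma integral_prod_le (B : Set T) (N : ℕ) :
    (∫ t : Fin N → T, (∏ i, (1 - B.indicator 1 (t i) / 2)) *
        (MvPolynomial.eval (v ∘ t) (alternant P N (wordOf ⊥))) ^ 2 ∂(Measure.pi fun _ => μ N)) /
      evalForm v μ N (alternant P N (wordOf ⊥)) (alternant P N (wordOf ⊥)) ≤
    Real.exp (-(∑ i ∈ Finset.range N, mass v μ P B N (wordOf ⊥ i)) / 2) := by
  have := hm.isFiniteMeasure
  set w := wordOf ⊥ with hw
  let φ : T → ℝ := fun t => 1 - B.indicator 1 t / 2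
  have hφ : ∀ t, 0 ≤ φ t ∧ |φ t| ≤ 1 := by
    intro t
    by_cases ht : t ∈ B <;> norm_num [φ, ht]
  let h : Fin N → ℝ := fun i => ∫ t, (P N (w i)).eval (v t) * (P N (w i)).eval (v t) ∂(μ N)
  have hpos : ∀ i, 0 < h i := fun i => hm.norm_pos N _ (by
    have := i.2
    rw [hw]; unfold wordOf; omega)
  let A : Matrix (Fin N) (Fin N) ℝ := Matrix.of fun i j =>
    ∫ t, φ t * (P N (w i)).eval (v t) * (P N (w j)).eval (v t) ∂(μ N)
  have hint : ∀ f g : Polynomial ℝ,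
      Integrable (fun t => φ t * f.eval (v t) * g.eval (v t)) (μ N) := fun f g => by
    simpa only [mul_assoc] using hm.integrable_bounded_mul (fun t => (hφ t).2) N f g
  have hnum : ∫ t : Fin N → T, (∏ i, (1 - B.indicator 1 (t i) / 2)) *
      (MvPolynomial.eval (v ∘ t) (alternant P N w)) ^ 2 ∂(Measure.pi fun _ => μ N) =
      N.factorial * A.det := by
    rw [← integral_det_mul_det (fun (i : Fin N) t => φ t * (P N (w i)).eval (v t))
      (fun (i : Fin N) t => (P N (w i)).eval (v t)) fun i j => hint _ _]
    refine integral_congr_ae (Eventually.of_forall fun t => ?_)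
    simp only
    rw [eval_alternant, sq, ← mul_assoc]
    congr 1
    have := Matrix.det_mul_row (fun j => φ (t j))
      (Matrix.of fun i j : Fin N => (P N (w i)).eval (v (t j)))
    exact this.symm
  rw [hnum, hm.evalForm_alternant_self, mul_div_mul_left _ _ (by positivity),
    ← Fin.prod_univ_eq_prod_range (fun i => ∫ t, (P N (wordOf ⊥ i)).eval (v t) *
      (P N (wordOf ⊥ i)).eval (v t) ∂(μ N)), ← Fin.sum_univ_eq_sum_range
      (fun i => mass v μ P B N (w i))]
  let r : Fin N → ℝ := fun i => (√(h i))⁻¹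
  have hr : ∀ i, r i * r i = (h i)⁻¹ := fun i => by
    simp only [r]
    rw [← mul_inv, Real.mul_self_sqrt (hpos i).le]
  let G : Matrix (Fin N) (Fin N) ℝ := Matrix.of fun i j => r i * (r j * A i j)
  have hdet : G.det = A.det / ∏ i, h i := by
    have h1 : G.det = (∏ i, r i) * ((∏ i, r i) * A.det) := by
      rw [← Matrix.det_mul_row, ← Matrix.det_mul_column]
      rfl
    rw [h1, ← mul_assoc, ← Finset.prod_mul_distrib, Finset.prod_congr rfl fun i _ => hr i,
      Finset.prod_inv_distrib, div_eq_inv_mul]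
  have hpsd : G.PosSemidef := by
    refine Matrix.PosSemidef.of_dotProduct_mulVec_nonneg ?_ fun x => ?_
    · ext i j
      simp only [G, A, Matrix.conjTranspose_apply, Matrix.of_apply, star_trivial]
      rw [mul_left_comm]
      congr 2
      exact integral_congr_ae (Eventually.of_forall fun t => by simp only; ring)
    · let f : Polynomial ℝ := ∑ i, Polynomial.C (x i * r i) * P N (w i)
      have h2 : star x ⬝ᵥ G.mulVec x = ∫ t, φ t * f.eval (v t) * f.eval (v t) ∂(μ N) := by
        have h3 : ∀ t, φ t * f.eval (v t) * f.eval (v t) = ∑ i, ∑ j,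
            (x i * r i * (x j * r j)) *
              (φ t * (P N (w i)).eval (v t) * (P N (w j)).eval (v t)) := by
          intro t
          simp only [f, Polynomial.eval_finsetSum, Polynomial.eval_mul, Polynomial.eval_C]
          rw [mul_assoc, Finset.sum_mul_sum, Finset.mul_sum]
          refine Finset.sum_congr rfl fun i _ => ?_
          rw [Finset.mul_sum]
          exact Finset.sum_congr rfl fun j _ => by ring
        simp only [h3]
        rw [integral_finsetSum _ fun i _ => integrable_finsetSum _ fun j _ =>
          (hint _ _).const_mul _]
        simp only [dotProduct, Matrix.mulVec, star_trivial]
        refine Finset.sum_congr rfl fun i _ => ?_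
        rw [integral_finsetSum _ fun j _ => (hint _ _).const_mul _, Finset.mul_sum]
        refine Finset.sum_congr rfl fun j _ => ?_
        rw [integral_const_mul]
        simp only [G, A, Matrix.of_apply]
        ring
      rw [h2]
      refine integral_nonneg fun t => ?_
      simp only [Pi.zero_apply, mul_assoc]
      exact mul_nonneg (hφ t).1 (mul_self_nonneg _)
  have hdiag : ∀ i, G i i = 1 - mass v μ P B N (w i) / 2 := by
    intro i
    have h4 : A i i = h i - (∫ t, B.indicator 1 t *
        ((P N (w i)).eval (v t) * (P N (w i)).eval (v t)) ∂(μ N)) / 2 := by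
      rw [← integral_div, ← integral_sub (hm.integrable_polynomial_mul N _ _)
        ((hm.integrable_bounded_mul (abs_indicator_one_le B) N _ _).div_const _)]
      refine integral_congr_ae (Eventually.of_forall fun t => ?_)
      simp only [φ]
      ring
    simp only [G, Matrix.of_apply]
    rw [← mul_assoc, hr, h4, mass]
    change (h i)⁻¹ * (h i - _) = 1 - _ / h i / 2
    have := (hpos i).ne'
    field_simp
  have htr : G.trace - N = -(∑ i : Fin N, mass v μ P B N (w i)) / 2 := by
    rw [Matrix.trace]
    simp only [Matrix.diag_apply, hdiag, Finset.sum_sub_distrib, Finset.sum_const, Finset.card_univ,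
      Fintype.card_fin, nsmul_eq_mul, mul_one, ← Finset.sum_div]
    ring
  rw [← htr]
  change A.det / ∏ i, h i ≤ _
  rw [← hdet]
  exact det_le_exp_trace hpsd

variable (hs : IsStableFamily q P a b a' b')
include hs

/-- The second moment of `P_j²` is at least the recurrence coefficient `a_j`. -/
lemma le_secondMoment {N : ℕ} {j : ℤ} (hj : 0 < (N : ℤ) + j) :
    a N j * ∫ t, (P N j).eval (v t) * (P N j).eval (v t) ∂(μ N) ≤
      ∫ t, v t ^ 2 * ((P N j).eval (v t) * (P N j).eval (v t)) ∂(μ N) := by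
  have h0 := hm.norm_pos N j hj.le
  have h1 := hm.norm_pos N (j - 1) (by omega)
  have hr := hm.norm_ratio N j hj
  have key : ∫ t, v t ^ 2 * ((P N j).eval (v t) * (P N j).eval (v t)) ∂(μ N) =
      (∫ t, (P N (j + 1)).eval (v t) * (P N (j + 1)).eval (v t) ∂(μ N)) +
      (b N j) ^ 2 * (∫ t, (P N j).eval (v t) * (P N j).eval (v t) ∂(μ N)) +
      (a N j) ^ 2 * ∫ t, (P N (j - 1)).eval (v t) * (P N (j - 1)).eval (v t) ∂(μ N) := by
    have e : ∀ t, v t ^ 2 * ((P N j).eval (v t) * (P N j).eval (v t)) =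
        ((P N (j + 1)).eval (v t) * (P N (j + 1)).eval (v t) +
        (b N j) ^ 2 * ((P N j).eval (v t) * (P N j).eval (v t)) +
        (a N j) ^ 2 * ((P N (j - 1)).eval (v t) * (P N (j - 1)).eval (v t))) +
        (2 * b N j * ((P N (j + 1)).eval (v t) * (P N j).eval (v t)) +
        2 * a N j * ((P N (j + 1)).eval (v t) * (P N (j - 1)).eval (v t)) +
        2 * a N j * b N j * ((P N j).eval (v t) * (P N (j - 1)).eval (v t))) := by
      intro t
      have := congrArg (Polynomial.eval (v t)) (hs.three_term N j hj.le)
      simp only [Polynomial.eval_add, Polynomial.eval_mul, Polynomial.eval_X,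
        Polynomial.eval_C] at this
      rw [show v t ^ 2 * ((P N j).eval (v t) * (P N j).eval (v t)) =
        (v t * (P N j).eval (v t)) ^ 2 by ring, this]
      ring
    have hi := fun i k => hm.integrable_polynomial_mul N (P N i) (P N k)
    simp only [e]
    have ad : ∀ {f g : T → ℝ}, Integrable f (μ N) → Integrable g (μ N) →
        Integrable (fun t => f t + g t) (μ N) := fun hf hg => hf.add hg
    rw [integral_add (ad (ad (hi _ _) ((hi _ _).const_mul _)) ((hi _ _).const_mul _))
      (ad (ad ((hi _ _).const_mul _) ((hi _ _).const_mul _)) ((hi _ _).const_mul _)),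
      integral_add (ad (hi _ _) ((hi _ _).const_mul _)) ((hi _ _).const_mul _),
      integral_add (hi _ _) ((hi _ _).const_mul _),
      integral_add (ad ((hi _ _).const_mul _) ((hi _ _).const_mul _)) ((hi _ _).const_mul _),
      integral_add ((hi _ _).const_mul _) ((hi _ _).const_mul _)]
    simp only [integral_const_mul]
    rw [hm.orth N (j + 1) j (by omega), hm.orth N (j + 1) (j - 1) (by omega),
      hm.orth N j (j - 1) (by omega)]
    ring
  have h2 : 0 ≤ ∫ t, (P N (j + 1)).eval (v t) * (P N (j + 1)).eval (v t) ∂(μ N) :=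
    integral_nonneg fun t => mul_self_nonneg _
  rw [key]
  have h3 : (a N j) ^ 2 * ∫ t, (P N (j - 1)).eval (v t) * (P N (j - 1)).eval (v t) ∂(μ N) =
      a N j * ∫ t, (P N j).eval (v t) * (P N j).eval (v t) ∂(μ N) := by
    rw [hr]; ring
  rw [h3]
  nlinarith [mul_nonneg (sq_nonneg (b N j)) h0.le]

lemma moment_eq_powCoeff {N : ℕ} {j : ℤ} (hj : 0 ≤ (N : ℤ) + j) (k : ℕ) :
    ∫ t, v t ^ k * ((P N j).eval (v t) * (P N j).eval (v t)) ∂(μ N) =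
      powCoeff (a N) (b N) k j 0 * ∫ t, (P N j).eval (v t) * (P N j).eval (v t) ∂(μ N) := by
  have e : ∀ t, v t ^ k * ((P N j).eval (v t) * (P N j).eval (v t)) =
      ∑ r ∈ Finset.Icc (-(k : ℤ)) k, powCoeff (a N) (b N) k j r *
        ((P N (j + r)).eval (v t) * (P N j).eval (v t)) := by
    intro t
    have := congrArg (Polynomial.eval (v t)) (hs.X_pow_mul N k hj)
    simp only [Polynomial.eval_finsetSum, Polynomial.eval_mul, Polynomial.eval_pow,
      Polynomial.eval_X, Polynomial.eval_C] at this
    rw [← mul_assoc, this, Finset.sum_mul]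
    exact Finset.sum_congr rfl fun r _ => by ring
  simp only [e]
  rw [integral_finsetSum _ fun r _ => (hm.integrable_polynomial_mul N _ _).const_mul _]
  simp only [integral_const_mul]
  rw [Finset.sum_eq_single 0]
  · rw [add_zero]
  · intro r _ hr
    rw [hm.orth N _ _ (by omega), mul_zero]
  · intro h
    exact absurd (Finset.mem_Icc.2 ⟨by omega, by omega⟩) h

/-- The polynomials `P_j` with `j < 0` live at the scale `q^{-j}`: their second moments are of order
`q^{-2j}`, and their fourth moments at most of order `q^{-4j}`. Hence each of them has at least a
fixed amount of mass off any sufficiently small neighbourhood of the origin, and the total mass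
off small neighbourhoods is unbounded. -/
lemma exists_mass_ge : ∃ η : ℝ, 0 < η ∧ ∀ m : ℕ, ∃ ε : ℝ, 0 < ε ∧
    ∀ B : Set T, (∀ t, ε ≤ |v t| → t ∈ B) →
      ∀ᶠ N in atTop, m * η ≤ ∑ i ∈ Finset.range N, mass v μ P B N (wordOf ⊥ i) := by
  obtain ⟨c, hc, hlow⟩ := hs.lower
  obtain ⟨C, hC, hup⟩ := hs.exists_powCoeff_diag_le 4
  have hq := hs.q_pos
  let τ := c / (2 * (C + 1))
  have hτ : 0 < τ := by positivity
  have hτC : τ * C ≤ c / 2 := by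
    have : τ * (C + 1) = c / 2 := by simp only [τ]; field_simp
    nlinarith
  refine ⟨τ * c / 4, by positivity, fun m => ?_⟩
  let κ := min 1 (c / 8)
  have hκ : 0 < κ := lt_min one_pos (by positivity)
  have hκ2 : κ ^ 2 ≤ c / 8 := by
    have h1 : κ ≤ 1 := min_le_left _ _
    have h2 : κ ≤ c / 8 := min_le_right _ _
    nlinarith
  refine ⟨κ * q ^ (m + 5), by positivity, fun B hB => ?_⟩
  set ε := κ * q ^ (m + 5) with hε
  have hone : ∀ i ∈ Finset.Ico 4 (m + 4), ∀ᶠ N : ℕ in atTop,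
      τ * c / 4 ≤ mass v μ P B N (wordOf ⊥ i) := by
    intro i hi
    have hi := Finset.mem_Ico.1 hi
    have hw : wordOf ⊥ i = -1 - (i : ℤ) :=
      isWord_wordOf (m := 0) (by rw [YoungDiagram.colLen_eq_card]; simp [YoungDiagram.col]) i
        (Nat.zero_le i)
    rw [hw]
    set j : ℤ := -1 - (i : ℤ) with hj
    set Q : ℝ := q ^ (-j) with hQ
    have hQpos : 0 < Q := zpow_pos hq _
    have hQε : q ^ (m + 5) ≤ Q := by
      rw [hQ, show -j = ((i + 1 : ℕ) : ℤ) by push_cast; omega, zpow_natCast]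
      exact pow_le_pow_of_le_one hq.le hs.q_lt_one.le (by omega)
    have hεQ : ε ^ 2 ≤ c / 8 * Q ^ 2 := by
      rw [hε, mul_pow]
      exact mul_le_mul hκ2 (pow_le_pow_left₀ (by positivity) hQε 2) (by positivity) (by positivity)
    have hlim : ∀ᶠ N in atTop, c / 2 * Q ^ 2 < a N j := by
      refine (hs.tendsto_a j).eventually_const_lt ?_
      have := hlow j (by omega)
      nlinarith [mul_pos hc (pow_pos hQpos 2)]
    have hN : ∀ᶠ N : ℕ in atTop, 0 < (N : ℤ) + j := by
      filter_upwards [eventually_gt_atTop (i + 1)] with N hN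
      omega
    filter_upwards [hlim, hN] with N haN hN
    have hpos := hm.norm_pos N j hN.le
    set H := ∫ t, (P N j).eval (v t) * (P N j).eval (v t) ∂(μ N) with hH
    have h2 := hm.le_secondMoment hs hN
    have h4 := hm.moment_eq_powCoeff hs hN.le 4
    have h4' := (abs_le.1 (hup N j (by push_cast; omega))).2
    -- The test function `2 s x² - s² x⁴ - 2 s ε²` lies below the indicator function of `B`, because
    -- `2 s x² - s² x⁴ = 1 - (1 - s x²)²`; its scale `s` is adapted to `P_j`.
    set s := τ / Q ^ 2 with hs'
    have hspos : 0 < s := by positivity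
    have hsQ : s * Q ^ 2 = τ := by rw [hs']; field_simp
    have hpt : ∀ t, 2 * s * (v t ^ 2 * ((P N j).eval (v t) * (P N j).eval (v t))) -
        s ^ 2 * (v t ^ 4 * ((P N j).eval (v t) * (P N j).eval (v t))) -
        2 * s * ε ^ 2 * ((P N j).eval (v t) * (P N j).eval (v t)) ≤
        B.indicator 1 t * ((P N j).eval (v t) * (P N j).eval (v t)) := by
      intro t
      have h5 : 2 * s * v t ^ 2 - s ^ 2 * v t ^ 4 - 2 * s * ε ^ 2 ≤ B.indicator 1 t := by
        by_cases ht : t ∈ B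
        · rw [Set.indicator_of_mem ht, Pi.one_apply]
          nlinarith [sq_nonneg (1 - s * v t ^ 2), mul_nonneg hspos.le (sq_nonneg ε)]
        · rw [Set.indicator_of_notMem ht]
          have h6 : |v t| < ε := not_le.1 fun h => ht (hB t h)
          have h7 : v t ^ 2 ≤ ε ^ 2 := by
            rw [← sq_abs]
            exact pow_le_pow_left₀ (abs_nonneg _) h6.le 2
          nlinarith [mul_le_mul_of_nonneg_left h7 hspos.le, sq_nonneg (s * v t ^ 2)]
      have := mul_le_mul_of_nonneg_right h5 (mul_self_nonneg ((P N j).eval (v t)))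
      refine le_trans (le_of_eq ?_) this
      ring
    have hi0 := hm.integrable_polynomial_mul N (P N j) (P N j)
    have hik : ∀ k : ℕ, Integrable
        (fun t => v t ^ k * ((P N j).eval (v t) * (P N j).eval (v t))) (μ N) := by
      intro k
      have := hm.integrable_polynomial_mul N (Polynomial.X ^ k * P N j) (P N j)
      simpa only [Polynomial.eval_mul, Polynomial.eval_pow, Polynomial.eval_X, mul_assoc] using this
    have h8 := integral_mono ((((hik 2).const_mul (2 * s)).sub ((hik 4).const_mul (s ^ 2))).sub
      (hi0.const_mul (2 * s * ε ^ 2))) (hm.integrable_bounded_mul (abs_indicator_one_le B) N _ _) hpt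
    simp only [Pi.sub_apply] at h8
    have hsub : Integrable (fun t => 2 * s * (v t ^ 2 * ((P N j).eval (v t) * (P N j).eval (v t))) -
        s ^ 2 * (v t ^ 4 * ((P N j).eval (v t) * (P N j).eval (v t)))) (μ N) :=
      ((hik 2).const_mul (2 * s)).sub ((hik 4).const_mul (s ^ 2))
    rw [integral_sub hsub
      (hi0.const_mul (2 * s * ε ^ 2)), integral_sub ((hik 2).const_mul (2 * s))
      ((hik 4).const_mul (s ^ 2)), integral_const_mul, integral_const_mul, integral_const_mul,
      h4] at h8
    rw [mass, le_div_iff₀ hpos]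
    refine le_trans ?_ h8
    rw [← hH]
    have h9 : c / 2 * Q ^ 2 * H ≤
        ∫ t, v t ^ 2 * ((P N j).eval (v t) * (P N j).eval (v t)) ∂(μ N) :=
      (mul_le_mul_of_nonneg_right haN.le hpos.le).trans h2
    have h10 : powCoeff (a N) (b N) 4 j 0 * H ≤ C * Q ^ 4 * H :=
      mul_le_mul_of_nonneg_right h4' hpos.le
    have h11 : 2 * s * (c / 2 * Q ^ 2 * H) = τ * c * H := by rw [← hsQ]; ring
    have h12 : s ^ 2 * (C * Q ^ 4 * H) ≤ τ * (c / 2) * H := by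
      have e : s ^ 2 * (C * Q ^ 4 * H) = τ * (τ * C) * H := by rw [← hsQ]; ring
      rw [e]
      exact mul_le_mul_of_nonneg_right (mul_le_mul_of_nonneg_left hτC hτ.le) hpos.le
    have h13 : 2 * s * ε ^ 2 * H ≤ τ * c / 4 * H := by
      refine mul_le_mul_of_nonneg_right ?_ hpos.le
      have := mul_le_mul_of_nonneg_left hεQ hspos.le
      nlinarith
    have h14 := mul_le_mul_of_nonneg_left h9 (by positivity : (0 : ℝ) ≤ 2 * s)
    have h15 := mul_le_mul_of_nonneg_left h10 (by positivity : (0 : ℝ) ≤ s ^ 2)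
    linarith
  filter_upwards [(Finset.eventually_all _).2 hone, eventually_ge_atTop (m + 4)] with N h1 hN
  calc (m : ℝ) * (τ * c / 4) = ∑ i ∈ Finset.Ico 4 (m + 4), τ * c / 4 := by simp
    _ ≤ ∑ i ∈ Finset.Ico 4 (m + 4), mass v μ P B N (wordOf ⊥ i) := Finset.sum_le_sum h1
    _ ≤ ∑ i ∈ Finset.range N, mass v μ P B N (wordOf ⊥ i) := by
      refine Finset.sum_le_sum_of_subset_of_nonneg (fun i hi => ?_) fun i _ _ =>
        mass_nonneg B N _
      have := Finset.mem_Ico.1 hi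
      exact Finset.mem_range.2 (by omega)

end IsOrthogonalModel
end HoleBound

/-! ### Orthogonal polynomial ensembles -/

section Ensembles

variable {q α β s p : ℝ} {γ δ : ℂ}

open Classical in
/-- The configuration formed by the entries of a tuple. -/
def configOf {N : ℕ} (t : Fin N → lattice q α β) : Config q α β :=
  fun x => decide (∃ i, t i = x)

lemma configOf_apply {N : ℕ} (t : Fin N → lattice q α β) (x : lattice q α β) :
    (configOf t) x = true ↔ ∃ i, t i = x := by
  simp [configOf]

lemma evalAt_configOf {N : ℕ} {t : Fin N → lattice q α β} (ht : Function.Injective t) (F : Sym) :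
    F.evalAt (configOf t) = MvPolynomial.eval (Subtype.val ∘ t) (Sym.proj N F) := by
  have hpts : (configOf t).points = Set.range fun i => (t i : ℝ) := by
    ext x
    constructor
    · rintro ⟨h, hx⟩
      obtain ⟨i, hi⟩ := (configOf_apply t _).1 hx
      exact ⟨i, congrArg Subtype.val hi⟩
    · rintro ⟨i, rfl⟩
      exact ⟨(t i).2, (configOf_apply t _).2 ⟨i, rfl⟩⟩
  have hinj : Function.Injective fun i => (t i : ℝ) := Subtype.val_injective.comp ht
  have h1 : ∀ k : ℕ, ∑' x : (configOf t).points, (x : ℝ) ^ (k + 1) = ∑ i, (t i : ℝ) ^ (k + 1) := by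
    intro k
    rw [hpts, tsum_range (fun x : ℝ => x ^ (k + 1)) hinj, tsum_fintype]
  unfold Sym.evalAt Sym.proj
  simp only [h1]
  induction F using MvPolynomial.induction_on with
  | C r => simp
  | add F G hF hG => simp only [map_add, hF, hG]
  | mul_X F k hF =>
    simp only [map_mul, hF, MvPolynomial.aeval_X]
    simp [MvPolynomial.psum]

lemma injective_of_eval_vandermondeProd {N : ℕ} {t : Fin N → lattice q α β}
    (h : MvPolynomial.eval (Subtype.val ∘ t) (vandermondeProd N) ≠ 0) : Function.Injective t := by
  have key : ∀ i j, i < j → t i ≠ t j := by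
    intro i j hij e
    refine h ?_
    rw [vandermondeProd, map_prod]
    refine Finset.prod_eq_zero (Finset.mem_univ i) ?_
    rw [map_prod]
    refine Finset.prod_eq_zero (Finset.mem_Ioi.2 hij) ?_
    simp [e]
  intro i j e
  by_contra hne
  rcases lt_or_gt_of_ne hne with hlt | hlt
  · exact key i j hlt e
  · exact key j i hlt e.symm

/-- The density of the `N`-point orthogonal polynomial ensemble. -/
def ensembleDensity (q α β : ℝ) (γ δ : ℂ) (N : ℕ) (t : Fin N → lattice q α β) : ℝ :=
  MvPolynomial.eval (Subtype.val ∘ t) (vandermondeProd N) ^ 2 /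
    evalForm Subtype.val (shiftedMeasure q α β γ δ) N (vandermondeProd N) (vandermondeProd N)

/-- The `N`-point orthogonal polynomial ensemble, as a measure on configurations. -/
def ensemble (q α β : ℝ) (γ δ : ℂ) (N : ℕ) : Measure (Config q α β) :=
  ((Measure.pi fun _ : Fin N => shiftedMeasure q α β γ δ N).withDensity fun t =>
    ENNReal.ofReal (ensembleDensity q α β γ δ N t)).map configOf

lemma evalForm_vandermonde_pos (h : Regular q α β s p) (hs : γ + δ = s) (hp : γ * δ = p) (N : ℕ) :
    0 < evalForm Subtype.val (shiftedMeasure q α β γ δ) N (vandermondeProd N) (vandermondeProd N) := by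
  rw [← (shifted_isStable h hs hp).alternant_bot]
  exact (shifted_isOrthogonalModel h hs hp).evalForm_alternant_self_pos N ⊥

lemma ensembleDensity_nonneg (h : Regular q α β s p) (hs : γ + δ = s) (hp : γ * δ = p) (N : ℕ)
    (t : Fin N → lattice q α β) : 0 ≤ ensembleDensity q α β γ δ N t :=
  div_nonneg (sq_nonneg _) (evalForm_vandermonde_pos h hs hp N).le

lemma integral_ensemble (h : Regular q α β s p) (hs : γ + δ = s) (hp : γ * δ = p) (N : ℕ)
    {f : Config q α β → ℝ} (hf : Continuous f) :
    ∫ X, f X ∂(ensemble q α β γ δ N) =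
      (∫ t : Fin N → lattice q α β, f (configOf t) *
        MvPolynomial.eval (Subtype.val ∘ t) (vandermondeProd N) ^ 2
          ∂(Measure.pi fun _ => shiftedMeasure q α β γ δ N)) /
      evalForm Subtype.val (shiftedMeasure q α β γ δ) N (vandermondeProd N) (vandermondeProd N) := by
  unfold ensemble
  rw [integral_map (Measurable.of_discrete).aemeasurable hf.aestronglyMeasurable,
    integral_withDensity_eq_integral_toReal_smul (Measurable.of_discrete)
      (Eventually.of_forall fun _ => ENNReal.ofReal_lt_top), ← integral_div]
  refine integral_congr_ae (Eventually.of_forall fun t => ?_)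
  simp only
  rw [ENNReal.toReal_ofReal (ensembleDensity_nonneg h hs hp N t), smul_eq_mul, ensembleDensity]
  ring

lemma isProbabilityMeasure_ensemble (h : Regular q α β s p) (hs : γ + δ = s) (hp : γ * δ = p)
    (N : ℕ) : IsProbabilityMeasure (ensemble q α β γ δ N) := by
  have hm := shifted_isOrthogonalModel h hs hp
  have := hm.isFiniteMeasure
  have hZ := evalForm_vandermonde_pos h hs hp N
  unfold ensemble
  refine @Measure.isProbabilityMeasure_map _ _ _ _ _ ⟨?_⟩ _ (Measurable.of_discrete).aemeasurable
  rw [withDensity_apply _ MeasurableSet.univ, Measure.restrict_univ,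
    ← ofReal_integral_eq_lintegral_ofReal]
  · unfold ensembleDensity
    rw [integral_div]
    simp only [sq]
    rw [show ∫ t : Fin N → lattice q α β, _ ∂_ = evalForm Subtype.val (shiftedMeasure q α β γ δ) N
      (vandermondeProd N) (vandermondeProd N) from rfl, div_self hZ.ne', ENNReal.ofReal_one]
  · unfold ensembleDensity
    simp only [sq]
    exact (hm.integrable_eval_mul N _ _).div_const _
  · exact Eventually.of_forall (ensembleDensity_nonneg h hs hp N)

/-- Under the `N`-point ensemble, products of symmetric functions have expectation given by the
form on alternating polynomials. -/
lemma integral_ensemble_mul (h : Regular q α β s p) (hs : γ + δ = s) (hp : γ * δ = p) (N : ℕ)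
    (F G : Sym) :
    ∫ X, F.evalAt X * G.evalAt X ∂(ensemble q α β γ δ N) =
      evalForm Subtype.val (shiftedMeasure q α β γ δ) N (Sym.proj N F * vandermondeProd N)
        (Sym.proj N G * vandermondeProd N) /
      evalForm Subtype.val (shiftedMeasure q α β γ δ) N (vandermondeProd N) (vandermondeProd N) := by
  rw [integral_ensemble h hs hp N (f := fun X => F.evalAt X * G.evalAt X)
    ((continuous_evalAt h F).mul (continuous_evalAt h G))]
  congr 1
  refine integral_congr_ae (Eventually.of_forall fun t => ?_)
  simp only [map_mul]
  by_cases hV : MvPolynomial.eval (Subtype.val ∘ t) (vandermondeProd N) = 0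
  · simp [hV]
  · have hinj := injective_of_eval_vandermondeProd hV
    rw [evalAt_configOf hinj, evalAt_configOf hinj]
    ring

/-- The limiting squared norm of `Φ_ν`: the product of the limiting recurrence coefficients over
the contents of the boxes of `ν`. -/
def limitNorm (q α β s p : ℝ) (ν : YoungDiagram) : ℝ :=
  ∏ i ∈ Finset.range (ν.colLen 0), ∏ k ∈ Finset.range (ν.rowLen i),
    scaledRatio q α β s p 0 (q ^ (1 + ((k : ℤ) - i)))

lemma limitNorm_pos (h : Regular q α β s p) (hs : γ + δ = s) (hp : γ * δ = p) (ν : YoungDiagram) :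
    0 < limitNorm q α β s p ν :=
  Finset.prod_pos fun _ _ => Finset.prod_pos fun _ _ => (shifted_isStable h hs hp).a_pos _

lemma tendsto_integral_ensemble_mul (h : Regular q α β s p) (hs : γ + δ = s) (hp : γ * δ = p)
    (F G : Sym) {d : ℕ} (hF : F.degree ≤ d) (hG : G.degree ≤ d) :
    Tendsto (fun N => ∫ X, F.evalAt X * G.evalAt X ∂(ensemble q α β γ δ N)) atTop
      (𝓝 (∑ ν ∈ partitionsLE d,
        bigFock h hs hp F ν * bigFock h hs hp G ν * limitNorm q α β s p ν)) := by
  have hm := shifted_isOrthogonalModel h hs hp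
  have hst := shifted_isStable h hs hp
  have hlen : ∀ᶠ N in atTop, ∀ ν ∈ partitionsLE d, ν.colLen 0 ≤ N :=
    (Finset.eventually_all _).2 fun ν _ => eventually_ge_atTop _
  have h1 : Tendsto (fun N => ∑ ν ∈ partitionsLE d,
      levelCoeff Subtype.val (shiftedMeasure q α β γ δ) (shiftedPoly q α β γ δ) N ν F *
      levelCoeff Subtype.val (shiftedMeasure q α β γ δ) (shiftedPoly q α β γ δ) N ν G *
      ∏ i ∈ Finset.range (ν.colLen 0), ∏ k ∈ Finset.range (ν.rowLen i),
        shiftedA q α β s p N ((k : ℤ) - i)) atTop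
      (𝓝 (∑ ν ∈ partitionsLE d,
        bigFock h hs hp F ν * bigFock h hs hp G ν * limitNorm q α β s p ν)) :=
    tendsto_finsetSum _ fun ν _ => ((hm.tendsto_fock hst ν F).mul (hm.tendsto_fock hst ν G)).mul
      (tendsto_finsetProd _ fun i _ => tendsto_finsetProd _ fun k _ => hst.tendsto_a _)
  refine h1.congr' ?_
  filter_upwards [hlen, hm.eventually_expansion hst hF, hm.eventually_expansion hst hG]
    with N hN hFN hGN
  rw [integral_ensemble_mul h hs hp, ← hst.alternant_bot, hFN, hGN, hm.evalForm_sum_left,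
    Finset.sum_div]
  refine Finset.sum_congr rfl fun ν hν => ?_
  rw [evalForm_C_mul_left, evalForm_comm, hm.evalForm_sum_left, Finset.sum_eq_single ν]
  · rw [evalForm_C_mul_left, hm.evalForm_alternant_self_eq (hN ν hν)]
    have := (hm.evalForm_alternant_self_pos N ⊥).ne'
    field_simp
  · intro ν' hν' hne
    rw [evalForm_C_mul_left, hm.evalForm_alternant_ne hne (hN ν' hν') (hN ν hν), mul_zero]
  · exact fun hν' => absurd hν hν'

lemma prod_half_eq {ι : Type*} {B S : Finset ι} {g : ι → Bool}
    (hS : ∀ x, x ∈ S ↔ x ∈ B ∧ g x = true) :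
    (∏ x ∈ B, if g x then (1 / 2 : ℝ) else 1) = (1 / 2) ^ S.card := by
  have : S = B.filter fun x => g x = true := by
    ext x
    rw [hS, Finset.mem_filter]
  rw [this, Finset.prod_ite, Finset.prod_const, Finset.prod_const_one, mul_one]

/-- The gap functional `X ↦ 2^{-#(X ∩ B)}`. -/
def gapWeight (B : Finset (lattice q α β)) (X : Config q α β) : ℝ :=
  ∏ x ∈ B, if X x then 1 / 2 else 1

lemma continuous_gapWeight (B : Finset (lattice q α β)) :
    Continuous fun X : Config q α β => gapWeight B X := by
  refine continuous_finsetProd _ fun x _ => ?_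
  exact (continuous_of_discreteTopology (f := fun b : Bool => if b then (1 / 2 : ℝ) else 1)).comp
    (continuous_config_apply x)

lemma gapWeight_configOf (B : Finset (lattice q α β)) {N : ℕ} {t : Fin N → lattice q α β}
    (ht : Function.Injective t) :
    gapWeight B (configOf t) = ∏ i, (1 - (B : Set (lattice q α β)).indicator 1 (t i) / 2) := by
  classical
  have h1 : ∀ i, (1 - (B : Set (lattice q α β)).indicator (1 : lattice q α β → ℝ) (t i) / 2) =
      if t i ∈ B then 1 / 2 else 1 := by
    intro i
    by_cases hi : t i ∈ B
    · rw [Set.indicator_of_mem (Finset.mem_coe.2 hi), if_pos hi, Pi.one_apply]; norm_num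
    · rw [Set.indicator_of_notMem (fun h => hi (Finset.mem_coe.1 h)), if_neg hi]; norm_num
  simp only [h1]
  rw [Finset.prod_ite, Finset.prod_const, Finset.prod_const_one, mul_one,
    ← Finset.card_image_of_injective _ ht]
  refine prod_half_eq (g := configOf t) fun x => ?_
  rw [Finset.mem_image]
  constructor
  · rintro ⟨i, hi, rfl⟩
    exact ⟨(Finset.mem_filter.1 hi).2, (configOf_apply t _).2 ⟨i, rfl⟩⟩
  · rintro ⟨hx, hx'⟩
    obtain ⟨i, rfl⟩ := (configOf_apply t x).1 hx'
    exact ⟨i, Finset.mem_filter.2 ⟨Finset.mem_univ i, hx⟩, rfl⟩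

lemma integral_gapWeight_le (h : Regular q α β s p) (hs : γ + δ = s) (hp : γ * δ = p) (N : ℕ)
    (B : Finset (lattice q α β)) :
    ∫ X, gapWeight B X ∂(ensemble q α β γ δ N) ≤
      Real.exp (-(∑ i ∈ Finset.range N, mass Subtype.val (shiftedMeasure q α β γ δ)
        (shiftedPoly q α β γ δ) (B : Set (lattice q α β)) N (wordOf ⊥ i)) / 2) := by
  have hm := shifted_isOrthogonalModel h hs hp
  refine le_trans (le_of_eq ?_) (hm.integral_prod_le (B : Set (lattice q α β)) N)
  rw [integral_ensemble h hs hp N (continuous_gapWeight B),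
    (shifted_isStable h hs hp).alternant_bot]
  congr 1
  refine integral_congr_ae (Eventually.of_forall fun t => ?_)
  simp only
  by_cases hV : MvPolynomial.eval (Subtype.val ∘ t) (vandermondeProd N) = 0
  · simp [hV]
  · rw [gapWeight_configOf B (injective_of_eval_vandermondeProd hV)]

end Ensembles

/-! ### The limit measure -/

section LimitMeasure

variable {q α β s p : ℝ} {γ δ : ℂ}

/-- By compactness, the ensembles have a weak limit along an ultrafilter. -/
lemma exists_limit_measure (h : Regular q α β s p) (hs : γ + δ = s) (hp : γ * δ = p) :
    ∃ (M : Measure (Config q α β)) (U : Ultrafilter ℕ), IsProbabilityMeasure M ∧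
      (U : Filter ℕ) ≤ atTop ∧ ∀ f : C(Config q α β, ℝ),
        Tendsto (fun N => ∫ X, f X ∂(ensemble q α β γ δ N)) U (𝓝 (∫ X, f X ∂M)) := by
  let K : ℕ → ProbabilityMeasure (Config q α β) := fun N =>
    ⟨ensemble q α β γ δ N, isProbabilityMeasure_ensemble h hs hp N⟩
  let U : Ultrafilter ℕ := Ultrafilter.of atTop
  let M := (U.map K).lim
  have hM : Tendsto K U (𝓝 M) := (U.map K).le_nhds_lim
  refine ⟨M, U, inferInstance, Ultrafilter.of_le _, fun f => ?_⟩
  exact ProbabilityMeasure.tendsto_iff_forall_integral_tendsto.1 hM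
    (BoundedContinuousFunction.mkOfCompact f)

/-- A probability measure on configurations under which the coefficient map is an isometry, up to
the weights `limitNorm`, and almost all configurations are infinite. -/
lemma exists_isometric_measure (h : Regular q α β s p) (hs : γ + δ = s) (hp : γ * δ = p) :
    ∃ M : Measure (Config q α β), IsProbabilityMeasure M ∧
      (∀ (F G : Sym) (d : ℕ), F.degree ≤ d → G.degree ≤ d →
        ∫ X, F.evalAt X * G.evalAt X ∂M = ∑ ν ∈ partitionsLE d,
          bigFock h hs hp F ν * bigFock h hs hp G ν * limitNorm q α β s p ν) ∧
      M (infiniteConfigs q α β)ᶜ = 0 := by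
  obtain ⟨M, U, hM, hU, hlim⟩ := exists_limit_measure h hs hp
  refine ⟨M, hM, fun F G d hF hG => ?_, ?_⟩
  · exact tendsto_nhds_unique (hlim (evalHom h F * evalHom h G))
      ((tendsto_integral_ensemble_mul h hs hp F G hF hG).mono_left hU)
  obtain ⟨η, hη, hmass⟩ := (shifted_isOrthogonalModel h hs hp).exists_mass_ge
    (shifted_isStable h hs hp)
  have hgap : ∀ m : ℕ, ∃ B : Finset (lattice q α β),
      ∫ X, gapWeight B X ∂M ≤ Real.exp (-(m * η) / 2) := by
    intro m
    obtain ⟨ε, hε, hB⟩ := hmass m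
    have hfin : {x : lattice q α β | ε ≤ |(x : ℝ)|}.Finite := by
      have := (summable_abs_lattice h).tendsto_cofinite_zero.eventually_lt_const hε
      simpa only [Filter.eventually_cofinite, not_lt] using this
    refine ⟨hfin.toFinset, ?_⟩
    refine le_of_tendsto (hlim ⟨_, continuous_gapWeight hfin.toFinset⟩) (hU ?_)
    filter_upwards [hB (hfin.toFinset : Set (lattice q α β)) fun t ht => by
      simpa using ht] with N hN
    refine (integral_gapWeight_le h hs hp N hfin.toFinset).trans (Real.exp_le_exp.2 ?_)
    linarith
  have hcard : ∀ n : ℕ, M {X | ∀ B : Finset (lattice q α β), (1 / 2 : ℝ) ^ n ≤ gapWeight B X} = 0 := by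
    intro n
    have hle : ∀ m : ℕ, M.real {X | ∀ B : Finset (lattice q α β), (1 / 2 : ℝ) ^ n ≤ gapWeight B X} ≤
        2 ^ n * Real.exp (-(m * η) / 2) := by
      intro m
      obtain ⟨B, hB⟩ := hgap m
      have h1 : M.real {X | ∀ B : Finset (lattice q α β), (1 / 2 : ℝ) ^ n ≤ gapWeight B X} ≤
          M.real {X | (1 / 2 : ℝ) ^ n ≤ gapWeight B X} :=
        measureReal_mono fun X hX => hX B
      have h2 := mul_meas_ge_le_integral_of_nonneg (μ := M) (f := fun X => gapWeight B X)
        (Eventually.of_forall fun X => Finset.prod_nonneg fun x _ => by split_ifs <;> norm_num)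
        ((BoundedContinuousFunction.mkOfCompact ⟨_, continuous_gapWeight B⟩).integrable M)
        ((1 / 2 : ℝ) ^ n)
      have h3 : M.real {X | (1 / 2 : ℝ) ^ n ≤ gapWeight B X} =
          2 ^ n * ((1 / 2 : ℝ) ^ n * M.real {X | (1 / 2 : ℝ) ^ n ≤ gapWeight B X}) := by
        rw [← mul_assoc, ← mul_pow]; norm_num
      rw [h3] at h1
      exact h1.trans (mul_le_mul_of_nonneg_left (h2.trans hB) (by positivity))
    have hexp : Tendsto (fun m : ℕ => (2 : ℝ) ^ n * Real.exp (-(m * η) / 2)) atTop (𝓝 0) := by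
      have h4 : Tendsto (fun m : ℕ => -((m : ℝ) * η) / 2) atTop atBot := by
        have h5 : Tendsto (fun m : ℕ => (m : ℝ) * (η / 2)) atTop atTop :=
          tendsto_natCast_atTop_atTop.atTop_mul_const (by positivity)
        refine (tendsto_neg_atTop_atBot.comp h5).congr fun m => ?_
        simp only [Function.comp_apply]; ring
      simpa using (Real.tendsto_exp_atBot.comp h4).const_mul ((2 : ℝ) ^ n)
    have h6 := ge_of_tendsto' hexp hle
    exact (measureReal_eq_zero_iff).1 (le_antisymm h6 measureReal_nonneg)
  have hcover : (infiniteConfigs q α β)ᶜ ⊆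
      ⋃ n : ℕ, {X | ∀ B : Finset (lattice q α β), (1 / 2 : ℝ) ^ n ≤ gapWeight B X} := by
    intro X hX
    have hfin : X.points.Finite := by
      by_contra hinf
      exact hX hinf
    have hfin' : {x : lattice q α β | X x = true}.Finite := by
      refine Set.Finite.of_finite_image (f := Subtype.val) (hfin.subset ?_)
        Subtype.val_injective.injOn
      rintro _ ⟨x, hx, rfl⟩
      exact ⟨x.2, hx⟩
    refine Set.mem_iUnion.2 ⟨hfin'.toFinset.card, fun B => ?_⟩
    classical
    refine le_of_le_of_eq ?_ (prod_half_eq (S := B ∩ hfin'.toFinset) (g := X) fun x => by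
      rw [Finset.mem_inter, Set.Finite.mem_toFinset]; rfl).symm
    exact pow_le_pow_of_le_one (by norm_num) (by norm_num)
      (Finset.card_le_card Finset.inter_subset_right)
  exact measure_mono_null hcover (measure_iUnion_null hcard)

end LimitMeasure

/-! ### Admissible parameters -/

section Admissibility

lemma pairFactor_eq (a c d z : ℝ) :
    pairFactor a (c + d) (c * d) z = (1 - c / a * z) * (1 - d / a * z) := by
  unfold pairFactor
  ring

lemma pairFactor_pos_of_mem_Ioo {q a c d : ℝ} (hq0 : 0 < q) (hq1 : q < 1) {n : ℤ}
    (hc : c / a ∈ Set.Ioo (q ^ (n + 1)) (q ^ n)) (hd : d / a ∈ Set.Ioo (q ^ (n + 1)) (q ^ n))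
    (k : ℤ) : 0 < pairFactor a (c + d) (c * d) (q ^ k) := by
  rw [pairFactor_eq]
  have hk : 0 < q ^ k := zpow_pos hq0 k
  rcases le_or_gt 0 (n + k) with h | h
  · have hle : q ^ n * q ^ k ≤ 1 := by
      rw [← zpow_add₀ hq0.ne']
      exact zpow_le_one₀ hq0 hq1.le h
    have h1 := mul_lt_mul_of_pos_right hc.2 hk
    have h2 := mul_lt_mul_of_pos_right hd.2 hk
    exact mul_pos (by linarith) (by linarith)
  · have hle : 1 ≤ q ^ (n + 1) * q ^ k := by
      rw [← zpow_add₀ hq0.ne']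
      exact one_le_zpow_of_nonpos₀ hq0 hq1.le (by omega)
    have h1 := mul_lt_mul_of_pos_right hc.1 hk
    have h2 := mul_lt_mul_of_pos_right hd.1 hk
    exact mul_pos_of_neg_of_neg (by linarith) (by linarith)

lemma pairFactor_pos_of_neg {a c d z : ℝ} (hc : c / a < 0) (hd : d / a < 0) (hz : 0 < z) :
    0 < pairFactor a (c + d) (c * d) z := by
  rw [pairFactor_eq]
  exact mul_pos (by nlinarith) (by nlinarith)

lemma pairFactor_pos_of_im_ne_zero {a z : ℝ} {γ : ℂ} (ha : a ≠ 0) (hz : z ≠ 0) (hγ : γ.im ≠ 0) :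
    0 < pairFactor a (2 * γ.re) (γ.re ^ 2 + γ.im ^ 2) z := by
  have h1 : pairFactor a (2 * γ.re) (γ.re ^ 2 + γ.im ^ 2) z =
      (1 - γ.re * z / a) ^ 2 + (γ.im * z / a) ^ 2 := by
    unfold pairFactor
    ring
  rw [h1]
  have : γ.im * z / a ≠ 0 := div_ne_zero (mul_ne_zero hγ hz) ha
  positivity

lemma Admissible.exists_regular {q α β : ℝ} {γ δ : ℂ} (hq0 : 0 < q) (hq1 : q < 1)
    (h : Admissible q α β γ δ) :
    ∃ s p : ℝ, Regular q α β s p ∧ γ + δ = s ∧ γ * δ = p := by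
  obtain ⟨hα, hβ, ⟨him, rfl⟩ | ⟨c, d, rfl, rfl, n, ⟨hc, hd⟩ | ⟨hc, hd⟩⟩⟩ := h
  · refine ⟨2 * γ.re, γ.re ^ 2 + γ.im ^ 2, ⟨hq0, hq1, hα, hβ, by positivity, fun n => ?_,
      fun n => ?_⟩, ?_, ?_⟩
    · exact pairFactor_pos_of_im_ne_zero hα.ne' (zpow_pos hq0 n).ne' him
    · exact pairFactor_pos_of_im_ne_zero hβ.ne (zpow_pos hq0 n).ne' him
    · apply Complex.ext <;> simp [two_mul]
    · rw [Complex.mul_conj, Complex.normSq_apply]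
      push_cast
      ring
  · have hlow : 0 < α * q ^ (n + 1) := mul_pos hα (zpow_pos hq0 _)
    have hc0 : 0 < c := hlow.trans hc.1
    have hd0 : 0 < d := hlow.trans hd.1
    refine ⟨c + d, c * d, ⟨hq0, hq1, hα, hβ, mul_pos hc0 hd0, fun k => ?_, fun k => ?_⟩,
      by push_cast; rfl, by push_cast; rfl⟩
    · refine pairFactor_pos_of_mem_Ioo (n := n) hq0 hq1 ⟨?_, ?_⟩ ⟨?_, ?_⟩ k
      · rw [lt_div_iff₀ hα, mul_comm]; exact hc.1
      · rw [div_lt_iff₀ hα, mul_comm]; exact hc.2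
      · rw [lt_div_iff₀ hα, mul_comm]; exact hd.1
      · rw [div_lt_iff₀ hα, mul_comm]; exact hd.2
    · exact pairFactor_pos_of_neg (div_neg_of_pos_of_neg hc0 hβ) (div_neg_of_pos_of_neg hd0 hβ)
        (zpow_pos hq0 k)
  · have hupp : β * q ^ (n + 1) < 0 := mul_neg_of_neg_of_pos hβ (zpow_pos hq0 _)
    have hc0 : c < 0 := hc.2.trans hupp
    have hd0 : d < 0 := hd.2.trans hupp
    refine ⟨c + d, c * d, ⟨hq0, hq1, hα, hβ, mul_pos_of_neg_of_neg hc0 hd0, fun k => ?_,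
      fun k => ?_⟩, by push_cast; rfl, by push_cast; rfl⟩
    · exact pairFactor_pos_of_neg (div_neg_of_neg_of_pos hc0 hα) (div_neg_of_neg_of_pos hd0 hα)
        (zpow_pos hq0 k)
    · refine pairFactor_pos_of_mem_Ioo (n := n) hq0 hq1 ⟨?_, ?_⟩ ⟨?_, ?_⟩ k
      · rw [lt_div_iff_of_neg hβ, mul_comm]; exact hc.2
      · rw [div_lt_iff_of_neg hβ, mul_comm]; exact hc.1
      · rw [lt_div_iff_of_neg hβ, mul_comm]; exact hd.2
      · rw [div_lt_iff_of_neg hβ, mul_comm]; exact hd.1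

end Admissibility

/-! ### The orthogonal basis and uniqueness -/

section OrthogonalBasis

variable {q α β s p : ℝ} {γ δ : ℂ}

lemma memLp_evalAt (h : Regular q α β s p) (M : Measure (Config q α β)) [IsFiniteMeasure M]
    (F : Sym) : MemLp (fun X : Config q α β => F.evalAt X) 2 M := by
  obtain ⟨C, hC⟩ := isCompact_univ.exists_bound_of_continuousOn
    (continuous_evalAt h F).continuousOn
  exact MemLp.of_bound (continuous_evalAt h F).aestronglyMeasurable C
    (Eventually.of_forall fun X => hC X trivial)

lemma inner_toLp_evalAt {M : Measure (Config q α β)} {F G : Sym}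
    (hF : MemLp (fun X : Config q α β => F.evalAt X) 2 M)
    (hG : MemLp (fun X : Config q α β => G.evalAt X) 2 M) :
    inner ℝ hF.toLp hG.toLp = ∫ X, F.evalAt X * G.evalAt X ∂M := by
  rw [L2.inner_def]
  refine integral_congr_ae ?_
  filter_upwards [hF.coeFn_toLp, hG.coeFn_toLp] with X h1 h2
  rw [h1, h2, real_inner_eq_re_inner]
  simp [mul_comm]

/-- The functions `Φ_ν` are orthogonal for a measure under which the coefficient map is
isometric. -/
lemma integral_Phi_mul_Phi (h : Regular q α β s p) (hs : γ + δ = s) (hp : γ * δ = p)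
    {M : Measure (Config q α β)} (hM : ∀ (F G : Sym) (d : ℕ), F.degree ≤ d → G.degree ≤ d →
      ∫ X, F.evalAt X * G.evalAt X ∂M = ∑ ν ∈ partitionsLE d,
        bigFock h hs hp F ν * bigFock h hs hp G ν * limitNorm q α β s p ν)
    (ν ν' : YoungDiagram) :
    (ν ≠ ν' → ∫ X, (Phi q α β γ δ ν).evalAt X * (Phi q α β γ δ ν').evalAt X ∂M = 0) ∧
    0 < ∫ X, (Phi q α β γ δ ν).evalAt X * (Phi q α β γ δ ν).evalAt X ∂M := by
  classical
  constructor
  · intro hne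
    rw [hM _ _ _ (le_max_left _ _) (le_max_right _ _), bigFock_Phi, bigFock_Phi]
    refine Finset.sum_eq_zero fun κ _ => ?_
    rw [Pi.single_apply, Pi.single_apply]
    split_ifs with h1 h2
    · exact absurd (h1.symm.trans h2) hne
    all_goals simp
  · rw [hM _ _ _ (le_max_left _ ν.card) (le_max_left _ _), bigFock_Phi]
    have h1 : ∀ κ, (Pi.single ν 1 : YoungDiagram → ℝ) κ * (Pi.single ν 1 : YoungDiagram → ℝ) κ *
        limitNorm q α β s p κ = if κ = ν then limitNorm q α β s p ν else 0 := by
      intro κ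
      rw [Pi.single_apply]
      split_ifs with e
      · rw [e]; ring
      · ring
    simp only [h1, Finset.sum_ite_eq']
    rw [if_pos (mem_partitionsLE.2 (le_max_right _ _))]
    exact limitNorm_pos h hs hp ν

/-- Symmetric functions are dense in `L²`, and the functions `Φ_ν` span them. -/
lemma span_Phi_dense (h : Regular q α β s p) (hs : γ + δ = s) (hp : γ * δ = p)
    (M : Measure (Config q α β)) [IsFiniteMeasure M]
    (hΦ : ∀ ν : YoungDiagram, MemLp (fun X => (Phi q α β γ δ ν).evalAt X) 2 M) :
    (Submodule.span ℝ (Set.range fun ν => (hΦ ν).toLp)).topologicalClosure = ⊤ := by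
  rw [← Submodule.dense_iff_topologicalClosure_eq_top]
  have h1 : Dense ((evalHom h).range : Set C(Config q α β, ℝ)) := by
    rw [dense_iff_closure_eq, ← Subalgebra.topologicalClosure_coe, dense_evalHom h]
    rfl
  have h2 := (ContinuousMap.toLp_denseRange ℝ M ℝ (p := 2) (by norm_num)).dense_image
    (ContinuousMap.toLp (E := ℝ) 2 M ℝ).continuous h1
  refine h2.mono ?_
  rintro _ ⟨_, ⟨F, rfl⟩, rfl⟩
  have h3 : ContinuousMap.toLp (E := ℝ) 2 M ℝ (evalHom h F) =
      ∑ ν ∈ partitionsLE F.degree, bigFock h hs hp F ν • (hΦ ν).toLp := by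
    have h4 : evalHom h F = ∑ ν ∈ partitionsLE F.degree,
        bigFock h hs hp F ν • evalHom h (Phi q α β γ δ ν) := by
      conv_lhs => rw [eq_sum_Phi h hs hp F]
      simp only [map_sum, map_smul]
    rw [h4, map_sum]
    refine Finset.sum_congr rfl fun ν _ => ?_
    rw [map_smul]
    rfl
  change ContinuousMap.toLp (E := ℝ) 2 M ℝ (evalHom h F) ∈ _
  rw [h3]
  exact Submodule.sum_mem _ fun ν _ => Submodule.smul_mem _ _
    (Submodule.subset_span ⟨ν, rfl⟩)

lemma isOrthogonalityMeasure_of_isometric (h : Regular q α β s p) (hs : γ + δ = s)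
    (hp : γ * δ = p) {M : Measure (Config q α β)} [hprob : IsProbabilityMeasure M]
    (hM : ∀ (F G : Sym) (d : ℕ), F.degree ≤ d → G.degree ≤ d →
      ∫ X, F.evalAt X * G.evalAt X ∂M = ∑ ν ∈ partitionsLE d,
        bigFock h hs hp F ν * bigFock h hs hp G ν * limitNorm q α β s p ν) :
    IsOrthogonalityMeasure q α β γ δ M where
  isProbabilityMeasure := hprob
  memLp ν := memLp_evalAt h M _
  ne_zero ν h0 := by
    have h1 := inner_toLp_evalAt (memLp_evalAt h M (Phi q α β γ δ ν))
      (memLp_evalAt h M (Phi q α β γ δ ν))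
    rw [h0, inner_zero_left] at h1
    exact (integral_Phi_mul_Phi h hs hp hM ν ν).2.ne h1
  orthogonal ν ν' hne := by
    rw [inner_toLp_evalAt]
    exact (integral_Phi_mul_Phi h hs hp hM ν ν').1 hne
  dense_span := span_Phi_dense h hs hp M _

/-- Orthogonality to `Φ_∅ = 1` determines the expectations of all symmetric functions. -/
lemma IsOrthogonalityMeasure.integral_evalAt (h : Regular q α β s p) (hs : γ + δ = s)
    (hp : γ * δ = p) {M : Measure (Config q α β)} (hM : IsOrthogonalityMeasure q α β γ δ M)
    (F : Sym) : ∫ X, F.evalAt X ∂M = bigFock h hs hp F ⊥ := by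
  classical
  have := hM.isProbabilityMeasure
  have hΦ : ∀ ν, ∫ X, (Phi q α β γ δ ν).evalAt X ∂M = if ν = ⊥ then 1 else 0 := by
    intro ν
    split_ifs with hν
    · simp [hν, Phi_bot h hs hp, evalAt_one]
    · have h1 := hM.orthogonal ν ⊥ hν
      rw [inner_toLp_evalAt] at h1
      simpa only [Phi_bot h hs hp, evalAt_one, mul_one] using h1
  have h2 : ∀ X : Config q α β, F.evalAt X = ∑ ν ∈ partitionsLE F.degree,
      bigFock h hs hp F ν * (Phi q α β γ δ ν).evalAt X := by
    intro X
    conv_lhs => rw [eq_sum_Phi h hs hp F, evalAt_sum]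
    simp only [evalAt_smul]
  simp only [h2]
  rw [integral_finsetSum _ fun ν _ => ((hM.memLp ν).integrable (by norm_num)).const_mul _]
  simp only [integral_const_mul, hΦ, mul_ite, mul_one, mul_zero, Finset.sum_ite_eq']
  rw [if_pos (mem_partitionsLE.2 (by simp [YoungDiagram.card]))]

end OrthogonalBasis

end BigQJacobi

end

theorem theorem5 (q α β : ℝ) (γ δ : ℂ) (hq0 : 0 < q) (hq1 : q < 1)
    (hadm : BigQJacobi.Admissible q α β γ δ) :
    (∃! M : MeasureTheory.Measure (BigQJacobi.Config q α β),
      BigQJacobi.IsOrthogonalityMeasure q α β γ δ M) ∧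
    ∀ M : MeasureTheory.Measure (BigQJacobi.Config q α β),
      BigQJacobi.IsOrthogonalityMeasure q α β γ δ M →
        M (BigQJacobi.infiniteConfigs q α β)ᶜ = 0 := by
  obtain ⟨s, p, h, hs, hp⟩ := hadm.exists_regular hq0 hq1
  obtain ⟨M, hM, hiso, hinf⟩ := BigQJacobi.exists_isometric_measure h hs hp
  have horth := BigQJacobi.isOrthogonalityMeasure_of_isometric h hs hp hiso
  have huniq : ∀ M', BigQJacobi.IsOrthogonalityMeasure q α β γ δ M' → M' = M := by
    intro M' hM'
    have := hM'.isProbabilityMeasure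
    exact BigQJacobi.measure_ext_of_evalAt h fun F => by
      rw [hM'.integral_evalAt h hs hp, horth.integral_evalAt h hs hp]
  exact ⟨⟨M, horth, huniq⟩, fun M' hM' => by rw [huniq M' hM', hinf]⟩
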